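/- Let $M$ be a closed (compact, without boundary) connected smooth manifold of dimension $m\ge 3$ with first Betti number $b=\dim H_1(M,\mathbb R)\ge 1$, and let $g$ be a smooth Riemannian metric on $M$. A class in $H_1(M,\mathbb R)$ is called integral if it lies in the image of $H_1(M,\mathbb Z)\to H_1(M,\mathbb R)$, and a point $s\in H_1(M,\mathbb R)$ is said to have rational direction if $s\in\mathbb R v$ for some integral class $v$. For a smooth Riemannian metric $h$ on $M$, the stable norm $\|\cdot\|_h$ is the unique norm on $H_1(M,\mathbb R)$ such that, for every integral class $v$, $$\|v\|_h=\lim_{n\to\infty}\frac{1}{n}\,\inf\{L_h(\gamma) : \gamma \text{ a piecewise } C^1 \text{ closed curve in } M \text{ with } [\gamma]=n v \text{ in } H_1(M,\mathbb R)\},$$ where $L_h$ denotes length with respect to $h$; let $\mathcal B(h)=\{u\in H_1(M,\mathbb R) : \|u\|_h\le 1\}$ be its unit ball. Let $K\subset H_1(M,\mathbb R)$ be a convex polytope (the convex hull of a finite set) which is centrally symmetric ($-K=K$), has nonempty interior, and all of whose vertices have rational direction. Then there is a smooth Riemannian metric $g'$ on $M$ conformal to $g$ (that is, $g'=f g$ for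 some smooth function $f:M\to(0,\infty)$) such that $$\mathcal B(g')=K.$$ -/

import Mathlib

open CategoryTheory AlgebraicTopology Bundle Manifold Filter Set MeasureTheory
open scoped Manifold ContDiff Topology ENNReal Simplicial Pointwise

universe u

noncomputable section

/-! ### First homology -/

section Homology

variable (M : Type u) [TopologicalSpace M]

/-- The real singular chain complex of `M`. -/
abbrev realSingularComplex : ChainComplex (ModuleCat.{u} ℝ) ℕ :=
  ((singularChainComplexFunctor (ModuleCat.{u} ℝ)).obj (ModuleCat.of ℝ (ULift.{u} ℝ))).obj
    (TopCat.of M)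

/-- `H₁(M, ℝ)`, the first singular homology of `M` with real coefficients. -/
def realH1 : ModuleCat.{u} ℝ :=
  ((singularHomologyFunctor (ModuleCat.{u} ℝ) 1).obj (ModuleCat.of ℝ (ULift.{u} ℝ))).obj
    (TopCat.of M)

/-- The canonical vector space topology on `H₁(M, ℝ)`: the finest one making the operations
continuous. In finite dimension it is the usual one. -/
instance : TopologicalSpace (realH1 M) := moduleTopology ℝ (realH1 M)

instance : IsModuleTopology ℝ (realH1 M) := ⟨rfl⟩

variable {M}

/-- The singular `1`-simplex `σ`, as a morphism from the coefficients to the `1`-chains. -/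
def simplexMap (σ : (TopCat.toSSet.obj (TopCat.of M)) _⦋1⦌) :
    ModuleCat.of ℝ (ULift.{u} ℝ) ⟶ (realSingularComplex M).X 1 :=
  SSet.ιChainComplex _ σ

/-- The singular `1`-simplex `σ`, as a `1`-chain with coefficient `1`. -/
def simplexChain (σ : (TopCat.toSSet.obj (TopCat.of M)) _⦋1⦌) : (realSingularComplex M).X 1 :=
  (simplexMap σ).hom ⟨1⟩

/-- The homology class of a `1`-cycle. -/
def cycleClass (z : (realSingularComplex M).cycles 1) : realH1 M :=
  ((realSingularComplex M).homologyπ 1).hom z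

/-- Integral classes: the image of `H₁(M, ℤ)` in `H₁(M, ℝ)`, that is, the classes of the cycles
which are integral linear combinations of singular simplices. -/
def IsIntegralClass (v : realH1 M) : Prop :=
  ∃ z : (realSingularComplex M).cycles 1,
    ((realSingularComplex M).iCycles 1).hom z ∈ AddSubgroup.closure (range (simplexChain (M := M)))
      ∧ cycleClass z = v

/-- A point has rational direction if it lies on the line spanned by an integral class. -/
def HasRationalDirection (s : realH1 M) : Prop :=
  ∃ v : realH1 M, IsIntegralClass v ∧ s ∈ Submodule.span ℝ {v}

/-- A path, as a singular `1`-simplex. -/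
def pathSimplex {x y : M} (γ : Path x y) : (TopCat.toSSet.obj (TopCat.of M)) _⦋1⦌ :=
  TopCat.toSSetObj₁Equiv.symm (TopCat.pathEquiv (X := TopCat.of M).symm γ).hom

lemma pathSimplex_comp_d {x : M} (γ : Path x x) :
    simplexMap (pathSimplex γ) ≫ (realSingularComplex M).d 1 0 = 0 := by
  refine (SSet.ιChainComplex_d (R := ModuleCat.of ℝ (ULift.{u} ℝ)) _ _).trans ?_
  have h0 : (TopCat.pathEquiv (X := TopCat.of M).symm γ).hom 0 = x :=
    (TopCat.pathEquiv (X := TopCat.of M).symm γ).hom₀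
  have h1 : (TopCat.pathEquiv (X := TopCat.of M).symm γ).hom 1 = x :=
    (TopCat.pathEquiv (X := TopCat.of M).symm γ).hom₁
  simp [Fin.sum_univ_two, pathSimplex, h0, h1]
  rfl

/-- A closed curve, as a `1`-cycle. -/
def loopCycle {x : M} (γ : Path x x) : (realSingularComplex M).cycles 1 :=
  ((realSingularComplex M).liftCycles (simplexMap (pathSimplex γ)) 0 (by simp)
    (pathSimplex_comp_d γ)).hom ⟨1⟩

/-- The real homology class of a closed curve. -/
def loopClass {x : M} (γ : Path x x) : realH1 M := cycleClass (loopCycle γ)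

end Homology

/-! ### Stable norm -/

section Stable

variable {m : ℕ} {M : Type u} [TopologicalSpace M] [ChartedSpace (EuclideanSpace ℝ (Fin m)) M]
  [IsManifold (𝓡 m) ∞ M]

variable (m M) in
/-- Smooth Riemannian metrics on `M`. -/
abbrev SmoothMetric :=
  ContMDiffRiemannianMetric (𝓡 m) ∞ (EuclideanSpace ℝ (Fin m))
    (fun x : M ↦ TangentSpace (𝓡 m) x)

/-- `g'` is conformal to `g`: it is `g` multiplied by a smooth positive function. -/
def IsConformalTo (g g' : SmoothMetric m M) : Prop :=
  ∃ f : M → ℝ, ContMDiff (𝓡 m) 𝓘(ℝ) ∞ f ∧ (∀ x, 0 < f x) ∧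
    ∀ (x : M) (v w : TangentSpace (𝓡 m) x), g'.inner x v w = f x * g.inner x v w

variable (m) in
/-- A curve defined on `[0, 1]` is piecewise `C¹` if it is continuous and `C¹` on each of
the closed intervals of a finite subdivision. -/
def IsPiecewiseC1 (γ : ℝ → M) : Prop :=
  ContinuousOn γ (Icc 0 1) ∧ ∃ (n : ℕ) (t : ℕ → ℝ), Monotone t ∧ t 0 = 0 ∧ t n = 1 ∧
    ∀ i < n, ContMDiffOn 𝓘(ℝ) (𝓡 m) 1 γ (Icc (t i) (t (i + 1)))

/-- The length of a curve on `[0, 1]` for the metric `g`. -/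
def curveLength (g : SmoothMetric m M) (γ : ℝ → M) : ℝ≥0∞ :=
  letI : RiemannianBundle (fun x : M ↦ TangentSpace (𝓡 m) x) := ⟨g.toRiemannianMetric⟩
  pathELength (𝓡 m) γ 0 1

/-- The infimum of the lengths of the closed curves in the homology class `v`. -/
def minLength (g : SmoothMetric m M) (v : realH1 M) : ℝ≥0∞ :=
  ⨅ (x : M) (γ : Path x x) (_ : IsPiecewiseC1 m γ.extend) (_ : loopClass γ = v),
    curveLength g γ.extend

/-- `N` is the stable norm of `g`: the (unique) norm on `H₁(M, ℝ)` whose value at each integral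
class `v` is the limit of `L(n v) / n`, where `L(n v)` is the minimal length of a closed curve in
the class `n v`. -/
structure IsStableNorm (g : SmoothMetric m M) (N : Seminorm ℝ (realH1 M)) : Prop where
  definite : ∀ u, N u = 0 → u = 0
  tendsto : ∀ v, IsIntegralClass v →
    Tendsto (fun n : ℕ ↦ minLength g (n • v) / n) atTop (𝓝 (ENNReal.ofReal (N v)))

end Stable

end

/-! Let `N` be the gauge of `K`, a norm because `K` is a symmetric convex body, and for each nonzero
vertex `s` let `w s` be an integral class positively proportional to `s`. It suffices to find a
conformal metric for which every closed curve is at least as long as the `N`-norm of its class,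
while each `w s` is the class of a closed curve of length exactly `N (w s)`.

Construction of the metric. Since the dimension is at least three, general position yields disjoint
embedded circles in the classes `w s` (`exists_disjoint_embedded`). Consider a closed 1-form `ω`
with values in `H₁(M, ℝ)` whose integral over each loop is the class of the loop. Adding an exact
form, one may assume that near the circle of class `w s` it is `dθ ⊗ w s`, where `θ` is a local time
function along the circle and `dθ` is metrically dual to the velocity there (`exists_isAdaptedAt`).
The conformal factor `f` has to satisfy `N (ω v) ^ 2 ≤ f * g v v` everywhere, and the circles must
have speed `N (w s)` for `f g`. Near a circle, `N (w s) ^ 2 * |dθ| ^ 2` does both; elsewhere large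
constants do. These conditions are convex in `f`, so local choices are glued by a partition of unity
(`exists_conformal_factor`). Integrating `ω` along a closed curve then bounds its length below by
the norm of its class (`exists_conformal_metric`).

No de Rham theory is needed. The form is replaced by a function `Ψ` on continuous paths which is
additive on the sides of triangles (`IsPathCocycle`) and equals the homology class on loops
(`exists_pathCocycle_loopClass`). It has local primitives `k`, possibly discontinuous; a single
function `F` on `M` makes all differences `k - F` smooth, and `ω` is their common differential. All
homotopy arguments are consequences of the triangle identity.

The stable norm. The lower bound is immediate. For the upper bound, an integral class `v` lies in
the cone over a simplex spanned by vertices in a face: it is a nonnegative combination of linearly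
independent vertices, with coefficients of sum `N v` (`exists_seminorm_of_polytope`). Its
coefficients with respect to the integral classes `w s` are rational (`exists_rat_of_integral`), so
with a common denominator `D` the class `D • v` is a sum of natural multiples of the `w s`. Winding
around the circles, with connecting paths travelled forth and back, represents `n • v` by a closed
curve of length at most `n * N v` plus a constant independent of `n` (`exists_minLength_le`). -/

noncomputable section

/-! ### Paths and singular chains -/

section PathClasses

variable {M : Type u} [TopologicalSpace M]

/-- A continuous map on the unit interval, as a singular `1`-simplex. -/
def edgeSimplex (p : C(unitInterval, M)) : (TopCat.toSSet.obj (TopCat.of M)) _⦋1⦌ :=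
  (TopCat.toSSetObjEquiv (TopCat.of M) (.op ⦋1⦌)).symm
    (p.comp (toContinuousMap stdSimplexHomeomorphUnitInterval))

lemma edgeSimplex_surjective (σ : (TopCat.toSSet.obj (TopCat.of M)) _⦋1⦌) :
    ∃ p : C(unitInterval, M), edgeSimplex p = σ := by
  refine ⟨(TopCat.toSSetObjEquiv (TopCat.of M) (.op ⦋1⦌) σ).comp
    (toContinuousMap stdSimplexHomeomorphUnitInterval.symm), ?_⟩
  unfold edgeSimplex
  rw [Equiv.symm_apply_eq]
  ext x
  simp

/-- The straight segment from `A` to `B` in the plane, parametrized by the unit interval. -/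
def planeSeg (A B : ℝ × ℝ) : C(unitInterval, ℝ × ℝ) :=
  ⟨fun t ↦ (1 - (t : ℝ)) • A + (t : ℝ) • B, by fun_prop⟩

/-- The affine map from the standard triangle to the plane with given vertices. -/
def planeTriangle (A B C : ℝ × ℝ) : C(stdSimplex ℝ (Fin 3), ℝ × ℝ) where
  toFun s := s.1 0 • A + s.1 1 • B + s.1 2 • C
  continuous_toFun := by
    have h : ∀ i : Fin 3, Continuous fun s : stdSimplex ℝ (Fin 3) ↦ s.1 i := fun i ↦
      (continuous_apply i).comp continuous_subtype_val
    exact (((h 0).smul continuous_const).add ((h 1).smul continuous_const)).add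
      ((h 2).smul continuous_const)

/-- The singular `2`-simplex obtained by restricting `H` to an affine triangle. -/
def triangleSimplex (H : C(ℝ × ℝ, M)) (A B C : ℝ × ℝ) :
    (TopCat.toSSet.obj (TopCat.of M)) _⦋2⦌ :=
  (TopCat.toSSetObjEquiv (TopCat.of M) (.op ⦋2⦌)).symm (H.comp (planeTriangle A B C))

lemma toSSetObjEquiv_δ (X : TopCat.{u}) (n : ℕ) (i : Fin (n + 2))
    (σ : (TopCat.toSSet.obj X) _⦋n + 1⦌) (s) :
    TopCat.toSSetObjEquiv X (.op ⦋n⦌) ((TopCat.toSSet.obj X).δ i σ) s =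
      TopCat.toSSetObjEquiv X (.op ⦋n + 1⦌) σ (stdSimplex.map (SimplexCategory.δ i) s) :=
  rfl

/-- Stated for an arbitrary map of vertices, so that the three faces are treated at once. -/
lemma planeTriangle_map (A B C : ℝ × ℝ) (f : Fin 2 → Fin 3) (s : stdSimplex ℝ (Fin 2)) :
    planeTriangle A B C (stdSimplex.map f s) =
      s.1 0 • (![A, B, C] (f 0)) + s.1 1 • (![A, B, C] (f 1)) := by
  have h1 : planeTriangle A B C (stdSimplex.map f s) =
      ∑ j : Fin 3, (stdSimplex.map f s : Fin 3 → ℝ) j • (![A, B, C] j) := by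
    rw [Fin.sum_univ_three]; rfl
  rw [h1]
  simp only [stdSimplex.map_coe, FunOnFinite.linearMap_apply_apply, Finset.sum_smul]
  rw [show s.1 0 • (![A, B, C] (f 0)) + s.1 1 • (![A, B, C] (f 1)) =
    ∑ i : Fin 2, s.1 i • (![A, B, C] (f i)) by rw [Fin.sum_univ_two],
    ← Finset.sum_fiberwise Finset.univ f (fun i ↦ s.1 i • (![A, B, C] (f i)))]
  refine Finset.sum_congr rfl fun j _ ↦ Finset.sum_congr rfl fun i hi ↦ ?_
  rw [(Finset.mem_filter.1 hi).2]
  rfl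

lemma triangleSimplex_δ (H : C(ℝ × ℝ, M)) (A B C : ℝ × ℝ) (i : Fin 3) :
    (TopCat.toSSet.obj (TopCat.of M)).δ i (triangleSimplex H A B C) =
      edgeSimplex (H.comp (planeSeg (![A, B, C] (i.succAbove 0)) (![A, B, C] (i.succAbove 1)))) := by
  apply (TopCat.toSSetObjEquiv (TopCat.of M) (.op ⦋1⦌)).injective
  ext s
  rw [toSSetObjEquiv_δ]
  simp only [triangleSimplex, edgeSimplex, Equiv.apply_symm_apply]
  change H (planeTriangle A B C _) = H (planeSeg _ _ (stdSimplexHomeomorphUnitInterval s))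
  rw [planeTriangle_map]
  congr 1
  have h1 : s.1 0 = 1 - s.1 1 := eq_sub_of_add_eq (stdSimplex.add_eq_one s)
  rw [h1]
  rfl

/-- The singular `n`-simplex `σ`, as an `n`-chain with coefficient `a`. -/
def chainSingle {n : ℕ} (σ : (TopCat.toSSet.obj (TopCat.of M)) _⦋n⦌) :
    ℝ →ₗ[ℝ] (realSingularComplex M).X n :=
  (show ModuleCat.of ℝ (ULift.{u} ℝ) ⟶ (realSingularComplex M).X n from
    SSet.ιChainComplex _ σ).hom ∘ₗ (ULift.moduleEquiv (R := ℝ) (M := ℝ)).symm.toLinearMap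

lemma simplexChain_eq_chainSingle (σ : (TopCat.toSSet.obj (TopCat.of M)) _⦋1⦌) :
    simplexChain σ = chainSingle σ 1 := rfl

lemma d_chainSingle {n : ℕ} (σ : (TopCat.toSSet.obj (TopCat.of M)) _⦋n + 1⦌) (a : ℝ) :
    ((realSingularComplex M).d (n + 1) n).hom (chainSingle σ a) =
      ∑ i : Fin (n + 2), (-1 : ℤ) ^ i.val •
        chainSingle ((TopCat.toSSet.obj (TopCat.of M)).δ i σ) a := by
  have h1 := congrArg (fun f ↦ f.hom (ULift.up a))
    (SSet.ιChainComplex_d (R := ModuleCat.of ℝ (ULift.{u} ℝ)) _ σ)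
  refine h1.trans ?_
  rw [ModuleCat.hom_sum, LinearMap.sum_apply]
  rfl

/-- The class of a path modulo boundaries. -/
def edgeClass (p : C(unitInterval, M)) : (realSingularComplex M).opcycles 1 :=
  ((realSingularComplex M).pOpcycles 1).hom (simplexChain (edgeSimplex p))

lemma pOpcycles_d (z : (realSingularComplex M).X 2) :
    ((realSingularComplex M).pOpcycles 1).hom (((realSingularComplex M).d 2 1).hom z) = 0 := by
  rw [← LinearMap.comp_apply, ← ModuleCat.hom_comp, HomologicalComplex.d_pOpcycles]
  rfl

/-- The boundary of the singular triangle is `BC - AC + AB`, and boundaries vanish in `opcycles`.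
Degenerate triangles are allowed, which makes this one relation sufficient for subdivision, reversal
and homotopy. -/
lemma edgeClass_triangle (H : C(ℝ × ℝ, M)) (A B C : ℝ × ℝ) :
    edgeClass (H.comp (planeSeg A B)) + edgeClass (H.comp (planeSeg B C)) =
      edgeClass (H.comp (planeSeg A C)) := by
  have h := pOpcycles_d (chainSingle (triangleSimplex H A B C) 1)
  rw [d_chainSingle, Fin.sum_univ_three, triangleSimplex_δ, triangleSimplex_δ,
    triangleSimplex_δ] at h
  simp only [map_add, map_zsmul] at h
  have h5 : (-1 : ℤ) ^ 0 • edgeClass (H.comp (planeSeg B C)) +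
      (-1 : ℤ) ^ 1 • edgeClass (H.comp (planeSeg A C)) +
      (-1 : ℤ) ^ 2 • edgeClass (H.comp (planeSeg A B)) = 0 := h
  simp only [pow_zero, one_smul, pow_one, neg_smul, even_two, Even.neg_pow, one_pow] at h5
  rw [← sub_eq_zero, ← h5]
  abel

/-- Homology embeds in chains modulo boundaries, where open arcs have classes too; identities
between classes of loops can be checked there after cutting the loops. -/
lemma homologyι_loopClass {x : M} (γ : Path x x) :
    ((realSingularComplex M).homologyι 1).hom (loopClass γ) = edgeClass γ.toContinuousMap := by
  have h1 : ((realSingularComplex M).homologyι 1).hom (((realSingularComplex M).homologyπ 1).hom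
      (loopCycle γ)) = ((realSingularComplex M).pOpcycles 1).hom
      (((realSingularComplex M).iCycles 1).hom (loopCycle γ)) := by
    rw [← LinearMap.comp_apply, ← ModuleCat.hom_comp, HomologicalComplex.homology_π_ι]
    rfl
  refine h1.trans ?_
  have h2 : ((realSingularComplex M).iCycles 1).hom (loopCycle γ) =
      simplexChain (edgeSimplex γ.toContinuousMap) := by
    unfold loopCycle
    rw [← LinearMap.comp_apply, ← ModuleCat.hom_comp, HomologicalComplex.liftCycles_i]
    rfl
  rw [h2]
  rfl

lemma homologyι_injective :
    Function.Injective ((realSingularComplex M).homologyι 1).hom :=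
  (ModuleCat.mono_iff_injective _).1 inferInstance

end PathClasses
end

noncomputable section

/-! ### Additive path functionals -/

section PathCocycle

variable {M : Type*} [TopologicalSpace M] {A : Type*} [AddCommGroup A]

/-- A function on paths is a cocycle if it is additive on the sides of every singular triangle. -/
def IsPathCocycle (Ψ : C(unitInterval, M) → A) : Prop :=
  ∀ (H : C(ℝ × ℝ, M)) (P Q R : ℝ × ℝ),
    Ψ (H.comp (planeSeg P Q)) + Ψ (H.comp (planeSeg Q R)) = Ψ (H.comp (planeSeg P R))

/-- The restriction of a curve to the segment from `a` to `b`, reparametrized by `[0, 1]`. -/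
def arc (c : C(ℝ, M)) (a b : ℝ) : C(unitInterval, M) :=
  c.comp ⟨fun t ↦ (1 - (t : ℝ)) * a + t * b, by fun_prop⟩

lemma arc_apply (c : C(ℝ, M)) (a b : ℝ) (t : unitInterval) :
    arc c a b t = c ((1 - (t : ℝ)) * a + t * b) := rfl

lemma arc_mem (c : C(ℝ, M)) {a b : ℝ} (hab : a ≤ b) (t : unitInterval) :
    ∃ s ∈ Icc a b, arc c a b t = c s :=
  ⟨(1 - (t : ℝ)) * a + t * b,
    ⟨by nlinarith [t.2.1, t.2.2], by nlinarith [t.2.1, t.2.2]⟩, rfl⟩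

namespace IsPathCocycle

variable {Ψ : C(unitInterval, M) → A} (hΨ : IsPathCocycle Ψ)
include hΨ

/-- Apply the triangle identity to a flat triangle on the first axis, mapped by `c` through the
first projection. -/
lemma arc_add (c : C(ℝ, M)) (a b d : ℝ) :
    Ψ (arc c a b) + Ψ (arc c b d) = Ψ (arc c a d) := by
  have h := hΨ (c.comp ⟨Prod.fst, continuous_fst⟩) (a, 0) (b, 0) (d, 0)
  exact h

lemma arc_self (c : C(ℝ, M)) (a : ℝ) : Ψ (arc c a a) = 0 := by
  simpa using hΨ.arc_add c a a a

lemma arc_swap (c : C(ℝ, M)) (a b : ℝ) : Ψ (arc c b a) = -Ψ (arc c a b) := by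
  rw [eq_neg_iff_add_eq_zero, hΨ.arc_add, hΨ.arc_self]

lemma const (x : M) : Ψ (ContinuousMap.const _ x) = 0 :=
  hΨ.arc_self (ContinuousMap.const _ x) 0

lemma trans {x y z : M} (γ : Path x y) (δ : Path y z) :
    Ψ (γ.trans δ).toContinuousMap = Ψ γ.toContinuousMap + Ψ δ.toContinuousMap := by
  let c : C(ℝ, M) := ⟨(γ.trans δ).extend, (γ.trans δ).continuous_extend⟩
  have h1 : arc c 0 1 = (γ.trans δ).toContinuousMap := by
    ext t
    simp [arc_apply, c]
  have h2 : arc c 0 (1 / 2) = γ.toContinuousMap := by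
    ext t
    have ht := t.2
    have e : (1 - (t : ℝ)) * 0 + t * (1 / 2) = (t : ℝ) / 2 := by ring
    change (γ.trans δ).extend ((1 - (t : ℝ)) * 0 + t * (1 / 2)) = γ t
    rw [e, Path.extend_apply _ ⟨by linarith [ht.1], by linarith [ht.2]⟩, Path.trans_apply]
    rw [dif_pos (by simp only []; linarith [ht.2])]
    congr 1
    ext
    simp only []
    ring
  have h3 : arc c (1 / 2) 1 = δ.toContinuousMap := by
    ext t
    have ht := t.2
    have e : (1 - (t : ℝ)) * (1 / 2) + t * 1 = (1 + (t : ℝ)) / 2 := by ring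
    change (γ.trans δ).extend ((1 - (t : ℝ)) * (1 / 2) + t * 1) = δ t
    rw [e, Path.extend_apply _ ⟨by linarith [ht.1], by linarith [ht.2]⟩, Path.trans_apply]
    split_ifs with h
    · simp only [] at h
      -- The midpoint belongs to the first branch of `Path.trans`, which forces `t = 0`.
      have h0 : t = 0 := Subtype.ext (le_antisymm (by simp only [Icc.coe_zero]; linarith) ht.1)
      subst h0
      simp
    · congr 1
      ext
      simp only []
      ring
  rw [← h1, ← h2, ← h3, hΨ.arc_add]

lemma symm {x y : M} (γ : Path x y) : Ψ γ.symm.toContinuousMap = -Ψ γ.toContinuousMap := by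
  let c : C(ℝ, M) := ⟨γ.extend, γ.continuous_extend⟩
  have h1 : arc c 0 1 = γ.toContinuousMap := by
    ext t
    simp [arc_apply, c]
  have h2 : arc c 1 0 = γ.symm.toContinuousMap := by
    ext t
    have e : (1 - (t : ℝ)) * 1 + t * 0 = ((unitInterval.symm t : unitInterval) : ℝ) := by
      simp
    change γ.extend ((1 - (t : ℝ)) * 1 + t * 0) = γ.symm t
    rw [e, Path.extend_apply _ (unitInterval.symm t).2]
    rfl
  rw [← h1, ← h2, hΨ.arc_swap]

/-- Freely homotopic loops have the same value. -/
lemma eq_of_freeHomotopy (H : C(ℝ × ℝ, M)) (h : ∀ s, H (s, 0) = H (s, 1)) :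
    Ψ (H.comp (planeSeg (0, 0) (0, 1))) = Ψ (H.comp (planeSeg (1, 0) (1, 1))) := by
  -- Both ways around the square from `(0, 0)` to `(1, 1)` have the value of the diagonal, and the
  -- two sides on which the loop parameter is constant carry the same path.
  have h1 := hΨ H (0, 0) (0, 1) (1, 1)
  have h2 := hΨ H (0, 0) (1, 0) (1, 1)
  have h3 : H.comp (planeSeg (0, 1) (1, 1)) = H.comp (planeSeg (0, 0) (1, 0)) := by
    ext t
    simp [planeSeg, h]
  rw [h3] at h1
  rw [← h2, add_comm] at h1
  exact add_left_cancel h1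

/-- Paths homotopic relative to their ends have the same value. -/
lemma eq_of_homotopy (H : C(ℝ × ℝ, M)) (h0 : ∀ s, H (s, 0) = H (0, 0))
    (h1 : ∀ s, H (s, 1) = H (0, 1)) :
    Ψ (H.comp (planeSeg (0, 0) (0, 1))) = Ψ (H.comp (planeSeg (1, 0) (1, 1))) := by
  have e1 := hΨ H (0, 0) (0, 1) (1, 1)
  have e2 := hΨ H (0, 0) (1, 0) (1, 1)
  have h3 : H.comp (planeSeg (0, 1) (1, 1)) = ContinuousMap.const _ (H (0, 1)) := by
    ext t
    simp [planeSeg, h1]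
  have h4 : H.comp (planeSeg (0, 0) (1, 0)) = ContinuousMap.const _ (H (0, 0)) := by
    ext t
    simp [planeSeg, h0]
  rw [h3, hΨ.const, add_zero] at e1
  rw [h4, hΨ.const, zero_add] at e2
  rw [e1, e2]

end IsPathCocycle

end PathCocycle

/-! ### Integral classes -/

section Integral

variable {M : Type u} [TopologicalSpace M]

lemma isPathCocycle_edgeClass : IsPathCocycle (edgeClass (M := M)) := edgeClass_triangle

/-- Chains are finitely supported functions on singular simplices. -/
def chainEquiv (n : ℕ) :
    ((TopCat.toSSet.obj (TopCat.of M)) _⦋n⦌ →₀ ℝ) ≃ₗ[ℝ] (realSingularComplex M).X n := by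
  let S := (TopCat.toSSet.obj (TopCat.of M)) _⦋n⦌
  let f : ModuleCat.of ℝ (S →₀ ℝ) ⟶ (realSingularComplex M).X n :=
    ModuleCat.ofHom (Finsupp.lsum ℝ fun σ ↦ chainSingle σ)
  -- The inverse comes from the universal property of the coproduct which defines the chains.
  let k : (realSingularComplex M).X n ⟶ ModuleCat.of ℝ (S →₀ ℝ) :=
    Limits.Sigma.desc (f := fun _ : S ↦ ModuleCat.of ℝ (ULift.{u} ℝ)) fun σ ↦
      ModuleCat.ofHom ((Finsupp.lsingle σ).comp (ULift.moduleEquiv (R := ℝ) (M := ℝ)).toLinearMap)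
  have hk : ∀ (σ : S) (a : ℝ), k.hom (chainSingle σ a) = Finsupp.single σ a := by
    intro σ a
    have h := congrArg (fun f ↦ f.hom (ULift.up a)) (Limits.Sigma.ι_desc
      (f := fun _ : S ↦ ModuleCat.of ℝ (ULift.{u} ℝ)) (fun σ ↦
      ModuleCat.ofHom ((Finsupp.lsingle σ).comp
        (ULift.moduleEquiv (R := ℝ) (M := ℝ)).toLinearMap)) σ)
    exact h
  have h1 : k ≫ f = 𝟙 _ := by
    apply SSet.chainComplex_hom_ext (X := TopCat.toSSet.obj (TopCat.of M))
      (R := ModuleCat.of ℝ (ULift.{u} ℝ)) (n := n)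
    intro σ
    ext a
    change f.hom (k.hom (chainSingle σ a.down)) = chainSingle σ a.down
    rw [hk]
    change (Finsupp.lsum ℝ fun σ ↦ chainSingle σ) _ = _
    simp
  have h2 : f ≫ k = 𝟙 _ := by
    ext σ : 3
    ext
    change k.hom ((Finsupp.lsum ℝ fun σ ↦ chainSingle σ) (Finsupp.single σ 1)) _ =
      Finsupp.single σ 1 _
    rw [Finsupp.lsum_single, hk]
  exact LinearEquiv.ofLinearMap f.hom k.hom (by rw [← ModuleCat.hom_comp, h1]; rfl)
    (by rw [← ModuleCat.hom_comp, h2]; rfl)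

lemma chainEquiv_single {n : ℕ} (σ : (TopCat.toSSet.obj (TopCat.of M)) _⦋n⦌) (a : ℝ) :
    chainEquiv n (Finsupp.single σ a) = chainSingle σ a := by
  change (Finsupp.lsum ℝ fun σ ↦ chainSingle σ) (Finsupp.single σ a) = _
  simp

@[elab_as_elim]
lemma chain_induction {n : ℕ} {p : (realSingularComplex M).X n → Prop}
    (hadd : ∀ x y, p x → p y → p (x + y)) (hzero : p 0) (hsingle : ∀ σ a, p (chainSingle σ a))
    (z : (realSingularComplex M).X n) : p z := by
  obtain ⟨f, rfl⟩ := (chainEquiv n).surjective z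
  induction f using Finsupp.induction_linear with
  | zero => simpa using hzero
  | add f g hf hg => simpa using hadd _ _ hf hg
  | single σ a => rw [chainEquiv_single]; exact hsingle σ a

/-- The additive endomorphism of the chains which applies `ρ` to the coefficients. -/
def mapCoeff (ρ : ℝ →+ ℝ) (n : ℕ) : (realSingularComplex M).X n →+ (realSingularComplex M).X n :=
  (chainEquiv n).toAddEquiv.toAddMonoidHom.comp
    ((Finsupp.mapRange.addMonoidHom ρ).comp (chainEquiv n).symm.toAddEquiv.toAddMonoidHom)

lemma mapCoeff_chainSingle (ρ : ℝ →+ ℝ) {n : ℕ} (σ : (TopCat.toSSet.obj (TopCat.of M)) _⦋n⦌)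
    (a : ℝ) : mapCoeff ρ n (chainSingle σ a) = chainSingle σ (ρ a) := by
  change chainEquiv n (Finsupp.mapRange ρ ρ.map_zero ((chainEquiv n).symm (chainSingle σ a))) = _
  rw [← chainEquiv_single, LinearEquiv.symm_apply_apply, Finsupp.mapRange_single,
    chainEquiv_single]

/-- The boundary has integral coefficients, so it commutes with additive changes of coefficients,
linear or not. -/
lemma mapCoeff_d (ρ : ℝ →+ ℝ) (n : ℕ) (z : (realSingularComplex M).X (n + 1)) :
    mapCoeff ρ n (((realSingularComplex M).d (n + 1) n).hom z) =
      ((realSingularComplex M).d (n + 1) n).hom (mapCoeff ρ (n + 1) z) := by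
  induction z using chain_induction with
  | hadd x y hx hy => simp only [map_add, hx, hy]
  | hzero => simp only [map_zero]
  | hsingle σ a =>
    rw [mapCoeff_chainSingle, d_chainSingle, d_chainSingle, map_sum]
    simp only [map_zsmul, mapCoeff_chainSingle]

lemma mapCoeff_smul (ρ : ℝ →+ ℝ) {z : (realSingularComplex M).X 1}
    (hz : z ∈ AddSubgroup.closure (range (simplexChain (M := M)))) (a : ℝ) :
    mapCoeff ρ 1 (a • z) = ρ a • z := by
  induction hz using AddSubgroup.closure_induction with
  | mem x hx =>
    obtain ⟨σ, rfl⟩ := hx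
    rw [simplexChain_eq_chainSingle, ← map_smul, mapCoeff_chainSingle, ← map_smul]
    simp
  | zero => simp
  | add x y _ _ hx hy => rw [smul_add, map_add, hx, hy, smul_add]
  | neg x _ hx => rw [smul_neg, map_neg, hx, smul_neg]

lemma exists_d_eq {z : (realSingularComplex M).X 1}
    (hz : ((realSingularComplex M).pOpcycles 1).hom z = 0) :
    ∃ y, ((realSingularComplex M).d 2 1).hom y = z := by
  have h : (ShortComplex.mk ((realSingularComplex M).d 2 1) ((realSingularComplex M).pOpcycles 1)
      (HomologicalComplex.d_pOpcycles _ _ _)).Exact :=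
    ShortComplex.exact_of_g_is_cokernel _
      ((realSingularComplex M).opcyclesIsCokernel 2 1 (by simp))
  exact (ShortComplex.moduleCat_exact_iff _).1 h z hz

lemma homologyι_cycleClass (z : (realSingularComplex M).cycles 1) :
    ((realSingularComplex M).homologyι 1).hom (cycleClass z) =
      ((realSingularComplex M).pOpcycles 1).hom (((realSingularComplex M).iCycles 1).hom z) := by
  have h1 : ((realSingularComplex M).homologyι 1).hom (((realSingularComplex M).homologyπ 1).hom
      z) = ((realSingularComplex M).pOpcycles 1).hom
      (((realSingularComplex M).iCycles 1).hom z) := by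
    rw [← LinearMap.comp_apply, ← ModuleCat.hom_comp, HomologicalComplex.homology_π_ι]
    rfl
  exact h1

/-- `H₁(M, ℝ)` in the space of chains modulo boundaries. -/
def h1Incl (M : Type u) [TopologicalSpace M] :
    realH1 M →ₗ[ℝ] (realSingularComplex M).opcycles 1 :=
  ((realSingularComplex M).homologyι 1).hom

lemma h1Incl_injective : Function.Injective (h1Incl M) := homologyι_injective

lemma h1Incl_loopClass {x : M} (γ : Path x x) :
    h1Incl M (loopClass γ) = edgeClass γ.toContinuousMap := homologyι_loopClass γ

lemma IsIntegralClass.exists_chain {v : realH1 M} (hv : IsIntegralClass v) :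
    ∃ z ∈ AddSubgroup.closure (range (simplexChain (M := M))),
      ((realSingularComplex M).d 1 0).hom z = 0 ∧
      h1Incl M v = ((realSingularComplex M).pOpcycles 1).hom z := by
  obtain ⟨z, hz, rfl⟩ := hv
  refine ⟨_, hz, ?_, homologyι_cycleClass z⟩
  rw [← LinearMap.comp_apply, ← ModuleCat.hom_comp, HomologicalComplex.iCycles_d]
  rfl

/-- Real relations between integral classes persist under additive maps of the coefficients. -/
theorem sum_smul_eq_of_integral {ι : Type*} (s : Finset ι) (a : ι → ℝ) (w : ι → realH1 M)
    (hw : ∀ i, IsIntegralClass (w i)) {v : realH1 M} (hv : IsIntegralClass v)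
    (h : v = ∑ i ∈ s, a i • w i) (ρ : ℝ →+ ℝ) (hρ : ρ 1 = 1) :
    v = ∑ i ∈ s, ρ (a i) • w i := by
  obtain ⟨z, hz, -, hzv⟩ := hv.exists_chain
  choose y hy _ hyw using fun i ↦ (hw i).exists_chain
  have h1 : ((realSingularComplex M).pOpcycles 1).hom (z - ∑ i ∈ s, a i • y i) = 0 := by
    simp only [map_sub, map_sum, map_smul, ← hyw, ← hzv]
    rw [h]
    simp
  -- On chains the relation holds only up to a boundary; changing the coefficients carries this
  -- boundary to another one.
  obtain ⟨c, hc⟩ := exists_d_eq h1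
  have h2 := mapCoeff_d ρ 1 c
  rw [hc] at h2
  simp only [map_sub, map_sum, mapCoeff_smul ρ (hy _)] at h2
  rw [← one_smul ℝ z, mapCoeff_smul ρ hz, hρ, one_smul] at h2
  have h3 := pOpcycles_d (mapCoeff ρ 2 c)
  rw [← h2] at h3
  simp only [map_sub, map_sum, map_smul, ← hyw, ← hzv, sub_eq_zero] at h3
  apply h1Incl_injective
  rw [h3]
  simp

/-- The coefficients of an integral class with respect to independent integral classes are
rational. -/
theorem exists_rat_of_integral {ι : Type*} (s : Finset ι) (a : ι → ℝ) (w : ι → realH1 M)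
    (hw : ∀ i, IsIntegralClass (w i)) (hind : LinearIndepOn ℝ w s) {v : realH1 M}
    (hv : IsIntegralClass v) (h : v = ∑ i ∈ s, a i • w i) :
    ∀ i ∈ s, ∃ q : ℚ, a i = q := by
  -- A `ℚ`-linear projection of `ℝ` onto `ℚ` turns the coefficients into rational ones without
  -- changing the sum, so independence makes it fix them.
  obtain ⟨ρ, hρ⟩ := LinearMap.exists_leftInverse_of_injective (Algebra.linearMap ℚ ℝ)
    (LinearMap.ker_eq_bot.2 (algebraMap ℚ ℝ).injective)
  let ρ' : ℝ →+ ℝ := (Rat.castHom ℝ : ℚ →+ ℝ).comp ρ.toAddMonoidHom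
  have h1 : ρ 1 = 1 := by
    have := LinearMap.congr_fun hρ 1
    simpa using this
  have h2 := sum_smul_eq_of_integral s a w hw hv h ρ' (by simp [ρ', h1])
  intro i hi
  refine ⟨ρ (a i), ?_⟩
  have h3 : ∑ i ∈ s, (a i - ρ' (a i)) • w i = 0 := by
    simp only [sub_smul, Finset.sum_sub_distrib, ← h, ← h2, sub_self]
  exact sub_eq_zero.1 (linearIndepOn_finset_iff.1 hind _ h3 i hi)

/-- In a path connected space, integral classes are classes of loops based at a given point. -/
theorem IsIntegralClass.exists_loop [PathConnectedSpace M] (x₀ : M) {v : realH1 M}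
    (hv : IsIntegralClass v) : ∃ γ : Path x₀ x₀, loopClass γ = v := by
  obtain ⟨z, hz, hd, hzv⟩ := hv.exists_chain
  let δ : ∀ x : M, Path x₀ x := fun x ↦ PathConnectedSpace.somePath x₀ x
  let pt : (TopCat.toSSet.obj (TopCat.of M)) _⦋0⦌ → M := fun σ ↦ TopCat.toSSetObj₀Equiv σ
  -- `D` attaches to each point the chosen path from `x₀`. Subtracting `D (d z)` closes every edge
  -- of `z` into a loop at `x₀`, and it changes nothing when `z` is a cycle.
  let D : (realSingularComplex M).X 0 →ₗ[ℝ] (realSingularComplex M).opcycles 1 :=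
    (Finsupp.lsum ℝ fun σ ↦ LinearMap.toSpanSingleton ℝ _
      (edgeClass (δ (pt σ)).toContinuousMap)) ∘ₗ (chainEquiv 0).symm.toLinearMap
  have hD : ∀ σ, D (chainSingle σ 1) = edgeClass (δ (pt σ)).toContinuousMap := by
    intro σ
    change (Finsupp.lsum ℝ fun σ ↦ LinearMap.toSpanSingleton ℝ _
      (edgeClass (δ (pt σ)).toContinuousMap)) ((chainEquiv 0).symm (chainSingle σ 1)) = _
    rw [← chainEquiv_single, LinearEquiv.symm_apply_apply]
    simp
  have hΨ := isPathCocycle_edgeClass (M := M)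
  have key : ∃ γ : Path x₀ x₀, edgeClass γ.toContinuousMap =
      ((realSingularComplex M).pOpcycles 1).hom z - D (((realSingularComplex M).d 1 0).hom z) := by
    -- The induction runs over all integral chains, most of which are not cycles.
    clear hd hzv
    induction hz using AddSubgroup.closure_induction with
    | mem x hx =>
      obtain ⟨σ, rfl⟩ := hx
      obtain ⟨p, rfl⟩ := edgeSimplex_surjective σ
      let γ : Path (p 0) (p 1) := ⟨p, rfl, rfl⟩
      refine ⟨((δ (p 0)).trans γ).trans (δ (p 1)).symm, ?_⟩
      rw [hΨ.trans, hΨ.trans, hΨ.symm, simplexChain_eq_chainSingle, d_chainSingle,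
        Fin.sum_univ_two, map_add, map_zsmul, map_zsmul, hD, hD]
      have e0 : pt ((TopCat.toSSet.obj (TopCat.of M)).δ 0 (edgeSimplex p)) = p 1 := by
        have := TopCat.δ_zero_toSSetObj₁Equiv.symm
          (TopCat.pathEquiv (X := TopCat.of M).symm γ).hom
        have h2 : edgeSimplex p = TopCat.toSSetObj₁Equiv.symm
          (TopCat.pathEquiv (X := TopCat.of M).symm γ).hom := rfl
        rw [h2, this]
        exact (TopCat.pathEquiv (X := TopCat.of M).symm γ).hom₁
      have e1 : pt ((TopCat.toSSet.obj (TopCat.of M)).δ 1 (edgeSimplex p)) = p 0 := by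
        have := TopCat.δ_one_toSSetObj₁Equiv.symm
          (TopCat.pathEquiv (X := TopCat.of M).symm γ).hom
        have h2 : edgeSimplex p = TopCat.toSSetObj₁Equiv.symm
          (TopCat.pathEquiv (X := TopCat.of M).symm γ).hom := rfl
        rw [h2, this]
        exact (TopCat.pathEquiv (X := TopCat.of M).symm γ).hom₀
      rw [e0, e1]
      have h3 : ((realSingularComplex M).pOpcycles 1).hom (chainSingle (edgeSimplex p) 1) =
        edgeClass γ.toContinuousMap := rfl
      rw [h3]
      simp only [Fin.val_zero, pow_zero, one_smul, Fin.val_one, pow_one, neg_smul]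
      abel
    | zero => exact ⟨Path.refl x₀, (hΨ.const x₀).trans (by simp)⟩
    | add x y _ _ hx hy =>
      obtain ⟨γ, hγ⟩ := hx
      obtain ⟨γ', hγ'⟩ := hy
      refine ⟨γ.trans γ', ?_⟩
      rw [hΨ.trans, hγ, hγ']
      simp only [map_add]
      abel
    | neg x _ hx =>
      obtain ⟨γ, hγ⟩ := hx
      refine ⟨γ.symm, ?_⟩
      rw [hΨ.symm, hγ]
      simp only [map_neg]
      abel
  obtain ⟨γ, hγ⟩ := key
  refine ⟨γ, h1Incl_injective ?_⟩
  rw [h1Incl_loopClass, hγ, hd, hzv, map_zero, sub_zero]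

/-- A linear path functional with values in `H₁(M, ℝ)` extending the class of loops. -/
theorem exists_pathCocycle_loopClass :
    ∃ Ψ : C(unitInterval, M) → realH1 M, IsPathCocycle Ψ ∧
      ∀ (x : M) (γ : Path x x), Ψ γ.toContinuousMap = loopClass γ := by
  -- A linear retraction onto `H₁(M, ℝ)`; its values on open paths are arbitrary, and no continuity
  -- is available.
  obtain ⟨r, hr⟩ := LinearMap.exists_leftInverse_of_injective (h1Incl M)
    (LinearMap.ker_eq_bot.2 h1Incl_injective)
  refine ⟨fun p ↦ r (edgeClass p), fun H P Q R ↦ ?_, fun x γ ↦ ?_⟩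
  · rw [← map_add, edgeClass_triangle]
  · change r (edgeClass γ.toContinuousMap) = _
    rw [← h1Incl_loopClass]
    exact LinearMap.congr_fun hr _

end Integral
end

noncomputable section

/-! ### Smoothing of paths -/

section Smoothing

variable {m : ℕ} {M : Type*} [TopologicalSpace M] [ChartedSpace (EuclideanSpace ℝ (Fin m)) M]

/-- The open subsets of `M` which correspond to a convex open set in a chart. -/
structure IsChartConvex (m : ℕ) {M : Type*} [TopologicalSpace M]
    [ChartedSpace (EuclideanSpace ℝ (Fin m)) M] (U : Set M) (x : M)
    (B : Set (EuclideanSpace ℝ (Fin m))) : Prop where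
  convex : Convex ℝ B
  isOpen : IsOpen B
  subset : B ⊆ (chartAt (EuclideanSpace ℝ (Fin m)) x).target
  eq : U = (chartAt (EuclideanSpace ℝ (Fin m)) x).source ∩
    chartAt (EuclideanSpace ℝ (Fin m)) x ⁻¹' B

lemma IsChartConvex.isOpen_set {U : Set M} {x : M} {B : Set (EuclideanSpace ℝ (Fin m))}
    (h : IsChartConvex m U x B) : IsOpen U := by
  rw [h.eq]
  exact (chartAt (EuclideanSpace ℝ (Fin m)) x).isOpen_inter_preimage h.isOpen

lemma IsChartConvex.symm_mem {U : Set M} {x : M} {B : Set (EuclideanSpace ℝ (Fin m))}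
    (h : IsChartConvex m U x B) {z : EuclideanSpace ℝ (Fin m)} (hz : z ∈ B) :
    (chartAt (EuclideanSpace ℝ (Fin m)) x).symm z ∈ U := by
  rw [h.eq]
  refine ⟨(chartAt _ x).map_target (h.subset hz), ?_⟩
  rw [mem_preimage, (chartAt _ x).right_inv (h.subset hz)]
  exact hz

lemma exists_isChartConvex (m : ℕ) {M : Type*} [TopologicalSpace M]
    [ChartedSpace (EuclideanSpace ℝ (Fin m)) M] (x : M) {W : Set M} (hW : W ∈ 𝓝 x) :
    ∃ U B, IsChartConvex m U x B ∧ x ∈ U ∧ U ⊆ W := by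
  set φ := chartAt (EuclideanSpace ℝ (Fin m)) x
  have hx : x ∈ φ.source := mem_chart_source _ x
  have h1 : φ.target ∩ φ.symm ⁻¹' W ∈ 𝓝 (φ x) := by
    refine inter_mem (φ.open_target.mem_nhds (φ.map_source hx)) ?_
    refine (φ.continuousAt_symm (φ.map_source hx)).preimage_mem_nhds ?_
    rwa [φ.left_inv hx]
  obtain ⟨r, hr, hrs⟩ := Metric.mem_nhds_iff.1 h1
  refine ⟨φ.source ∩ φ ⁻¹' Metric.ball (φ x) r, Metric.ball (φ x) r,
    ⟨convex_ball _ _, Metric.isOpen_ball, fun z hz ↦ (hrs hz).1, rfl⟩,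
    ⟨hx, Metric.mem_ball_self hr⟩, fun y hy ↦ ?_⟩
  have := (hrs hy.2).2
  rwa [mem_preimage, φ.left_inv hy.1] at this

/-- The retraction of the line onto the unit interval. -/
def clampI : C(ℝ, unitInterval) := ⟨projIcc 0 1 zero_le_one, continuous_projIcc⟩

lemma clampI_coe (t : unitInterval) : clampI (t : ℝ) = t := projIcc_val zero_le_one t

lemma clampI_zero : clampI 0 = 0 := projIcc_left zero_le_one

lemma clampI_one : clampI 1 = 1 := projIcc_right zero_le_one

variable {A : Type*} [AddCommGroup A] {Ψ : C(unitInterval, M) → A}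

/-- The straight homotopy in the chart stays in the convex set and fixes the ends. -/
lemma IsPathCocycle.eq_of_isChartConvex (hΨ : IsPathCocycle Ψ) {U : Set M} {x : M}
    {B : Set (EuclideanSpace ℝ (Fin m))} (hU : IsChartConvex m U x B) {p q : C(unitInterval, M)}
    (hp : ∀ t, p t ∈ U) (hq : ∀ t, q t ∈ U) (h0 : p 0 = q 0) (h1 : p 1 = q 1) : Ψ p = Ψ q := by
  set φ := chartAt (EuclideanSpace ℝ (Fin m)) x
  rw [hU.eq] at hp hq
  have hφp : Continuous fun t ↦ φ (p t) :=
    φ.continuousOn.comp_continuous p.continuous fun t ↦ (hp t).1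
  have hφq : Continuous fun t ↦ φ (q t) :=
    φ.continuousOn.comp_continuous q.continuous fun t ↦ (hq t).1
  -- Clamping the parameters extends the homotopy to the whole plane, as the triangle identity
  -- requires.
  let K : ℝ × ℝ → EuclideanSpace ℝ (Fin m) := fun z ↦
    (1 - (clampI z.1 : ℝ)) • φ (p (clampI z.2)) + (clampI z.1 : ℝ) • φ (q (clampI z.2))
  have hK : Continuous K := by
    have h1 : Continuous fun z : ℝ × ℝ ↦ φ (p (clampI z.2)) :=
      hφp.comp (clampI.continuous.comp continuous_snd)
    have h2 : Continuous fun z : ℝ × ℝ ↦ φ (q (clampI z.2)) :=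
      hφq.comp (clampI.continuous.comp continuous_snd)
    have h3 : Continuous fun z : ℝ × ℝ ↦ (clampI z.1 : ℝ) :=
      continuous_subtype_val.comp (clampI.continuous.comp continuous_fst)
    exact ((continuous_const.sub h3).smul h1).add (h3.smul h2)
  have hKB : ∀ z, K z ∈ B := fun z ↦
    hU.convex (hp _).2 (hq _).2 (sub_nonneg.2 (clampI z.1).2.2) (clampI z.1).2.1 (by ring)
  let H : C(ℝ × ℝ, M) := ⟨fun z ↦ φ.symm (K z),
    φ.continuousOn_symm.comp_continuous hK fun z ↦ hU.subset (hKB z)⟩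
  have e0 : ∀ s, H (s, 0) = p 0 := by
    intro s
    change φ.symm ((1 - (clampI s : ℝ)) • φ (p (clampI 0)) +
      (clampI s : ℝ) • φ (q (clampI 0))) = p 0
    rw [clampI_zero, ← h0, ← add_smul, sub_add_cancel, one_smul, φ.left_inv (hp 0).1]
  have e1 : ∀ s, H (s, 1) = p 1 := by
    intro s
    change φ.symm ((1 - (clampI s : ℝ)) • φ (p (clampI 1)) +
      (clampI s : ℝ) • φ (q (clampI 1))) = p 1
    rw [clampI_one, ← h1, ← add_smul, sub_add_cancel, one_smul, φ.left_inv (hp 1).1]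
  have h := hΨ.eq_of_homotopy H (fun s ↦ by rw [e0, e0]) (fun s ↦ by rw [e1, e1])
  convert h using 2
  · ext t
    have : planeSeg (0, 0) (0, 1) t = (0, (t : ℝ)) := by simp [planeSeg]
    rw [ContinuousMap.comp_apply, this]
    change _ = φ.symm ((1 - (clampI 0 : ℝ)) • φ (p (clampI t)) + (clampI 0 : ℝ) • φ (q (clampI t)))
    rw [clampI_zero, clampI_coe]
    simp [φ.left_inv (hp t).1]
  · ext t
    have : planeSeg (1, 0) (1, 1) t = (1, (t : ℝ)) := by simp [planeSeg]
    rw [ContinuousMap.comp_apply, this]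
    change _ = φ.symm ((1 - (clampI 1 : ℝ)) • φ (p (clampI t)) + (clampI 1 : ℝ) • φ (q (clampI t)))
    rw [clampI_one, clampI_coe]
    simp [φ.left_inv (hq t).1]

/-- A smooth curve which is constant outside of the middle third of the unit interval. -/
structure IsFlatCurve (m : ℕ) {M : Type*} [TopologicalSpace M]
    [ChartedSpace (EuclideanSpace ℝ (Fin m)) M] (c : C(ℝ, M)) (x y : M) : Prop where
  smooth : ContMDiff 𝓘(ℝ) (𝓡 m) ∞ c
  left : ∀ t ≤ 1 / 3, c t = x
  right : ∀ t, 2 / 3 ≤ t → c t = y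

variable (m) in
/-- There is a flat curve from `x` to `y` on which the path functional `Ψ` is `a`. -/
def FlatJoin (Ψ : C(unitInterval, M) → A) (x y : M) (a : A) : Prop :=
  ∃ c : C(ℝ, M), IsFlatCurve m c x y ∧ Ψ (arc c 0 1) = a

lemma IsPathCocycle.arc_const (hΨ : IsPathCocycle Ψ) (c : C(ℝ, M)) {a b : ℝ} (hab : a ≤ b) (x : M)
    (h : ∀ t ∈ Icc a b, c t = x) : Ψ (arc c a b) = 0 := by
  rw [← hΨ.const x]
  congr 1
  ext t
  obtain ⟨s, hs, e⟩ := arc_mem c hab t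
  rw [e, h s hs]
  rfl

/-- Each curve is run at speed six, on `[1/3, 1/2]` and `[1/2, 2/3]`. Between `4/9` and `5/9` both
are constant equal to `y`, so the junction is smooth. -/
lemma IsFlatCurve.exists_trans {c d : C(ℝ, M)} {x y z : M} (hc : IsFlatCurve m c x y)
    (hd : IsFlatCurve m d y z) : ∃ Q : C(ℝ, M), IsFlatCurve m Q x z ∧
      (∀ t < 5 / 9, Q t = c (6 * t - 2)) ∧ ∀ t > 4 / 9, Q t = d (6 * t - 3) := by
  let q : ℝ → M := fun t ↦ if t ≤ 1 / 2 then c (6 * t - 2) else d (6 * t - 3)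
  have hc6 : ContMDiff 𝓘(ℝ) (𝓡 m) ∞ fun t : ℝ ↦ c (6 * t - 2) :=
    hc.smooth.comp (ContDiff.contMDiff (by fun_prop))
  have hd6 : ContMDiff 𝓘(ℝ) (𝓡 m) ∞ fun t : ℝ ↦ d (6 * t - 3) :=
    hd.smooth.comp (ContDiff.contMDiff (by fun_prop))
  have q1 : ∀ t < 5 / 9, q t = c (6 * t - 2) := by
    intro t ht
    by_cases h : t ≤ 1 / 2
    · exact if_pos h
    · simp only [q, if_neg h]
      rw [hd.left _ (by linarith), hc.right _ (by linarith)]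
  have q2 : ∀ t > 4 / 9, q t = d (6 * t - 3) := by
    intro t ht
    by_cases h : t ≤ 1 / 2
    · simp only [q, if_pos h]
      rw [hd.left _ (by linarith), hc.right _ (by linarith)]
    · exact if_neg h
  have hq : ContMDiff 𝓘(ℝ) (𝓡 m) ∞ q := by
    intro t
    by_cases h : t < 5 / 9
    · refine (hc6 t).congr_of_eventuallyEq ?_
      filter_upwards [Iio_mem_nhds h] with s hs using q1 s hs
    · refine (hd6 t).congr_of_eventuallyEq ?_
      filter_upwards [Ioi_mem_nhds (show 4 / 9 < t by linarith)] with s hs using q2 s hs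
  let Q : C(ℝ, M) := ⟨q, hq.continuous⟩
  refine ⟨Q, ⟨hq, fun t ht ↦ ?_, fun t ht ↦ ?_⟩, q1, q2⟩
  · exact (q1 t (by linarith)).trans (hc.left _ (by linarith))
  · exact (q2 t (by linarith)).trans (hd.right _ (by linarith))

lemma IsPathCocycle.arc_exists_trans (hΨ : IsPathCocycle Ψ) {c d Q : C(ℝ, M)} {x y z : M}
    (hc : IsFlatCurve m c x y) (hd : IsFlatCurve m d y z)
    (q1 : ∀ t < 5 / 9, Q t = c (6 * t - 2)) (q2 : ∀ t > 4 / 9, Q t = d (6 * t - 3)) :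
    Ψ (arc Q 0 1) = Ψ (arc c 0 1) + Ψ (arc d 0 1) := by
  have e1 : Ψ (arc Q 0 (1 / 3)) = 0 := hΨ.arc_const Q (by norm_num) x fun t ht ↦
    (q1 t (by linarith [ht.2])).trans (hc.left _ (by linarith [ht.2]))
  have e2 : Ψ (arc Q (2 / 3) 1) = 0 := hΨ.arc_const Q (by norm_num) z fun t ht ↦
    (q2 t (by linarith [ht.1])).trans (hd.right _ (by linarith [ht.1]))
  have e3 : arc Q (1 / 3) (1 / 2) = arc c 0 1 := by
    ext t
    refine (q1 ((1 - (t : ℝ)) * (1 / 3) + t * (1 / 2))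
      (by nlinarith [t.2.1, t.2.2])).trans ?_
    rw [arc_apply]
    congr 1
    ring
  have e4 : arc Q (1 / 2) (2 / 3) = arc d 0 1 := by
    ext t
    refine (q2 ((1 - (t : ℝ)) * (1 / 2) + t * (2 / 3))
      (by nlinarith [t.2.1, t.2.2])).trans ?_
    rw [arc_apply]
    congr 1
    ring
  rw [← hΨ.arc_add Q 0 (1 / 3) 1, ← hΨ.arc_add Q (1 / 3) (1 / 2) 1,
    ← hΨ.arc_add Q (1 / 2) (2 / 3) 1, e1, e2, e3, e4, zero_add, add_zero]

lemma FlatJoin.trans (hΨ : IsPathCocycle Ψ) {x y z : M} {a b : A} (h1 : FlatJoin m Ψ x y a)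
    (h2 : FlatJoin m Ψ y z b) : FlatJoin m Ψ x z (a + b) := by
  obtain ⟨c, hc, rfl⟩ := h1
  obtain ⟨d, hd, rfl⟩ := h2
  obtain ⟨Q, hQ, q1, q2⟩ := hc.exists_trans hd
  exact ⟨Q, hQ, hΨ.arc_exists_trans hc hd q1 q2⟩

variable [IsManifold (𝓡 m) ∞ M]

/-- The replacement is the straight segment in the chart, run by a smooth step on the middle third.
Within a convex chart only the ends matter for `Ψ`. -/
lemma flatJoin_of_isChartConvex (hΨ : IsPathCocycle Ψ) {U : Set M} {x : M}
    {B : Set (EuclideanSpace ℝ (Fin m))} (hU : IsChartConvex m U x B) {p : C(unitInterval, M)}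
    (hp : ∀ t, p t ∈ U) : FlatJoin m Ψ (p 0) (p 1) (Ψ p) := by
  set φ := chartAt (EuclideanSpace ℝ (Fin m)) x with hφ
  have hp' := hp
  rw [hU.eq] at hp'
  let s : ℝ → ℝ := fun t ↦ Real.smoothTransition (3 * t - 1)
  have hs : ContDiff ℝ ∞ s := Real.smoothTransition.contDiff.comp (by fun_prop)
  let K : ℝ → EuclideanSpace ℝ (Fin m) := fun t ↦ (1 - s t) • φ (p 0) + s t • φ (p 1)
  have hK : ContDiff ℝ ∞ K :=
    ((contDiff_const.sub hs).smul contDiff_const).add (hs.smul contDiff_const)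
  have hKB : ∀ t, K t ∈ B := fun t ↦ hU.convex (hp' 0).2 (hp' 1).2
    (sub_nonneg.2 (Real.smoothTransition.le_one _)) (Real.smoothTransition.nonneg _) (by ring)
  have hc : ContMDiff 𝓘(ℝ) (𝓡 m) ∞ fun t ↦ φ.symm (K t) := by
    intro t
    have h1 : ContMDiffAt (𝓡 m) (𝓡 m) ∞ φ.symm (K t) :=
      (contMDiffOn_chart_symm (x := x)).contMDiffAt (φ.open_target.mem_nhds (hU.subset (hKB t)))
    exact h1.comp t hK.contMDiff.contMDiffAt
  let c : C(ℝ, M) := ⟨_, hc.continuous⟩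
  have hcl : ∀ t ≤ 1 / 3, c t = p 0 := by
    intro t ht
    have : s t = 0 := Real.smoothTransition.zero_of_nonpos (by linarith)
    change φ.symm ((1 - s t) • φ (p 0) + s t • φ (p 1)) = p 0
    simp [this, φ.left_inv (hp' 0).1]
  have hcr : ∀ t, 2 / 3 ≤ t → c t = p 1 := by
    intro t ht
    have : s t = 1 := Real.smoothTransition.one_of_one_le (by linarith)
    change φ.symm ((1 - s t) • φ (p 0) + s t • φ (p 1)) = p 1
    simp [this, φ.left_inv (hp' 1).1]
  refine ⟨c, ⟨hc, hcl, hcr⟩, ?_⟩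
  refine hΨ.eq_of_isChartConvex hU (fun t ↦ hU.symm_mem (hKB _)) hp ?_ ?_
  · rw [arc_apply, hcl _ (by norm_num)]
  · rw [arc_apply, hcr _ (by norm_num)]

/-- Every path can be replaced by a flat smooth path with the same ends and the same value of
the path functional. -/
theorem flatJoin_of_path (hΨ : IsPathCocycle Ψ) (p : C(unitInterval, M)) :
    FlatJoin m Ψ (p 0) (p 1) (Ψ p) := by
  choose U B hU hxU _ using fun x : M ↦ exists_isChartConvex m x (univ_mem (f := 𝓝 x))
  obtain ⟨t, ht0, htm, ⟨n, hn⟩, hsub⟩ := exists_monotone_Icc_subset_open_cover_unitInterval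
    (c := fun x ↦ p ⁻¹' U x) (fun x ↦ (hU x).isOpen_set.preimage p.continuous)
    (fun s _ ↦ mem_iUnion.2 ⟨p s, hxU _⟩)
  let c : C(ℝ, M) := p.comp clampI
  have hct : ∀ s : unitInterval, c (s : ℝ) = p s := fun s ↦ congrArg p (clampI_coe s)
  have h0 : arc c 0 1 = p := by
    ext s
    rw [arc_apply, ← hct s]
    simp
  have key : ∀ k, FlatJoin m Ψ (p 0) (p (t k)) (Ψ (arc c 0 (t k))) := by
    intro k
    induction k with
    | zero =>
      have := flatJoin_of_isChartConvex hΨ (hU (p 0)) (p := arc c 0 0) (fun s ↦ by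
        rw [arc_apply]
        have : (1 - (s : ℝ)) * 0 + s * 0 = ((0 : unitInterval) : ℝ) := by simp
        rw [this, hct]
        exact hxU _)
      rw [ht0]
      convert this using 1
      · rw [arc_apply, ← hct]; simp
      · rw [arc_apply, ← hct]; simp
      · simp
    | succ k ih =>
      obtain ⟨x, hx⟩ := hsub k
      have := flatJoin_of_isChartConvex hΨ (hU x) (p := arc c (t k) (t (k + 1))) (fun s ↦ by
        obtain ⟨r, hr, e⟩ := arc_mem c (htm (Nat.le_succ k)) s
        have hr' : r ∈ Icc (0 : ℝ) 1 := ⟨(t k).2.1.trans hr.1, hr.2.trans (t (k + 1)).2.2⟩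
        rw [e, hct ⟨r, hr'⟩]
        exact hx (show (⟨r, hr'⟩ : unitInterval) ∈ Icc (t k) (t (k + 1)) from ⟨hr.1, hr.2⟩))
      have e0 : arc c (t k) (t (k + 1)) 0 = p (t k) := by rw [arc_apply, ← hct]; simp
      have e1 : arc c (t k) (t (k + 1)) 1 = p (t (k + 1)) := by rw [arc_apply, ← hct]; simp
      rw [e0, e1] at this
      rw [← hΨ.arc_add c 0 (t k) (t (k + 1))]
      exact ih.trans hΨ this
  have := key n
  rw [hn n le_rfl] at this
  rw [← h0]
  simpa [h0] using this

/-- Every loop can be replaced by a smooth periodic curve. -/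
theorem exists_periodic_of_loop (hΨ : IsPathCocycle Ψ) {x : M} (γ : Path x x) :
    ∃ c : C(ℝ, M), ContMDiff 𝓘(ℝ) (𝓡 m) ∞ c ∧ Function.Periodic c 1 ∧
      Ψ (arc c 0 1) = Ψ γ.toContinuousMap := by
  obtain ⟨d, hd, hdΨ⟩ := flatJoin_of_path (m := m) hΨ γ.toContinuousMap
  have hl : ∀ t ≤ 1 / 3, d t = x := fun t ht ↦ (hd.left t ht).trans γ.source
  have hr : ∀ t, 2 / 3 ≤ t → d t = x := fun t ht ↦ (hd.right t ht).trans γ.target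
  -- Flatness at both ends makes the periodic extension coincide with a smooth translate of `d` on
  -- an interval longer than a period; this gives smoothness at the integers.
  have key : ∀ (k : ℤ) (t : ℝ), t ∈ Ioo (k - 1 / 3 : ℝ) (k + 4 / 3) →
      d (Int.fract t) = d (t - k) := by
    intro k t ht
    rcases lt_trichotomy ⌊t⌋ k with h | h | h
    · have h1 : t < k := Int.floor_lt.1 h
      have h2 : ⌊t⌋ = k - 1 := by
        rw [Int.floor_eq_iff]; push_cast; constructor <;> linarith [ht.1]
      rw [Int.fract, h2, hl (t - k) (by linarith), hr]
      push_cast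
      linarith [ht.1]
    · rw [Int.fract, h]
    · have h1 : (k + 1 : ℤ) ≤ t := Int.le_floor.1 h
      push_cast at h1
      have h2 : ⌊t⌋ = k + 1 := by
        rw [Int.floor_eq_iff]; push_cast; constructor <;> linarith [ht.2]
      rw [Int.fract, h2, hr (t - k) (by linarith), hl]
      push_cast
      linarith [ht.2]
  have hc : ContMDiff 𝓘(ℝ) (𝓡 m) ∞ fun t : ℝ ↦ d (Int.fract t) := by
    intro t
    have h1 : ContMDiff 𝓘(ℝ) (𝓡 m) ∞ fun s : ℝ ↦ d (s - ⌊t⌋) :=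
      hd.smooth.comp (ContDiff.contMDiff (by fun_prop))
    refine (h1 t).congr_of_eventuallyEq ?_
    filter_upwards [Ioo_mem_nhds (show (⌊t⌋ - 1 / 3 : ℝ) < t by linarith [Int.floor_le t])
      (show t < (⌊t⌋ + 4 / 3 : ℝ) by linarith [Int.lt_floor_add_one t])] with s hs
    exact key _ s hs
  refine ⟨⟨_, hc.continuous⟩, hc, fun t ↦ ?_, ?_⟩
  · change d (Int.fract (t + 1)) = d (Int.fract t)
    rw [Int.fract_add_one]
  · rw [← hdΨ]
    congr 1
    ext s
    have := key 0 s ⟨by push_cast; linarith [s.2.1], by push_cast; linarith [s.2.2]⟩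
    simpa [arc_apply] using this

end Smoothing
end

noncomputable section

/-! ### Perturbation of smooth loops -/

section Perturbation

variable {m : ℕ} {M : Type*} [TopologicalSpace M] [ChartedSpace (EuclideanSpace ℝ (Fin m)) M]

/-- A smooth curve of period one. -/
structure IsSmoothLoop (m : ℕ) {M : Type*} [TopologicalSpace M]
    [ChartedSpace (EuclideanSpace ℝ (Fin m)) M] (c : C(ℝ, M)) : Prop where
  smooth : ContMDiff 𝓘(ℝ) (𝓡 m) ∞ c
  periodic : Function.Periodic c 1

lemma IsSmoothLoop.add_int {c : C(ℝ, M)} (hc : IsSmoothLoop m c) (t : ℝ) (k : ℤ) :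
    c (t + k) = c t := by
  have := hc.periodic.int_mul k t
  simpa using this

variable (m) in
/-- A set of curves is stable if membership persists under small smooth deformations with
finitely many parameters. -/
def IsStable (G : Set (ℝ → M)) : Prop :=
  ∀ (K : EuclideanSpace ℝ (Fin m) × ℝ → M) (r : ℝ), 0 < r →
    ContMDiffOn 𝓘(ℝ, EuclideanSpace ℝ (Fin m) × ℝ) (𝓡 m) ∞ K (Metric.ball 0 r ×ˢ univ) →
    (fun t ↦ K (0, t)) ∈ G → ∀ᶠ w in 𝓝 0, (fun t ↦ K (w, t)) ∈ G

lemma IsStable.inter {G G' : Set (ℝ → M)} (h : IsStable m G) (h' : IsStable m G') :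
    IsStable m (G ∩ G') := fun K r hr hK h0 ↦
  (h K r hr hK h0.1).and (h' K r hr hK h0.2)

lemma IsStable.iInter {ι : Type*} [Finite ι] {G : ι → Set (ℝ → M)} (h : ∀ i, IsStable m (G i)) :
    IsStable m (⋂ i, G i) := fun K r hr hK h0 ↦ by
  have := eventually_all.2 fun i ↦ h i K r hr hK (mem_iInter.1 h0 i)
  filter_upwards [this] with w hw using mem_iInter.2 hw

/-- Finitely many stable properties, each of which can be achieved by a perturbation, can be
achieved simultaneously. -/
theorem exists_forall_mem_of_isStable {ι : Type*} [Finite ι] {P : C(ℝ, M) → Prop}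
    {G : Set (ℝ → M)} {R : ι → Set (ℝ → M)} (hR : ∀ i, IsStable m (R i))
    (step : ∀ i, ∀ G' : Set (ℝ → M), IsStable m G' → ∀ c : C(ℝ, M), P c → ⇑c ∈ G → ⇑c ∈ G' →
      ∃ c' : C(ℝ, M), P c' ∧ ⇑c' ∈ G ∩ G' ∧ ⇑c' ∈ R i)
    {c : C(ℝ, M)} (hc : P c) (hcG : ⇑c ∈ G) :
    ∃ c' : C(ℝ, M), P c' ∧ ⇑c' ∈ G ∧ ∀ i, ⇑c' ∈ R i := by
  classical
  have := Fintype.ofFinite ι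
  have key : ∀ s : Finset ι, ∃ c' : C(ℝ, M), P c' ∧ ⇑c' ∈ G ∧ ∀ i ∈ s, ⇑c' ∈ R i := by
    intro s
    induction s using Finset.induction_on with
    | empty => exact ⟨c, hc, hcG, by simp⟩
    | insert i s _ ih =>
      obtain ⟨d, hd, hdG, hds⟩ := ih
      -- The properties already obtained are passed as the stable set to be preserved by the next
      -- perturbation.
      obtain ⟨d', hd', hdG', hdR⟩ := step i (⋂ j : s, R j) (IsStable.iInter fun j ↦ hR j) d hd hdG
        (mem_iInter.2 fun j ↦ hds j j.2)
      refine ⟨d', hd', hdG'.1, fun j hj ↦ ?_⟩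
      rcases Finset.mem_insert.1 hj with rfl | hj
      · exact hdR
      · exact mem_iInter.1 hdG'.2 ⟨j, hj⟩
  obtain ⟨d, hd, hdG, h⟩ := key Finset.univ
  exact ⟨d, hd, hdG, fun i ↦ h i (Finset.mem_univ i)⟩

lemma contMDiffAt_of_ball {K : EuclideanSpace ℝ (Fin m) × ℝ → M} {r : ℝ}
    (hK : ContMDiffOn 𝓘(ℝ, EuclideanSpace ℝ (Fin m) × ℝ) (𝓡 m) ∞ K (Metric.ball 0 r ×ˢ univ))
    {w : EuclideanSpace ℝ (Fin m)} (hw : w ∈ Metric.ball 0 r) (t : ℝ) :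
    ContMDiffAt 𝓘(ℝ, EuclideanSpace ℝ (Fin m) × ℝ) (𝓡 m) ∞ K (w, t) :=
  hK.contMDiffAt (prod_mem_nhds (Metric.isOpen_ball.mem_nhds hw) univ_mem)

lemma isStable_mem {J : Set ℝ} (hJ : IsCompact J) {U : Set M} (hU : IsOpen U) :
    IsStable m (Set.ofPred fun c : ℝ → M ↦ ∀ t ∈ J, c t ∈ U) := fun K r hr hK h0 ↦ by
  refine hJ.eventually_forall_of_forall_eventually fun t ht ↦ ?_
  exact (contMDiffAt_of_ball hK (Metric.mem_ball_self hr) t).continuousAt.eventually_mem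
    (hU.mem_nhds (h0 t ht))

lemma isStable_ne [T2Space M] {J J' : Set ℝ} (hJ : IsCompact J) (hJ' : IsCompact J') :
    IsStable m (Set.ofPred fun c : ℝ → M ↦ ∀ s ∈ J, ∀ t ∈ J', c s ≠ c t) := fun K r hr hK h0 ↦ by
  have : ∀ᶠ w in 𝓝 (0 : EuclideanSpace ℝ (Fin m)), ∀ p ∈ J ×ˢ J', K (w, p.1) ≠ K (w, p.2) := by
    refine (hJ.prod hJ').eventually_forall_of_forall_eventually fun p hp ↦ ?_
    have h1 := (contMDiffAt_of_ball hK (Metric.mem_ball_self hr) p.1).continuousAt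
    have h2 := (contMDiffAt_of_ball hK (Metric.mem_ball_self hr) p.2).continuousAt
    have e1 : ContinuousAt (fun z : EuclideanSpace ℝ (Fin m) × (ℝ × ℝ) ↦ K (z.1, z.2.1)) (0, p) :=
      ContinuousAt.comp (f := fun z : EuclideanSpace ℝ (Fin m) × (ℝ × ℝ) ↦ (z.1, z.2.1))
        h1 (by fun_prop)
    have e2 : ContinuousAt (fun z : EuclideanSpace ℝ (Fin m) × (ℝ × ℝ) ↦ K (z.1, z.2.2)) (0, p) :=
      ContinuousAt.comp (f := fun z : EuclideanSpace ℝ (Fin m) × (ℝ × ℝ) ↦ (z.1, z.2.2))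
        h2 (by fun_prop)
    exact (e1.prodMk e2).eventually_mem
      (isClosed_diagonal.isOpen_compl.mem_nhds (h0 _ hp.1 _ hp.2))
  filter_upwards [this] with w hw s hs t ht using hw (s, t) ⟨hs, ht⟩

variable [IsManifold (𝓡 m) ∞ M]

lemma contMDiffAt_chartAt {x y : M}
    (hy : y ∈ (chartAt (EuclideanSpace ℝ (Fin m)) x).source) :
    ContMDiffAt (𝓡 m) 𝓘(ℝ, EuclideanSpace ℝ (Fin m)) ∞
      (chartAt (EuclideanSpace ℝ (Fin m)) x) y :=
  (contMDiffOn_chart (x := x)).contMDiffAt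
    ((chartAt (EuclideanSpace ℝ (Fin m)) x).open_source.mem_nhds hy)

lemma contMDiffAt_chartAt_symm {x : M} {z : EuclideanSpace ℝ (Fin m)}
    (hz : z ∈ (chartAt (EuclideanSpace ℝ (Fin m)) x).target) :
    ContMDiffAt 𝓘(ℝ, EuclideanSpace ℝ (Fin m)) (𝓡 m) ∞
      (chartAt (EuclideanSpace ℝ (Fin m)) x).symm z :=
  (contMDiffOn_chart_symm (x := x)).contMDiffAt
    ((chartAt (EuclideanSpace ℝ (Fin m)) x).open_target.mem_nhds hz)

/-- The derivative in the chart is jointly continuous in parameter and time, so an open condition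
persists, uniformly over the compact set of times. -/
lemma isStable_deriv {J : Set ℝ} (hJ : IsCompact J) (x : M)
    {O : Set (EuclideanSpace ℝ (Fin m))} (hO : IsOpen O) :
    IsStable m (Set.ofPred fun c : ℝ → M ↦
      ∀ t ∈ J, c t ∈ (chartAt (EuclideanSpace ℝ (Fin m)) x).source ∧
        deriv (fun s ↦ chartAt (EuclideanSpace ℝ (Fin m)) x (c s)) t ∈ O) := fun K r hr hK h0 ↦ by
  set φ := chartAt (EuclideanSpace ℝ (Fin m)) x
  refine hJ.eventually_forall_of_forall_eventually fun t ht ↦ ?_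
  have h1 := contMDiffAt_of_ball hK (Metric.mem_ball_self hr) t
  have h2 : ContDiffAt ℝ ∞ (fun z ↦ φ (K z)) ((0 : EuclideanSpace ℝ (Fin m)), t) :=
    ((contMDiffAt_chartAt (h0 t ht).1).comp _ h1).contDiffAt
  have h3 : ∀ᶠ z in 𝓝 ((0 : EuclideanSpace ℝ (Fin m)), t),
      deriv (fun s ↦ φ (K (z.1, s))) z.2 = fderiv ℝ (fun z ↦ φ (K z)) z (0, 1) := by
    filter_upwards [(h2.of_le (m := 1) (by exact_mod_cast le_top)).eventually (by simp)] with z hz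
    have e1 : HasDerivAt (fun s : ℝ ↦ (z.1, s)) ((0 : EuclideanSpace ℝ (Fin m)), (1 : ℝ)) z.2 :=
      (hasDerivAt_const _ _).prodMk (hasDerivAt_id _)
    exact ((hz.differentiableAt (by simp)).hasFDerivAt.comp_hasDerivAt z.2 e1).deriv
  have h4 : ContinuousAt (fun z ↦ fderiv ℝ (fun z ↦ φ (K z)) z (0, 1))
      ((0 : EuclideanSpace ℝ (Fin m)), t) :=
    (h2.fderiv_right (m := 0) (by simp)).continuousAt.clm_apply continuousAt_const
  have h5 := h3.self_of_nhds
  filter_upwards [h1.continuousAt.eventually_mem (φ.open_source.mem_nhds (h0 t ht).1), h3,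
    h4.eventually_mem (hO.mem_nhds (h5 ▸ (h0 t ht).2))] with z hz1 hz2 hz3
  exact ⟨hz1, hz2 ▸ hz3⟩

/-- Only times in `T` are moved, by `β t • w` in the chart. Since `β` vanishes off `T`, the two
formulas agree near the boundary of `T`, whence smoothness. -/
lemma exists_deformation {c : C(ℝ, M)} (hc : IsSmoothLoop m c) (x : M) {β : ℝ → ℝ}
    (hβ : ContDiff ℝ ∞ β) (hβp : Function.Periodic β 1) {T : Set ℝ} (hT : IsClosed T)
    (hTp : ∀ t ∈ T, ∀ k : ℤ, t + k ∈ T) (hβT : ∀ t ∉ T, β t = 0)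
    (hcT : ∀ t ∈ T, c t ∈ (chartAt (EuclideanSpace ℝ (Fin m)) x).source) :
    ∃ (K : EuclideanSpace ℝ (Fin m) × ℝ → M) (r : ℝ), 0 < r ∧
      ContMDiffOn 𝓘(ℝ, EuclideanSpace ℝ (Fin m) × ℝ) (𝓡 m) ∞ K (Metric.ball 0 r ×ˢ univ) ∧
      (∀ t, K (0, t) = c t) ∧ (∀ w t, K (w, t + 1) = K (w, t)) ∧
      (∀ w t, β t = 0 → K (w, t) = c t) ∧
      ∀ w ∈ Metric.ball 0 r, ∀ t ∈ T, K (w, t) ∈ (chartAt (EuclideanSpace ℝ (Fin m)) x).source ∧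
        chartAt (EuclideanSpace ℝ (Fin m)) x (K (w, t)) =
          chartAt (EuclideanSpace ℝ (Fin m)) x (c t) + β t • w := by
  classical
  set φ := chartAt (EuclideanSpace ℝ (Fin m)) x
  have hTc : IsCompact (T ∩ Icc 0 1) := isCompact_Icc.inter_left hT
  have hcont : ContinuousOn (fun t ↦ φ (c t)) (T ∩ Icc 0 1) :=
    φ.continuousOn.comp c.continuous.continuousOn fun t ht ↦ hcT t ht.1
  -- By periodicity one compact period suffices: `δ` is the room left in the chart and `b` bounds
  -- `β`, so the radius `δ / (b + 1)` is admissible.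
  obtain ⟨δ, hδ, hδs⟩ := (hTc.image_of_continuousOn hcont).exists_thickening_subset_open
    φ.open_target (by rintro _ ⟨t, ht, rfl⟩; exact φ.map_source (hcT t ht.1))
  obtain ⟨b, hb⟩ := (isCompact_Icc (a := (0 : ℝ)) (b := 1)).exists_bound_of_continuousOn
    hβ.continuous.continuousOn
  have hb0 : 0 ≤ b := (norm_nonneg _).trans (hb 0 (by simp))
  have hTi : ∀ t, t ∈ T ↔ Int.fract t ∈ T := by
    intro t
    refine ⟨fun h ↦ ?_, fun h ↦ ?_⟩
    · have := hTp t h (-⌊t⌋)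
      rwa [Int.cast_neg, ← sub_eq_add_neg] at this
    · have := hTp _ h ⌊t⌋
      rwa [Int.fract_add_floor] at this
  have hβf : ∀ t, β t = β (Int.fract t) := fun t ↦ by
    have := hβp.sub_int_mul_eq ⌊t⌋ (x := t)
    rw [mul_one] at this
    exact this.symm
  have hcf : ∀ t, c t = c (Int.fract t) := fun t ↦ by
    have := hc.periodic.sub_int_mul_eq ⌊t⌋ (x := t)
    rw [mul_one] at this
    exact this.symm
  have hrad : ∀ w ∈ Metric.ball (0 : EuclideanSpace ℝ (Fin m)) (δ / (b + 1)), ∀ t ∈ T,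
      φ (c t) + β t • w ∈ φ.target := by
    intro w hw t ht
    have h01 : Int.fract t ∈ Icc (0 : ℝ) 1 := ⟨Int.fract_nonneg t, (Int.fract_lt_one t).le⟩
    apply hδs
    rw [Metric.mem_thickening_iff]
    refine ⟨φ (c t), ⟨Int.fract t, ⟨(hTi t).1 ht, h01⟩, by simp only []; rw [← hcf]⟩, ?_⟩
    rw [dist_eq_norm, add_sub_cancel_left, norm_smul]
    have h1 : ‖β t‖ ≤ b := by rw [hβf]; exact hb _ h01
    rw [mem_ball_zero_iff, lt_div_iff₀ (by positivity)] at hw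
    nlinarith [norm_nonneg w, norm_nonneg (β t)]
  let K : EuclideanSpace ℝ (Fin m) × ℝ → M := fun z ↦
    if z.2 ∈ T then φ.symm (φ (c z.2) + β z.2 • z.1) else c z.2
  have hK0 : ∀ w t, β t = 0 → K (w, t) = c t := by
    intro w t h
    by_cases ht : t ∈ T
    · simp only [K, if_pos ht, h, zero_smul, add_zero]
      exact φ.left_inv (hcT t ht)
    · simp only [K, if_neg ht]
  refine ⟨K, δ / (b + 1), by positivity, ?_, ?_, ?_, hK0, ?_⟩
  · rintro ⟨w₀, t₀⟩ ⟨hw₀, -⟩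
    apply ContMDiffAt.contMDiffWithinAt
    have hsnd : ContMDiffAt 𝓘(ℝ, EuclideanSpace ℝ (Fin m) × ℝ) (𝓡 m) ∞
        (fun z : EuclideanSpace ℝ (Fin m) × ℝ ↦ c z.2) (w₀, t₀) :=
      (hc.smooth t₀).comp (w₀, t₀) (contDiff_snd.contMDiff.contMDiffAt)
    by_cases ht : t₀ ∈ T
    · have h1 : ContMDiffAt 𝓘(ℝ, EuclideanSpace ℝ (Fin m) × ℝ) 𝓘(ℝ, EuclideanSpace ℝ (Fin m)) ∞
          (fun z : EuclideanSpace ℝ (Fin m) × ℝ ↦ φ (c z.2) + β z.2 • z.1) (w₀, t₀) := by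
        have e1 : ContMDiffAt 𝓘(ℝ, EuclideanSpace ℝ (Fin m) × ℝ)
          𝓘(ℝ, EuclideanSpace ℝ (Fin m)) ∞
          (fun z : EuclideanSpace ℝ (Fin m) × ℝ ↦ φ (c z.2)) (w₀, t₀) :=
          (contMDiffAt_chartAt (hcT t₀ ht)).comp (w₀, t₀) hsnd
        have e2 : ContDiff ℝ ∞ (fun z : EuclideanSpace ℝ (Fin m) × ℝ ↦ β z.2 • z.1) :=
          (hβ.comp contDiff_snd).smul contDiff_fst
        exact (e1.contDiffAt.add e2.contDiffAt).contMDiffAt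
      have h2 : ContMDiffAt 𝓘(ℝ, EuclideanSpace ℝ (Fin m) × ℝ) (𝓡 m) ∞
          (fun z : EuclideanSpace ℝ (Fin m) × ℝ ↦ φ.symm (φ (c z.2) + β z.2 • z.1)) (w₀, t₀) :=
        ContMDiffAt.comp (w₀, t₀) (contMDiffAt_chartAt_symm (hrad w₀ hw₀ t₀ ht)) h1
      refine h2.congr_of_eventuallyEq ?_
      filter_upwards [hsnd.continuousAt.eventually_mem (φ.open_source.mem_nhds (hcT t₀ ht))]
        with z hz
      by_cases h : z.2 ∈ T
      · simp only [K, if_pos h]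
      · simp only [K, if_neg h, hβT _ h, zero_smul, add_zero]
        exact (φ.left_inv hz).symm
    · refine hsnd.congr_of_eventuallyEq ?_
      filter_upwards [(hT.isOpen_compl.preimage continuous_snd).mem_nhds
        (show (w₀, t₀) ∈ Prod.snd ⁻¹' Tᶜ from ht)] with z hz
      exact if_neg hz
  · intro t
    by_cases ht : t ∈ T
    · simp only [K, if_pos ht, smul_zero, add_zero]
      exact φ.left_inv (hcT t ht)
    · simp only [K, if_neg ht]
  · intro w t
    have h1 : t + 1 ∈ T ↔ t ∈ T := by rw [hTi, Int.fract_add_one, ← hTi]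
    simp only [K, h1, hβp t, hc.periodic t]
  · intro w hw t ht
    simp only [K, if_pos ht]
    exact ⟨φ.map_target (hrad w hw t ht), φ.right_inv (hrad w hw t ht)⟩

variable {A : Type*} [AddCommGroup A] {Ψ : C(unitInterval, M) → A}

/-- A smooth loop can be perturbed in a chart, preserving any stable property and the value of
the path functional, by a vector in a given dense set. -/
theorem exists_perturbation (hΨ : IsPathCocycle Ψ) {c : C(ℝ, M)} (hc : IsSmoothLoop m c) (x : M)
    {β : ℝ → ℝ} (hβ : ContDiff ℝ ∞ β) (hβp : Function.Periodic β 1) {T : Set ℝ} (hT : IsClosed T)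
    (hTp : ∀ t ∈ T, ∀ k : ℤ, t + k ∈ T) (hβT : ∀ t ∉ T, β t = 0)
    (hcT : ∀ t ∈ T, c t ∈ (chartAt (EuclideanSpace ℝ (Fin m)) x).source)
    {G : Set (ℝ → M)} (hG : IsStable m G) (hcG : ⇑c ∈ G)
    {W : Set (EuclideanSpace ℝ (Fin m))} (hW : Dense W) :
    ∃ c' : C(ℝ, M), IsSmoothLoop m c' ∧ ⇑c' ∈ G ∧ Ψ (arc c' 0 1) = Ψ (arc c 0 1) ∧
      (∀ t, β t = 0 → c' t = c t) ∧
      ∃ w ∈ W, ∀ t ∈ T, c' t ∈ (chartAt (EuclideanSpace ℝ (Fin m)) x).source ∧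
        chartAt (EuclideanSpace ℝ (Fin m)) x (c' t) =
          chartAt (EuclideanSpace ℝ (Fin m)) x (c t) + β t • w := by
  obtain ⟨K, r, hr, hK, hK0, hKp, hKβ, hKT⟩ := exists_deformation hc x hβ hβp hT hTp hβT hcT
  have h0 : (fun t ↦ K (0, t)) = c := funext hK0
  have hev := (hG K r hr hK (h0 ▸ hcG)).and (Metric.ball_mem_nhds 0 hr)
  obtain ⟨w, hwW, hwG, hwr⟩ := hW.inter_nhds_nonempty hev
  have hs : ContMDiff 𝓘(ℝ) (𝓡 m) ∞ fun t ↦ K (w, t) := fun t ↦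
    (contMDiffAt_of_ball hK hwr t).comp t
      (ContDiff.contMDiff (contDiff_prodMk_right w)).contMDiffAt
  refine ⟨⟨fun t ↦ K (w, t), hs.continuous⟩, ⟨hs, hKp w⟩, hwG, ?_, hKβ w, w, hwW,
    hKT w hwr⟩
  -- Scaling the parameter from `0` to `w` is a free homotopy of loops, so `Ψ` does not change.
  let H : C(ℝ × ℝ, M) := ⟨fun z ↦ K ((clampI z.1 : ℝ) • w, z.2), by
    rw [continuous_iff_continuousAt]
    intro z
    have h1 : (clampI z.1 : ℝ) • w ∈ Metric.ball (0 : EuclideanSpace ℝ (Fin m)) r := by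
      rw [mem_ball_zero_iff, norm_smul, Real.norm_of_nonneg (clampI z.1).2.1]
      rw [dist_zero_right] at hwr
      nlinarith [norm_nonneg w, (clampI z.1).2.1, (clampI z.1).2.2]
    refine ContinuousAt.comp (f := fun z : ℝ × ℝ ↦ ((clampI z.1 : ℝ) • w, z.2))
      (contMDiffAt_of_ball hK h1 z.2).continuousAt ?_
    have h3 : Continuous fun z : ℝ × ℝ ↦ (clampI z.1 : ℝ) :=
      continuous_subtype_val.comp (clampI.continuous.comp continuous_fst)
    exact ((h3.smul continuous_const).prodMk continuous_snd).continuousAt⟩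
  have h := hΨ.eq_of_freeHomotopy H fun s ↦ by
    have := hKp ((clampI s : ℝ) • w) 0
    rw [zero_add] at this
    exact this.symm
  convert h.symm using 2
  · ext t
    have e : planeSeg (1, 0) (1, 1) t = (1, (t : ℝ)) := by simp [planeSeg]
    rw [ContinuousMap.comp_apply, e]
    change K (w, (1 - (t : ℝ)) * 0 + t * 1) = K ((clampI 1 : ℝ) • w, (t : ℝ))
    rw [clampI_one]
    simp
  · ext t
    have e : planeSeg (0, 0) (0, 1) t = (0, (t : ℝ)) := by simp [planeSeg]
    rw [ContinuousMap.comp_apply, e]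
    change c ((1 - (t : ℝ)) * 0 + t * 1) = K ((clampI 0 : ℝ) • w, (t : ℝ))
    rw [clampI_zero]
    simp [hK0]

end Perturbation
end

noncomputable section

/-! ### General position -/

section GeneralPosition

/-- The distance to the nearest integer is at most `1 / 2`, and the cosine of `2πu` decreases for
`u` in `[0, 1/2]`. -/
lemma abs_sub_round_le_of_cos_le {ρ y : ℝ} (hρ0 : 0 ≤ ρ)
    (h : Real.cos (2 * Real.pi * ρ) ≤ Real.cos (2 * Real.pi * y)) : |y - round y| ≤ ρ := by
  by_contra! hlt
  have h1 : |y - round y| ≤ 1 / 2 := abs_sub_round y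
  have h2 : Real.cos (2 * Real.pi * y) = Real.cos (2 * Real.pi * |y - round y|) := by
    have e : 2 * Real.pi * |y - round y| = |2 * Real.pi * (y - round y)| := by
      rw [abs_mul, abs_of_pos (by positivity : (0 : ℝ) < 2 * Real.pi)]
    rw [e, Real.cos_abs, ← Real.cos_sub_int_mul_two_pi (2 * Real.pi * y) (round y)]
    congr 1
    ring
  rw [h2] at h
  have h3 : Real.cos (2 * Real.pi * |y - round y|) < Real.cos (2 * Real.pi * ρ) :=
    Real.cos_lt_cos_of_nonneg_of_le_pi (by positivity) (by nlinarith [Real.pi_pos])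
      (by nlinarith [Real.pi_pos])
  linarith

lemma cos_le_cos_of_le_one_sub {ρ y : ℝ} (hρ0 : 0 ≤ ρ) (h1 : ρ ≤ y) (h2 : y ≤ 1 - ρ) :
    Real.cos (2 * Real.pi * y) ≤ Real.cos (2 * Real.pi * ρ) := by
  rcases le_total y (1 / 2) with h | h
  · exact Real.cos_le_cos_of_nonneg_of_le_pi (by positivity) (by nlinarith [Real.pi_pos])
      (by nlinarith [Real.pi_pos])
  · have e : Real.cos (2 * Real.pi * y) = Real.cos (2 * Real.pi * (1 - y)) := by
      rw [← Real.cos_neg, ← Real.cos_add_two_pi]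
      congr 1
      ring
    rw [e]
    exact Real.cos_le_cos_of_nonneg_of_le_pi (by positivity) (by nlinarith [Real.pi_pos])
      (by nlinarith [Real.pi_pos])

/-- Smooth periodic bump functions. -/
lemma exists_periodic_bump (a : ℝ) {r R : ℝ} (hr : 0 ≤ r) (hrR : r < R) (hR : R ≤ 1 / 2) :
    ∃ (b : ℝ → ℝ) (T : Set ℝ), ContDiff ℝ ∞ b ∧ Function.Periodic b 1 ∧ IsClosed T ∧
      (∀ t ∈ T, ∀ k : ℤ, t + k ∈ T) ∧ (∀ t ∉ T, b t = 0) ∧ (∀ t, |t - a| ≤ r → b t = 1) ∧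
      (∀ t ∈ T, ∃ k : ℤ, |t + k - a| ≤ R) ∧ (∀ t, |t - a| ≤ r → T ∈ 𝓝 t) ∧
      ∀ t, R ≤ t - a → t - a ≤ 1 - R → b t = 0 := by
  -- `C (t - a)` is a smooth periodic substitute for the distance from `t` to `a + ℤ`; the bump is a
  -- smooth step between its levels `C R` and `C r`.
  set C := fun y ↦ Real.cos (2 * Real.pi * y)
  have hC : ContDiff ℝ ∞ C := Real.contDiff_cos.comp (contDiff_const.mul contDiff_id)
  have hCR : C R < C r := Real.cos_lt_cos_of_nonneg_of_le_pi (by positivity)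
    (by nlinarith [Real.pi_pos]) (by nlinarith [Real.pi_pos])
  have hCr : ∀ t, |t - a| ≤ r → C r ≤ C (t - a) := by
    intro t ht
    have e : C (t - a) = C |t - a| := by
      have : 2 * Real.pi * abs (t - a) = abs (2 * Real.pi * (t - a)) := by
        rw [abs_mul, abs_of_pos (by positivity : (0 : ℝ) < 2 * Real.pi)]
      simp only [C]
      rw [this, Real.cos_abs]
    rw [e]
    exact Real.cos_le_cos_of_nonneg_of_le_pi (by positivity) (by nlinarith [Real.pi_pos])
      (by nlinarith [Real.pi_pos])
  have hCi : ∀ t (k : ℤ), C (t + k - a) = C (t - a) := by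
    intro t k
    simp only [C]
    rw [← Real.cos_add_int_mul_two_pi (2 * Real.pi * (t - a)) k]
    congr 1
    ring
  have hcont : Continuous fun t ↦ C (t - a) := hC.continuous.comp (continuous_id.sub continuous_const)
  refine ⟨fun t ↦ Real.smoothTransition ((C (t - a) - C R) / (C r - C R)),
    Set.ofPred fun t ↦ C R ≤ C (t - a), ?_, ?_, ?_, ?_, ?_, ?_, ?_, ?_, ?_⟩
  · exact Real.smoothTransition.contDiff.comp
      (((hC.comp (contDiff_id.sub contDiff_const)).sub contDiff_const).div_const _)
  · intro t
    have := hCi t 1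
    rw [Int.cast_one] at this
    simp only [this]
  · exact isClosed_le continuous_const hcont
  · intro t ht k
    change C R ≤ C (t + k - a)
    rw [hCi]
    exact ht
  · intro t ht
    have ht' : C (t - a) < C R := not_le.1 ht
    exact Real.smoothTransition.zero_of_nonpos
      (div_nonpos_of_nonpos_of_nonneg (by linarith) (by linarith))
  · intro t ht
    refine Real.smoothTransition.one_of_one_le ?_
    rw [one_le_div (by linarith)]
    linarith [hCr t ht]
  · intro t ht
    refine ⟨-round (t - a), ?_⟩
    have := abs_sub_round_le_of_cos_le (hr.trans hrR.le) ht
    push_cast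
    rwa [show t + -(round (t - a) : ℝ) - a = t - a - round (t - a) by ring]
  · intro t ht
    filter_upwards [hcont.continuousAt.eventually (lt_mem_nhds (hCR.trans_le (hCr t ht)))]
      with s hs using le_of_lt hs
  · intro t h1 h2
    have := cos_le_cos_of_le_one_sub (hr.trans hrR.le) h1 h2
    exact Real.smoothTransition.zero_of_nonpos
      (div_nonpos_of_nonpos_of_nonneg (sub_nonpos.2 this) (by linarith))

/-- The image of a `C¹` map from a space of smaller dimension has dense complement. -/
lemma dense_compl_image_of_contDiffAt {F E : Type*} [NormedAddCommGroup F] [NormedSpace ℝ F]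
    [FiniteDimensional ℝ F] [NormedAddCommGroup E] [NormedSpace ℝ E] [FiniteDimensional ℝ E]
    (h : Module.finrank ℝ F < Module.finrank ℝ E) {f : F → E} {O : Set F}
    (hf : ∀ z ∈ O, ContDiffAt ℝ 1 f z) : Dense (f '' O)ᶜ := by
  refine dense_compl_of_dimH_lt_finrank ?_
  -- A `C¹` map is locally Lipschitz, hence does not raise the Hausdorff dimension.
  have h1 : dimH (f '' O) ≤ dimH O := by
    refine dimH_image_le_of_locally_lipschitzOn fun z hz ↦ ?_
    obtain ⟨K, t, ht, hK⟩ := (hf z hz).exists_lipschitzOnWith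
    exact ⟨K, t, nhdsWithin_le_nhds ht, hK⟩
  refine (h1.trans (dimH_mono (subset_univ O))).trans_lt ?_
  rw [Real.dimH_univ_eq_finrank]
  exact_mod_cast h

/-- A Lebesgue number argument. Arcs of radius `1 / (2 * n)` about these centers already cover the
circle (`exists_arc_mem`); the threefold radius leaves room for bumps equal to one near the small
arcs. With `4 ≤ n` the large radius stays below half a period. -/
lemma exists_arc_cover {ι : Type*} {O : ι → Set ℝ} (hO : ∀ i, IsOpen (O i))
    (hcov : ∀ t, ∃ i, t ∈ O i) :
    ∃ n : ℕ, 4 ≤ n ∧ ∀ l : Fin n, ∃ i,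
      Metric.closedBall ((2 * l + 1) / (2 * n) : ℝ) (3 / (2 * n)) ⊆ O i := by
  obtain ⟨δ, hδ, h⟩ := lebesgue_number_lemma_of_metric (isCompact_Icc (a := (0 : ℝ)) (b := 1))
    hO fun t _ ↦ mem_iUnion.2 (hcov t)
  obtain ⟨n, hn⟩ := exists_nat_gt (2 / δ)
  refine ⟨n + 4, by omega, fun l ↦ ?_⟩
  have hl : (l : ℝ) + 1 ≤ (n + 4 : ℕ) := by exact_mod_cast l.2
  have hn0 : (0 : ℝ) < (n + 4 : ℕ) := by positivity
  obtain ⟨i, hi⟩ := h ((2 * l + 1) / (2 * (n + 4 : ℕ))) ⟨by positivity, by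
    rw [div_le_one (by positivity)]; linarith⟩
  refine ⟨i, (Metric.closedBall_subset_ball ?_).trans hi⟩
  rw [div_lt_iff₀ hδ] at hn
  rw [div_lt_iff₀ (by positivity)]
  push_cast
  nlinarith

lemma exists_arc_mem {n : ℕ} (hn : 0 < n) (t : ℝ) :
    ∃ (k : ℤ) (l : Fin n), |t + k - (2 * l + 1) / (2 * n)| ≤ 1 / (2 * n) := by
  have hn' : (0 : ℝ) < n := by exact_mod_cast hn
  have h0 := Int.fract_nonneg t
  have h1 := Int.fract_lt_one t
  have h2 : ⌊n * Int.fract t⌋₊ < n := by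
    rw [Nat.floor_lt (by positivity)]
    nlinarith
  refine ⟨-⌊t⌋, ⟨⌊n * Int.fract t⌋₊, h2⟩, ?_⟩
  have h3 : t + ((-⌊t⌋ : ℤ) : ℝ) = Int.fract t := by
    rw [Int.fract]; push_cast; ring
  rw [h3]
  have h4 := Nat.floor_le (show 0 ≤ n * Int.fract t by positivity)
  have h5 := Nat.lt_floor_add_one (n * Int.fract t)
  set q : ℝ := (⌊n * Int.fract t⌋₊ : ℝ)
  have h6 : Int.fract t - (2 * q + 1) / (2 * n) =
      (2 * (n * Int.fract t - q) - 1) / (2 * n) := by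
    field_simp
    ring
  change abs (Int.fract t - (2 * q + 1) / (2 * n)) ≤ _
  rw [h6, abs_div, abs_of_pos (by positivity : (0 : ℝ) < 2 * n)]
  gcongr
  rw [abs_le]
  constructor <;> linarith

variable {m : ℕ} {M : Type*} [TopologicalSpace M] [ChartedSpace (EuclideanSpace ℝ (Fin m)) M]
  [IsManifold (𝓡 m) ∞ M]

/-- A curve with nowhere vanishing derivative. -/
def IsImmersedCurve (m : ℕ) {M : Type*} [TopologicalSpace M]
    [ChartedSpace (EuclideanSpace ℝ (Fin m)) M] (c : ℝ → M) : Prop :=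
  ∀ t, ∃ x, c t ∈ (chartAt (EuclideanSpace ℝ (Fin m)) x).source ∧
    deriv (fun s ↦ chartAt (EuclideanSpace ℝ (Fin m)) x (c s)) t ≠ 0

lemma contDiffAt_chartAt_comp {c : ℝ → M} (hc : ContMDiff 𝓘(ℝ) (𝓡 m) ∞ c) {x : M} {t : ℝ}
    (ht : c t ∈ (chartAt (EuclideanSpace ℝ (Fin m)) x).source) :
    ContDiffAt ℝ ∞ (fun s ↦ chartAt (EuclideanSpace ℝ (Fin m)) x (c s)) t :=
  ((contMDiffAt_chartAt ht).comp t (hc t)).contDiffAt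

lemma ContDiffAt.deriv_right_real {E : Type*} [NormedAddCommGroup E] [NormedSpace ℝ E]
    {f : ℝ → E} {t : ℝ} (hf : ContDiffAt ℝ ∞ f t) : ContDiffAt ℝ ∞ (deriv f) t := by
  have h := hf.fderiv_right (m := ∞) (by simp)
  exact h.clm_apply contDiffAt_const

/-- The forbidden translations are the values of a smooth map of the two parameters `(s, t)`. This
is where dimension at least three is used. -/
lemma dense_translate_ne (hm : 3 ≤ m) {c d : ℝ → M} (hc : ContMDiff 𝓘(ℝ) (𝓡 m) ∞ c)
    (hd : ContMDiff 𝓘(ℝ) (𝓡 m) ∞ d) (x : M) :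
    Dense (Set.ofPred fun w : EuclideanSpace ℝ (Fin m) ↦ ∀ s t,
      c s ∈ (chartAt (EuclideanSpace ℝ (Fin m)) x).source →
      d t ∈ (chartAt (EuclideanSpace ℝ (Fin m)) x).source →
      chartAt (EuclideanSpace ℝ (Fin m)) x (c s) + w ≠
        chartAt (EuclideanSpace ℝ (Fin m)) x (d t)) := by
  set φ := chartAt (EuclideanSpace ℝ (Fin m)) x
  have h := dense_compl_image_of_contDiffAt (F := ℝ × ℝ) (E := EuclideanSpace ℝ (Fin m))
    (f := fun z ↦ φ (d z.2) - φ (c z.1))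
    (O := Set.ofPred fun z ↦ c z.1 ∈ φ.source ∧ d z.2 ∈ φ.source)
    (by simp; omega) (by
      rintro z ⟨h1, h2⟩
      have e1 := (contDiffAt_chartAt_comp hc h1).comp z contDiffAt_fst
      have e2 := (contDiffAt_chartAt_comp hd h2).comp z contDiffAt_snd
      exact (e2.sub e1).of_le (by exact_mod_cast le_top))
  refine h.mono ?_
  intro w hw s t h1 h2 heq
  refine hw ⟨(s, t), ⟨h1, h2⟩, ?_⟩
  simp only []
  rw [← heq]
  abel

/-- The forbidden vectors are the values of a smooth map of the single parameter `t`, obtained by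
solving for `w`. -/
lemma dense_deriv_add_ne (hm : 2 ≤ m) {c : ℝ → M} (hc : ContMDiff 𝓘(ℝ) (𝓡 m) ∞ c) (x : M)
    {κ : ℝ → ℝ} (hκ : ContDiff ℝ ∞ κ) :
    Dense (Set.ofPred fun w : EuclideanSpace ℝ (Fin m) ↦ ∀ t,
      c t ∈ (chartAt (EuclideanSpace ℝ (Fin m)) x).source → κ t ≠ 0 →
      deriv (fun s ↦ chartAt (EuclideanSpace ℝ (Fin m)) x (c s)) t + κ t • w ≠ 0) := by
  set φ := chartAt (EuclideanSpace ℝ (Fin m)) x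
  have h := dense_compl_image_of_contDiffAt (F := ℝ) (E := EuclideanSpace ℝ (Fin m))
    (f := fun t ↦ -((κ t)⁻¹ • deriv (fun s ↦ φ (c s)) t))
    (O := Set.ofPred fun t ↦ c t ∈ φ.source ∧ κ t ≠ 0)
    (by simp; omega) (by
      rintro t ⟨h1, h2⟩
      have e1 := (contDiffAt_chartAt_comp hc h1).deriv_right_real
      exact ((hκ.contDiffAt.inv h2).smul e1).neg.of_le (by exact_mod_cast le_top))
  refine h.mono ?_
  intro w hw t h1 h2 heq
  refine hw ⟨t, ⟨h1, h2⟩, ?_⟩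
  simp only []
  rw [eq_neg_of_add_eq_zero_left heq, smul_neg, neg_neg, smul_smul, inv_mul_cancel₀ h2, one_smul]

variable {A : Type*} [AddCommGroup A] {Ψ : C(unitInterval, M) → A}

/-- Smooth loops can be made immersed. -/
theorem exists_immersed (hm : 2 ≤ m) (hΨ : IsPathCocycle Ψ) {c₀ : C(ℝ, M)}
    (hc₀ : IsSmoothLoop m c₀) :
    ∃ c : C(ℝ, M), IsSmoothLoop m c ∧ Ψ (arc c 0 1) = Ψ (arc c₀ 0 1) ∧ IsImmersedCurve m c := by
  obtain ⟨n, hn, hcov⟩ := exists_arc_cover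
    (O := fun x : M ↦ c₀ ⁻¹' (chartAt (EuclideanSpace ℝ (Fin m)) x).source)
    (fun x ↦ (chartAt _ x).open_source.preimage c₀.continuous)
    (fun t ↦ ⟨c₀ t, mem_chart_source _ _⟩)
  choose x hx using hcov
  have hn' : (4 : ℝ) ≤ n := by exact_mod_cast hn
  have hρ : (1 : ℝ) / (2 * n) ≤ 1 / 8 := by
    rw [div_le_div_iff₀ (by positivity) (by norm_num)]; linarith
  have hρ0 : (0 : ℝ) < 1 / (2 * n) := by positivity
  have hρ3 : (3 : ℝ) / (2 * n) = 3 * (1 / (2 * n)) := by ring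
  set ρ : ℝ := 1 / (2 * n)
  let a : Fin n → ℝ := fun l ↦ (2 * l + 1) / (2 * n)
  obtain ⟨c, ⟨hc, hcΨ⟩, -, hcR⟩ := exists_forall_mem_of_isStable (m := m) (M := M)
    (P := fun c ↦ IsSmoothLoop m c ∧ Ψ (arc c 0 1) = Ψ (arc c₀ 0 1))
    (G := ⋂ l, Set.ofPred fun c : ℝ → M ↦ ∀ t ∈ Metric.closedBall (a l) (3 * ρ),
      c t ∈ (chartAt (EuclideanSpace ℝ (Fin m)) (x l)).source)
    (R := fun l ↦ Set.ofPred fun c : ℝ → M ↦ ∀ t ∈ Metric.closedBall (a l) ρ,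
      c t ∈ (chartAt (EuclideanSpace ℝ (Fin m)) (x l)).source ∧
      deriv (fun s ↦ chartAt (EuclideanSpace ℝ (Fin m)) (x l) (c s)) t ∈
        ({0}ᶜ : Set (EuclideanSpace ℝ (Fin m))))
    (fun l ↦ isStable_deriv (isCompact_closedBall _ _) _ isOpen_compl_singleton)
    (by
      rintro l G' hG' c ⟨hc, hcΨ⟩ hcG hcG'
      have hGst : IsStable m (⋂ l, Set.ofPred fun c : ℝ → M ↦
          ∀ t ∈ Metric.closedBall (a l) (3 * ρ),
            c t ∈ (chartAt (EuclideanSpace ℝ (Fin m)) (x l)).source) :=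
        IsStable.iInter fun l ↦ isStable_mem (isCompact_closedBall _ _) (chartAt _ _).open_source
      obtain ⟨b, T, hb, hbp, hT, hTp, hbT, hb1, hTR, hTn, -⟩ := exists_periodic_bump (a l)
        (r := 2 * ρ) (R := 3 * ρ) (by positivity) (by linarith) (by linarith)
      -- A periodic replacement for `t - a l`: its derivative `κ` does not vanish on the small arc,
      -- so displacing the curve by `S t • w` changes the velocity by a nonzero multiple of `w`.
      let S : ℝ → ℝ := fun t ↦ Real.sin (2 * Real.pi * (t - a l))
      have hS : ContDiff ℝ ∞ S :=
        Real.contDiff_sin.comp (contDiff_const.mul (contDiff_id.sub contDiff_const))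
      have hSp : Function.Periodic S 1 := by
        intro t
        simp only [S]
        rw [← Real.sin_add_two_pi (2 * Real.pi * (t - a l))]
        congr 1
        ring
      let κ : ℝ → ℝ := fun t ↦ Real.cos (2 * Real.pi * (t - a l)) * (2 * Real.pi)
      have hκ : ContDiff ℝ ∞ κ := (Real.contDiff_cos.comp
        (contDiff_const.mul (contDiff_id.sub contDiff_const))).mul contDiff_const
      have hcl := mem_iInter.1 hcG l
      have hcT : ∀ t ∈ T, c t ∈ (chartAt (EuclideanSpace ℝ (Fin m)) (x l)).source := by
        intro t ht
        obtain ⟨k, hk⟩ := hTR t ht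
        have := hcl (t + k) (by rwa [Metric.mem_closedBall, Real.dist_eq])
        rwa [hc.add_int] at this
      obtain ⟨c', hc', hcG'', hcΨ', -, w, hw, hwT⟩ := exists_perturbation hΨ hc (x l)
        (β := fun t ↦ b t * S t) (hb.mul hS) (hbp.mul hSp) hT hTp
        (fun t ht ↦ by simp [hbT t ht]) hcT (hGst.inter hG') ⟨hcG, hcG'⟩
        (dense_deriv_add_ne hm hc.smooth (x l) hκ)
      refine ⟨c', ⟨hc', hcΨ'.trans hcΨ⟩, hcG'', fun t ht ↦ ?_⟩
      rw [Metric.mem_closedBall, Real.dist_eq] at ht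
      have hT' := hTn t (by linarith)
      have hmem := hcT t (mem_of_mem_nhds hT')
      refine ⟨(hwT t (mem_of_mem_nhds hT')).1, ?_⟩
      have hev : (fun s ↦ chartAt (EuclideanSpace ℝ (Fin m)) (x l) (c' s)) =ᶠ[𝓝 t]
          fun s ↦ chartAt (EuclideanSpace ℝ (Fin m)) (x l) (c s) + S s • w := by
        have hlt : ∀ᶠ s in 𝓝 t, |s - a l| < 2 * ρ := by
          have hcon : Continuous fun s : ℝ ↦ |s - a l| := by fun_prop
          exact hcon.continuousAt.eventually_lt continuousAt_const (by linarith)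
        filter_upwards [hT', hlt] with s hs1 hs2
        rw [(hwT s hs1).2, hb1 s hs2.le, one_mul]
      rw [hev.deriv_eq]
      have hd1 := ((contDiffAt_chartAt_comp hc.smooth hmem).differentiableAt
        (by simp)).hasDerivAt
      have hd2 : HasDerivAt S (κ t) t := by
        have h1 : HasDerivAt (fun t ↦ 2 * Real.pi * (t - a l)) (2 * Real.pi) t := by
          simpa using ((hasDerivAt_id t).sub_const (a l)).const_mul (2 * Real.pi)
        exact (Real.hasDerivAt_sin _).comp t h1
      rw [show deriv (fun s ↦ chartAt (EuclideanSpace ℝ (Fin m)) (x l) (c s) + S s • w) t = _ from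
        (hd1.add (hd2.smul_const w)).deriv]
      refine hw t hmem ?_
      have hpos : 0 < Real.cos (2 * Real.pi * (t - a l)) := by
        have h1 := abs_le.1 (ht.trans hρ)
        refine Real.cos_pos_of_mem_Ioo ⟨?_, ?_⟩
        · nlinarith [Real.pi_pos]
        · nlinarith [Real.pi_pos]
      exact mul_ne_zero hpos.ne' (by positivity))
    ⟨hc₀, rfl⟩ (mem_iInter.2 fun l t ht ↦ hx l (by rwa [hρ3]))
  refine ⟨c, hc, hcΨ, fun t ↦ ?_⟩
  obtain ⟨k, l, hkl⟩ := exists_arc_mem (show 0 < n by omega) t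
  obtain ⟨h1, h2⟩ := hcR l (t + k) (by rwa [Metric.mem_closedBall, Real.dist_eq])
  refine ⟨x l, by rwa [hc.add_int] at h1, ?_⟩
  have e : (fun s ↦ chartAt (EuclideanSpace ℝ (Fin m)) (x l) (c s)) =
      fun s ↦ (fun r ↦ chartAt (EuclideanSpace ℝ (Fin m)) (x l) (c r)) (s + k) := by
    ext1 s
    simp only [hc.add_int]
  rw [e, deriv_comp_add_const (fun r ↦ chartAt (EuclideanSpace ℝ (Fin m)) (x l) (c r)) (k : ℝ) t]
  exact h2

/-- Immersed loops can be made embedded and disjoint from finitely many given loops. -/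
theorem exists_embedded [T2Space M] (hm : 3 ≤ m) (hΨ : IsPathCocycle Ψ) {c₀ : C(ℝ, M)}
    (hc₀ : IsSmoothLoop m c₀) (himm : IsImmersedCurve m c₀) {κ : Type*} [Finite κ]
    (d : κ → C(ℝ, M)) (hd : ∀ j, IsSmoothLoop m (d j)) :
    ∃ c : C(ℝ, M), IsSmoothLoop m c ∧ Ψ (arc c 0 1) = Ψ (arc c₀ 0 1) ∧ IsImmersedCurve m c ∧
      (∀ s t, c s = c t → ∃ k : ℤ, s = t + k) ∧ ∀ j s t, c s ≠ d j t := by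
  -- Each arc gets a chart and a direction with which the velocity has positive inner product. This
  -- stable condition preserves immersedness and makes the curve injective on every large arc.
  let O : M × EuclideanSpace ℝ (Fin m) → Set (EuclideanSpace ℝ (Fin m)) := fun i ↦
    Set.ofPred fun z ↦ 0 < inner ℝ i.2 z
  have hO : ∀ i, IsOpen (O i) := fun i ↦ isOpen_lt continuous_const (by fun_prop)
  obtain ⟨n, hn, hcov⟩ := exists_arc_cover
    (O := fun i : M × EuclideanSpace ℝ (Fin m) ↦ Set.ofPred fun t : ℝ ↦
      c₀ t ∈ (chartAt (EuclideanSpace ℝ (Fin m)) i.1).source ∧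
      deriv (fun s ↦ chartAt (EuclideanSpace ℝ (Fin m)) i.1 (c₀ s)) t ∈ O i)
    (fun i ↦ by
      rw [isOpen_iff_mem_nhds]
      rintro t ⟨h1, h2⟩
      filter_upwards [c₀.continuous.continuousAt.eventually_mem
        ((chartAt (EuclideanSpace ℝ (Fin m)) i.1).open_source.mem_nhds h1),
        (contDiffAt_chartAt_comp hc₀.smooth h1).deriv_right_real.continuousAt.eventually_mem
          ((hO i).mem_nhds h2)] with s hs1 hs2 using ⟨hs1, hs2⟩)
    (fun t ↦ by
      obtain ⟨x, hx, hne⟩ := himm t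
      exact ⟨(x, deriv (fun s ↦ chartAt (EuclideanSpace ℝ (Fin m)) x (c₀ s)) t), hx,
        real_inner_self_pos.2 hne⟩)
  choose x hx using hcov
  have hn' : (4 : ℝ) ≤ n := by exact_mod_cast hn
  have hρ : (1 : ℝ) / (2 * n) ≤ 1 / 8 := by
    rw [div_le_div_iff₀ (by positivity) (by norm_num)]; linarith
  have hρ0 : (0 : ℝ) < 1 / (2 * n) := by positivity
  have hρ3 : (3 : ℝ) / (2 * n) = 3 * (1 / (2 * n)) := by ring
  set ρ : ℝ := 1 / (2 * n)
  let a : Fin n → ℝ := fun l ↦ (2 * l + 1) / (2 * n)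
  let G : Set (ℝ → M) := ⋂ l, Set.ofPred fun c : ℝ → M ↦ ∀ t ∈ Metric.closedBall (a l) (3 * ρ),
      c t ∈ (chartAt (EuclideanSpace ℝ (Fin m)) (x l).1).source ∧
      deriv (fun s ↦ chartAt (EuclideanSpace ℝ (Fin m)) (x l).1 (c s)) t ∈ O (x l)
  have hGst : IsStable m G :=
    IsStable.iInter fun l ↦ isStable_deriv (isCompact_closedBall _ _) _ (hO _)
  -- For each arc, `none` asks that the small arc avoid the curve outside the large arc, and `some
  -- j` that it avoid `d j`.
  let R : Fin n × Option κ → Set (ℝ → M) := fun i ↦ match i with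
    | (l, none) => Set.ofPred fun c : ℝ → M ↦ ∀ s ∈ Metric.closedBall (a l) ρ,
        ∀ t ∈ Icc (a l + 3 * ρ) (a l + 1 - 3 * ρ), c s ≠ c t
    | (l, some j) => Set.ofPred fun c : ℝ → M ↦ ∀ s ∈ Metric.closedBall (a l) ρ,
        c s ∈ (d j '' Icc 0 1)ᶜ
  have hRst : ∀ i, IsStable m (R i) := by
    rintro ⟨l, _ | j⟩
    · exact isStable_ne (isCompact_closedBall _ _) isCompact_Icc
    · exact isStable_mem (isCompact_closedBall _ _)
        ((isCompact_Icc.image (d j).continuous).isClosed.isOpen_compl)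
  obtain ⟨c, ⟨hc, hcΨ⟩, hcG, hcR⟩ := exists_forall_mem_of_isStable (m := m) (M := M)
    (P := fun c ↦ IsSmoothLoop m c ∧ Ψ (arc c 0 1) = Ψ (arc c₀ 0 1)) (G := G) hRst
    (by
      rintro ⟨l, o⟩ G' hG' c ⟨hc, hcΨ⟩ hcG hcG'
      obtain ⟨b, T, hb, hbp, hT, hTp, hbT, hb1, hTR, hTn, hb0⟩ := exists_periodic_bump (a l)
        (r := 2 * ρ) (R := 3 * ρ) (by positivity) (by linarith) (by linarith)
      have hcl := mem_iInter.1 hcG l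
      have hcT : ∀ t ∈ T, c t ∈ (chartAt (EuclideanSpace ℝ (Fin m)) (x l).1).source := by
        intro t ht
        obtain ⟨k, hk⟩ := hTR t ht
        have := (hcl (t + k) (by rwa [Metric.mem_closedBall, Real.dist_eq])).1
        rwa [hc.add_int] at this
      -- The curve to be avoided. In the case of `c` itself it is the unperturbed curve, which
      -- agrees with the perturbed one outside the large arc.
      let e : C(ℝ, M) := o.elim c d
      have he : IsSmoothLoop m e := by
        cases o with
        | none => exact hc
        | some j => exact hd j
      obtain ⟨c', hc', hcG'', hcΨ', hc0, w, hw, hwT⟩ := exists_perturbation hΨ hc (x l).1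
        hb hbp hT hTp hbT hcT (hGst.inter hG') ⟨hcG, hcG'⟩
        (dense_translate_ne hm hc.smooth he.smooth (x l).1)
      refine ⟨c', ⟨hc', hcΨ'.trans hcΨ⟩, hcG'', ?_⟩
      have key : ∀ s ∈ Metric.closedBall (a l) ρ, ∀ t, c' s ≠ e t := by
        intro s hs t heq
        rw [Metric.mem_closedBall, Real.dist_eq] at hs
        have hsT := mem_of_mem_nhds (hTn s (by linarith))
        obtain ⟨h1, h2⟩ := hwT s hsT
        rw [hb1 s (by linarith), one_smul, heq] at h2
        exact hw s t (hcT s hsT) (heq ▸ h1) h2.symm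
      cases o with
      | none =>
        intro s hs t ht
        rw [hc0 t (hb0 t (by linarith [ht.1]) (by linarith [ht.2]))]
        exact key s hs t
      | some j =>
        rintro s hs ⟨t, -, ht⟩
        exact key s hs t ht.symm)
    ⟨hc₀, rfl⟩ (mem_iInter.2 fun l t ht ↦ hx l (by rwa [hρ3]))
  have hmono : ∀ l, ∀ s ∈ Metric.closedBall (a l) (3 * ρ), ∀ t ∈ Metric.closedBall (a l) (3 * ρ),
      c s = c t → s = t := by
    intro l s hs t ht hst
    have hG := mem_iInter.1 hcG l
    let f : ℝ → ℝ := fun u ↦ inner ℝ (x l).2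
      (chartAt (EuclideanSpace ℝ (Fin m)) (x l).1 (c u))
    have hder : ∀ u ∈ Metric.closedBall (a l) (3 * ρ), HasDerivAt f (inner ℝ (x l).2
        (deriv (fun s ↦ chartAt (EuclideanSpace ℝ (Fin m)) (x l).1 (c s)) u)) u := by
      intro u hu
      have h1 := ((contDiffAt_chartAt_comp hc.smooth (hG u hu).1).differentiableAt
        (by simp)).hasDerivAt
      exact (innerSL ℝ (x l).2).hasFDerivAt.comp_hasDerivAt u h1
    have hsm : StrictMonoOn f (Metric.closedBall (a l) (3 * ρ)) := by
      refine strictMonoOn_of_deriv_pos (convex_closedBall _ _)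
        (fun u hu ↦ (hder u hu).continuousAt.continuousWithinAt) fun u hu ↦ ?_
      have hu' := interior_subset hu
      rw [(hder u hu').deriv]
      exact (hG u hu').2
    exact hsm.injOn hs ht (by simp only [f, hst])
  refine ⟨c, hc, hcΨ, fun t ↦ ?_, fun s t hst ↦ ?_, fun j s t hst ↦ ?_⟩
  · obtain ⟨k, l, hkl⟩ := exists_arc_mem (show 0 < n by omega) t
    obtain ⟨h1, h2⟩ := mem_iInter.1 hcG l (t + k) (by
      rw [Metric.mem_closedBall, Real.dist_eq]; exact hkl.trans (by linarith))
    refine ⟨(x l).1, by rwa [hc.add_int] at h1, ?_⟩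
    have e : (fun s ↦ chartAt (EuclideanSpace ℝ (Fin m)) (x l).1 (c s)) =
        fun s ↦ (fun r ↦ chartAt (EuclideanSpace ℝ (Fin m)) (x l).1 (c r)) (s + k) := by
      ext1 s
      simp only [hc.add_int]
    rw [e, deriv_comp_add_const (fun r ↦ chartAt (EuclideanSpace ℝ (Fin m)) (x l).1 (c r))
      (k : ℝ) t]
    intro h0
    have h2' : 0 < inner ℝ (x l).2 _ := h2
    rw [h0, inner_zero_right] at h2'
    exact lt_irrefl _ h2'
  · obtain ⟨k, l, hkl⟩ := exists_arc_mem (show 0 < n by omega) s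
    have hs' : s + k ∈ Metric.closedBall (a l) ρ := by rwa [Metric.mem_closedBall, Real.dist_eq]
    have hs3 := Metric.closedBall_subset_closedBall (show ρ ≤ 3 * ρ by linarith) hs'
    -- This shift brings `t` into the period starting at `a l - 3 * ρ`: either into the large arc,
    -- where the curve is injective, or into its complement, which the small arc avoids.
    set k' : ℤ := -⌊t - (a l - 3 * ρ)⌋
    have h1 := Int.floor_le (t - (a l - 3 * ρ))
    have h2 := Int.lt_floor_add_one (t - (a l - 3 * ρ))
    have hk' : (k' : ℝ) = -(⌊t - (a l - 3 * ρ)⌋ : ℝ) := by simp [k']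
    have hst' : c (s + k) = c (t + k') := by rw [hc.add_int, hc.add_int, hst]
    rcases le_total (t + k') (a l + 3 * ρ) with h | h
    · have := hmono l _ hs3 (t + k') (by
        rw [Metric.mem_closedBall, Real.dist_eq, abs_le]; constructor <;> linarith) hst'
      refine ⟨k' - k, ?_⟩
      push_cast
      linarith
    · exact absurd hst' (hcR (l, none) _ hs' _ ⟨h, by linarith⟩)
  · obtain ⟨k, l, hkl⟩ := exists_arc_mem (show 0 < n by omega) s
    have hs' : s + k ∈ Metric.closedBall (a l) ρ := by rwa [Metric.mem_closedBall, Real.dist_eq]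
    refine hcR (l, some j) _ hs' ⟨Int.fract t, ⟨Int.fract_nonneg t, (Int.fract_lt_one t).le⟩, ?_⟩
    rw [hc.add_int, hst]
    have := (hd j).add_int (Int.fract t) ⌊t⌋
    rw [Int.fract_add_floor] at this
    exact this.symm

/-- A smoothly embedded circle, parametrized with period one. -/
structure IsEmbeddedLoop (m : ℕ) {M : Type*} [TopologicalSpace M]
    [ChartedSpace (EuclideanSpace ℝ (Fin m)) M] (c : C(ℝ, M)) : Prop extends
    IsSmoothLoop m c where
  immersed : IsImmersedCurve m c
  injective : ∀ s t, c s = c t → ∃ k : ℤ, s = t + k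

/-- In dimension at least three, finitely many loops can be replaced by disjoint smoothly
embedded circles. -/
theorem exists_disjoint_embedded [T2Space M] (hm : 3 ≤ m) (hΨ : IsPathCocycle Ψ) {ι : Type*}
    [Finite ι] {x : M} (p : ι → Path x x) :
    ∃ γ : ι → C(ℝ, M), (∀ i, IsEmbeddedLoop m (γ i)) ∧
      (∀ i, Ψ (arc (γ i) 0 1) = Ψ (p i).toContinuousMap) ∧
      ∀ i j, i ≠ j → ∀ s t, γ i s ≠ γ j t := by
  classical
  have := Fintype.ofFinite ι
  have key : ∀ S : Finset ι, ∃ γ : ι → C(ℝ, M), (∀ i ∈ S, IsEmbeddedLoop m (γ i)) ∧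
      (∀ i ∈ S, Ψ (arc (γ i) 0 1) = Ψ (p i).toContinuousMap) ∧
      ∀ i ∈ S, ∀ j ∈ S, i ≠ j → ∀ s t, γ i s ≠ γ j t := by
    intro S
    induction S using Finset.induction_on with
    | empty => exact ⟨fun _ ↦ ContinuousMap.const _ x, by simp, by simp, by simp⟩
    | insert i₀ S hi₀ ih =>
      obtain ⟨γ, h1, h2, h3⟩ := ih
      obtain ⟨c, hc, hcp, hcΨ⟩ := exists_periodic_of_loop (m := m) hΨ (p i₀)
      obtain ⟨c', hc', hcΨ', himm⟩ := exists_immersed (by omega) hΨ ⟨hc, hcp⟩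
      obtain ⟨e, he, heΨ, heimm, heinj, hed⟩ := exists_embedded hm hΨ hc' himm
        (fun j : S ↦ γ j) (fun j ↦ (h1 j j.2).toIsSmoothLoop)
      have hne : ∀ i ∈ S, i ≠ i₀ := fun i hi h ↦ hi₀ (h ▸ hi)
      refine ⟨Function.update γ i₀ e, fun i hi ↦ ?_, fun i hi ↦ ?_, fun i hi j hj hij s t ↦ ?_⟩
      · rcases Finset.mem_insert.1 hi with rfl | hi
        · rw [Function.update_self]; exact ⟨he, heimm, heinj⟩
        · rw [Function.update_of_ne (hne i hi)]; exact h1 i hi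
      · rcases Finset.mem_insert.1 hi with rfl | hi
        · rw [Function.update_self, heΨ, hcΨ', hcΨ]
        · rw [Function.update_of_ne (hne i hi)]; exact h2 i hi
      · rcases Finset.mem_insert.1 hi with rfl | hi' <;> rcases Finset.mem_insert.1 hj with rfl | hj'
        · exact absurd rfl hij
        · rw [Function.update_self, Function.update_of_ne (hne j hj')]
          exact hed ⟨j, hj'⟩ s t
        · rw [Function.update_self, Function.update_of_ne (hne i hi')]
          exact (hed ⟨i, hi'⟩ t s).symm
        · rw [Function.update_of_ne (hne i hi'), Function.update_of_ne (hne j hj')]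
          exact h3 i hi' j hj' hij s t
  obtain ⟨γ, h1, h2, h3⟩ := key Finset.univ
  exact ⟨γ, fun i ↦ h1 i (Finset.mem_univ i), fun i ↦ h2 i (Finset.mem_univ i),
    fun i j ↦ h3 i (Finset.mem_univ i) j (Finset.mem_univ j)⟩

end GeneralPosition
end

noncomputable section

/-! ### The metric in charts -/

section ChartMetric

variable {m : ℕ} {M : Type*} [TopologicalSpace M] [ChartedSpace (EuclideanSpace ℝ (Fin m)) M]
  [IsManifold (𝓡 m) ∞ M]

variable (m) in
/-- The differential of the preferred chart at `x`, at the point `y`. -/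
def chartDeriv (x y : M) : TangentSpace (𝓡 m) y →L[ℝ] EuclideanSpace ℝ (Fin m) :=
  mfderiv (𝓡 m) 𝓘(ℝ, EuclideanSpace ℝ (Fin m)) (chartAt (EuclideanSpace ℝ (Fin m)) x) y

lemma hasMFDerivAt_chartAt {x y : M}
    (hy : y ∈ (chartAt (EuclideanSpace ℝ (Fin m)) x).source) :
    HasMFDerivAt (𝓡 m) 𝓘(ℝ, EuclideanSpace ℝ (Fin m))
      (chartAt (EuclideanSpace ℝ (Fin m)) x) y (chartDeriv m x y) :=
  ((contMDiffAt_chartAt hy).mdifferentiableAt (by simp)).hasMFDerivAt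

lemma chartDeriv_isInvertible {x y : M}
    (hy : y ∈ (chartAt (EuclideanSpace ℝ (Fin m)) x).source) : (chartDeriv m x y).IsInvertible :=
  isInvertible_mfderiv_extChartAt (I := 𝓡 m) (x := x) (by simpa using hy)

lemma chartDeriv_surjective {x y : M}
    (hy : y ∈ (chartAt (EuclideanSpace ℝ (Fin m)) x).source) :
    Function.Surjective (chartDeriv m x y) := (chartDeriv_isInvertible hy).surjective

section General

variable {EB HB B F : Type*} [NormedAddCommGroup EB]
  [NormedSpace ℝ EB] [TopologicalSpace HB] {IB : ModelWithCorners ℝ EB HB} {n : ℕ∞ω}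
  [TopologicalSpace B] [ChartedSpace HB B] [NormedAddCommGroup F] [NormedSpace ℝ F]
  {V : B → Type*} [TopologicalSpace (TotalSpace F V)] [∀ b, TopologicalSpace (V b)]
  [∀ b, AddCommGroup (V b)] [∀ b, Module ℝ (V b)] [FiberBundle F V] [VectorBundle ℝ F V]

lemma ContMDiffRiemannianMetric.contMDiffAt_inner
    (g : ContMDiffRiemannianMetric IB n F V) {X Y : ∀ x, V x} {x : B}
    (hX : ContMDiffAt IB (IB.prod 𝓘(ℝ, F)) n (fun b ↦ TotalSpace.mk' F b (X b)) x)
    (hY : ContMDiffAt IB (IB.prod 𝓘(ℝ, F)) n (fun b ↦ TotalSpace.mk' F b (Y b)) x) :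
    ContMDiffAt IB 𝓘(ℝ) n (fun b ↦ g.inner b (X b) (Y b)) x := by
  have : ContMDiffAt IB (IB.prod 𝓘(ℝ)) n
      (fun b ↦ TotalSpace.mk' ℝ (E := Bundle.Trivial B ℝ) b (g.inner b (X b) (Y b))) x := by
    apply ContMDiffAt.clm_bundle_apply₂ (F₁ := F) (F₂ := F)
    · exact g.contMDiff x
    · exact hX
    · exact hY
  simp only [contMDiffAt_totalSpace] at this
  exact this.2

/-- A smooth Riemannian metric multiplied by a positive smooth function. -/
def ContMDiffRiemannianMetric.conformal [∀ b, IsTopologicalAddGroup (V b)]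
    [∀ b, ContinuousConstSMul ℝ (V b)] (g : ContMDiffRiemannianMetric IB n F V) (f : B → ℝ)
    (hf : ContMDiff IB 𝓘(ℝ) n f) (hpos : ∀ x, 0 < f x) : ContMDiffRiemannianMetric IB n F V where
  inner b := f b • g.inner b
  symm b v w := by simp [g.symm b v w]
  pos b v hv := by simpa using mul_pos (hpos b) (g.pos b v hv)
  isVonNBounded b := by
    -- The unit ball of the rescaled metric is the old one scaled by the inverse square root of the
    -- factor.
    have h := (g.isVonNBounded b).image
      ((Real.sqrt (f b))⁻¹ • ContinuousLinearMap.id ℝ (V b))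
    refine Bornology.IsVonNBounded.subset ?_ h
    intro v hv
    refine (Set.mem_image _ _ _).2 ⟨Real.sqrt (f b) • v, ?_, ?_⟩
    · have : f b * g.inner b v v < 1 := hv
      simp only [map_smul, smul_apply, smul_eq_mul, mem_ofPred_eq]
      rw [← mul_assoc, Real.mul_self_sqrt (hpos b).le]
      exact this
    · simp [smul_smul, (Real.sqrt_pos.2 (hpos b)).ne']
  contMDiff := hf.smul_section g.contMDiff

end General

/-- Supplies the smooth local frame in which the coefficients of a metric are smooth functions. -/
lemma contMDiffAt_trivializationAt_symm (x : M) {y : M}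
    (hy : y ∈ (chartAt (EuclideanSpace ℝ (Fin m)) x).source) (v : EuclideanSpace ℝ (Fin m)) :
    ContMDiffAt (𝓡 m) ((𝓡 m).prod 𝓘(ℝ, EuclideanSpace ℝ (Fin m))) ∞
      (fun b ↦ TotalSpace.mk' (EuclideanSpace ℝ (Fin m)) b
        ((trivializationAt (EuclideanSpace ℝ (Fin m)) (TangentSpace (𝓡 m)) x).symmL ℝ b v)) y := by
  have h := ((trivializationAt (EuclideanSpace ℝ (Fin m)) (TangentSpace (𝓡 m) (M := M))
    x).contMDiffOn_symm (n := ∞) (IB := 𝓡 m))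
  have hopen := (trivializationAt (EuclideanSpace ℝ (Fin m)) (TangentSpace (𝓡 m) (M := M))
    x).open_target
  have hmem : (y, v) ∈ (trivializationAt (EuclideanSpace ℝ (Fin m)) (TangentSpace (𝓡 m) (M := M))
    x).target := by
    rw [Trivialization.mem_target]; exact hy
  have h1 : ContMDiffAt (𝓡 m) ((𝓡 m).prod 𝓘(ℝ, EuclideanSpace ℝ (Fin m))) ∞
      (fun b : M ↦ (b, v)) y := contMDiffAt_id.prodMk contMDiffAt_const
  refine ((h.contMDiffAt (hopen.mem_nhds hmem)).comp y h1).congr_of_eventuallyEq ?_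
  filter_upwards [(chartAt (EuclideanSpace ℝ (Fin m)) x).open_source.mem_nhds hy] with b hb
  have hb' : b ∈ (trivializationAt (EuclideanSpace ℝ (Fin m)) (TangentSpace (𝓡 m) (M := M))
    x).baseSet := hb
  rw [Trivialization.symmL_apply _ hb']
  exact Trivialization.mk_symm _ hb' v

lemma trivializationAt_symm_chartDeriv (x : M) {y : M}
    (hy : y ∈ (chartAt (EuclideanSpace ℝ (Fin m)) x).source) (v : TangentSpace (𝓡 m) y) :
    (trivializationAt (EuclideanSpace ℝ (Fin m)) (TangentSpace (𝓡 m)) x).symmL ℝ y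
      (chartDeriv m x y v) = v := by
  have h := TangentBundle.continuousLinearMapAt_trivializationAt (I := 𝓡 m) (x₀ := x) hy
  have h2 := (trivializationAt (EuclideanSpace ℝ (Fin m)) (TangentSpace (𝓡 m))
    x).symmL_continuousLinearMapAt (R := ℝ) hy v
  rw [h] at h2
  exact h2

/-- In a chart, a smooth metric is given by a smooth family of bilinear forms. -/
theorem SmoothMetric.exists_chart_form (g : SmoothMetric m M) (x : M) :
    ∃ G : M → EuclideanSpace ℝ (Fin m) →L[ℝ] EuclideanSpace ℝ (Fin m) →L[ℝ] ℝ,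
      ∀ y ∈ (chartAt (EuclideanSpace ℝ (Fin m)) x).source,
        ContMDiffAt (𝓡 m) 𝓘(ℝ, EuclideanSpace ℝ (Fin m) →L[ℝ] EuclideanSpace ℝ (Fin m) →L[ℝ] ℝ) ∞
          G y ∧
        ∀ v w : TangentSpace (𝓡 m) y,
          g.inner y v w = G y (chartDeriv m x y v) (chartDeriv m x y w) := by
  let X (i : Fin m) (y : M) : TangentSpace (𝓡 m) y :=
    (trivializationAt (EuclideanSpace ℝ (Fin m)) (TangentSpace (𝓡 m)) x).symmL ℝ y
      (EuclideanSpace.single i 1)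
  let B (i j : Fin m) : EuclideanSpace ℝ (Fin m) →L[ℝ] EuclideanSpace ℝ (Fin m) →L[ℝ] ℝ :=
    (EuclideanSpace.proj i : EuclideanSpace ℝ (Fin m) →L[ℝ] ℝ).smulRight
      (EuclideanSpace.proj j : EuclideanSpace ℝ (Fin m) →L[ℝ] ℝ)
  refine ⟨fun y ↦ ∑ i, ∑ j, g.inner y (X i y) (X j y) • B i j, fun y hy ↦ ⟨?_, fun v w ↦ ?_⟩⟩
  · refine contMDiffAt_finsetSum fun i _ ↦ contMDiffAt_finsetSum fun j _ ↦ ?_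
    exact (ContMDiffRiemannianMetric.contMDiffAt_inner g
      (contMDiffAt_trivializationAt_symm x hy _)
      (contMDiffAt_trivializationAt_symm x hy _)).smul contMDiffAt_const
  · have key (v : TangentSpace (𝓡 m) y) : v = ∑ i, (chartDeriv m x y v) i • X i y := by
      conv_lhs => rw [← trivializationAt_symm_chartDeriv x hy v]
      let L := (trivializationAt (EuclideanSpace ℝ (Fin m)) (TangentSpace (𝓡 m)) x).symmL ℝ y
      have e : (chartDeriv m x y v) = ∑ i, (chartDeriv m x y v) i • EuclideanSpace.single i 1 := by
        ext k; simp [Pi.single_apply]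
      change L (chartDeriv m x y v) = ∑ i, (chartDeriv m x y v) i • L (EuclideanSpace.single i 1)
      conv_lhs => rw [e]
      simp only [map_sum, map_smul]
    conv_lhs => rw [key v, key w]
    simp only [map_sum, map_smul, sum_apply, smul_apply,
      smul_eq_mul, B, ContinuousLinearMap.smulRight_apply, Finset.mul_sum]
    rw [Finset.sum_comm]
    refine Finset.sum_congr rfl fun i _ ↦ Finset.sum_congr rfl fun j _ ↦ ?_
    change _ = g.inner y (X i y) (X j y) * (chartDeriv m x y v i * chartDeriv m x y w j)
    ring

end ChartMetric
end

noncomputable section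

/-! ### A time function near an embedded curve -/

/-- A smooth function inverse to the curve `c` near `t₀`, with prescribed differential along the
curve. -/
theorem exists_time_function {E : Type*} [NormedAddCommGroup E] [NormedSpace ℝ E]
    {c : ℝ → E} {L : ℝ → E →L[ℝ] ℝ} {t₀ : ℝ}
    (hc : ∀ᶠ t in 𝓝 t₀, ContDiffAt ℝ ∞ c t) (hL : ∀ᶠ t in 𝓝 t₀, ContDiffAt ℝ ∞ L t)
    (h1 : ∀ᶠ t in 𝓝 t₀, L t (deriv c t) = 1) :
    ∃ h : E → ℝ, (∀ᶠ z in 𝓝 (c t₀), ContDiffAt ℝ ∞ h z) ∧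
      ∀ᶠ t in 𝓝 t₀, h (c t) = t ∧ fderiv ℝ h (c t) = L t := by
  have hcc : ∀ᶠ t in 𝓝 t₀, ContDiffAt ℝ ∞ (fun t ↦ L t₀ (c t)) t := by
    filter_upwards [hc] with t ht
    exact (L t₀).contDiff.contDiffAt.comp t ht
  have hder (t : ℝ) (ht : ContDiffAt ℝ ∞ c t) :
      HasDerivAt (fun t ↦ L t₀ (c t)) (L t₀ (deriv c t)) t :=
    (L t₀).hasFDerivAt.comp_hasDerivAt t (ht.differentiableAt (by simp)).hasDerivAt
  have hne : ∀ᶠ t in 𝓝 t₀, L t₀ (deriv c t) ≠ 0 := by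
    have hd : ContDiffAt ℝ ∞ (deriv c) t₀ := hc.self_of_nhds.deriv_right_real
    have : ContinuousAt (fun t ↦ L t₀ (deriv c t)) t₀ :=
      (L t₀).continuous.continuousAt.comp hd.continuousAt
    refine this.eventually_ne ?_
    rw [h1.self_of_nhds]; exact one_ne_zero
  have hs : HasStrictDerivAt (fun t ↦ L t₀ (c t)) (L t₀ (deriv c t₀)) t₀ :=
    hcc.self_of_nhds.hasStrictDerivAt' (hder t₀ hc.self_of_nhds) (by simp)
  let e := hs.hasStrictFDerivAt_equiv (hne.self_of_nhds) |>.toOpenPartialHomeomorph _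
  have hes : t₀ ∈ e.source := HasStrictFDerivAt.mem_toOpenPartialHomeomorph_source _
  have he (t : ℝ) : e t = L t₀ (c t) := rfl
  -- the local inverse
  have hτ : ∀ᶠ t in 𝓝 t₀, ContDiffAt ℝ ∞ e.symm (e t) := by
    filter_upwards [hcc, hc, hne, e.open_source.mem_nhds hes] with t h h' h0 hts
    refine e.contDiffAt_symm_deriv h0 (e.map_source hts) ?_ ?_
    · rw [e.left_inv hts]; exact hder t h'
    · rw [e.left_inv hts]; exact h
  have hinv : ∀ᶠ t in 𝓝 t₀, e.symm (e t) = t := by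
    filter_upwards [e.open_source.mem_nhds hes] with t hts using e.left_inv hts
  have hsymm : Tendsto e.symm (𝓝 (e t₀)) (𝓝 t₀) := by
    have := e.continuousAt_symm (e.map_source hes)
    rwa [ContinuousAt, e.left_inv hes] at this
  have hLc : Tendsto (fun z ↦ L t₀ z) (𝓝 (c t₀)) (𝓝 (e t₀)) := (L t₀).continuous.tendsto _
  let τ : E → ℝ := fun z ↦ e.symm (L t₀ z)
  have hτt : Tendsto τ (𝓝 (c t₀)) (𝓝 t₀) := hsymm.comp hLc
  have hτc : ∀ᶠ t in 𝓝 t₀, τ (c t) = t := hinv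
  have hτs : ∀ᶠ z in 𝓝 (c t₀), ContDiffAt ℝ ∞ τ z := by
    have h2 : ∀ᶠ s in 𝓝 (e t₀), ContDiffAt ℝ ∞ e.symm s := by
      filter_upwards [hsymm.eventually hτ, e.open_target.mem_nhds (e.map_source hes)] with s hs ht
      rwa [e.right_inv ht] at hs
    filter_upwards [hLc.eventually h2] with z hz
    exact hz.comp z (L t₀).contDiff.contDiffAt
  -- `τ` is a smooth left inverse of `c`. The correction vanishes on the curve and contributes `L -
  -- L (c') dτ` to the differential there; as `L (c') = 1`, the total is `L`.
  refine ⟨fun z ↦ τ z + L (τ z) (z - c (τ z)), ?_, ?_⟩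
  · filter_upwards [hτs, hτt.eventually hc, hτt.eventually hL] with z h h' h''
    exact h.add ((h''.comp z h).clm_apply (contDiffAt_id.sub (h'.comp z h)))
  · have hcont : Tendsto c (𝓝 t₀) (𝓝 (c t₀)) := hc.self_of_nhds.continuousAt
    filter_upwards [hτc, hcont.eventually hτs, hc, hL, h1] with t ht hs hct hLt h1t
    refine ⟨by simp [ht], ?_⟩
    have d1 : HasFDerivAt τ (fderiv ℝ τ (c t)) (c t) :=
      (hs.differentiableAt (by simp)).hasFDerivAt
    have d2 : HasFDerivAt (fun z ↦ c (τ z))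
        ((ContinuousLinearMap.toSpanSingleton ℝ (deriv c t)).comp (fderiv ℝ τ (c t))) (c t) := by
      refine HasFDerivAt.comp (c t) ?_ d1
      rw [ht]
      exact (hct.differentiableAt (by simp)).hasDerivAt.hasFDerivAt
    have d3 : HasFDerivAt (fun z ↦ L (τ z)) ((fderiv ℝ L t).comp (fderiv ℝ τ (c t))) (c t) := by
      refine HasFDerivAt.comp (c t) ?_ d1
      rw [ht]
      exact (hLt.differentiableAt (by simp)).hasFDerivAt
    have d4 := d1.add (d3.clm_apply ((hasFDerivAt_id (c t)).sub d2))
    refine d4.fderiv.trans ?_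
    ext v
    simp [ht, h1t]

end

noncomputable section

/-! ### Local primitives of a path cocycle -/

section Primitive

variable {m : ℕ} {M : Type*} [TopologicalSpace M] {V : Type*} [AddCommGroup V]
  {Ψ : C(unitInterval, M) → V} {k k' : M → V} {x : M}

/-- `k` is a primitive of the path cocycle `Ψ` near `x`. -/
def IsPrimitiveAt (Ψ : C(unitInterval, M) → V) (k : M → V) (x : M) : Prop :=
  ∃ U ∈ 𝓝 x, ∀ p : C(unitInterval, M), (∀ t, p t ∈ U) → Ψ p = k (p 1) - k (p 0)

lemma IsPrimitiveAt.eventually (hk : IsPrimitiveAt Ψ k x) :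
    ∀ᶠ y in 𝓝 x, IsPrimitiveAt Ψ k y := by
  obtain ⟨U, hU, h⟩ := hk
  filter_upwards [eventually_mem_nhds_iff.2 hU] with y hy using ⟨U, hy, h⟩

lemma IsPrimitiveAt.sub_const (hk : IsPrimitiveAt Ψ k x) (v : V) :
    IsPrimitiveAt Ψ (fun y ↦ k y - v) x := by
  obtain ⟨U, hU, h⟩ := hk
  exact ⟨U, hU, fun p hp ↦ by simp [h p hp]⟩

lemma IsPrimitiveAt.arc_eq {c : C(ℝ, M)} {t₀ : ℝ} (hk : IsPrimitiveAt Ψ k (c t₀)) :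
    ∀ᶠ t in 𝓝 t₀, Ψ (arc c t₀ t) = k (c t) - k (c t₀) := by
  obtain ⟨U, hU, h⟩ := hk
  obtain ⟨r, hr, hrU⟩ := Metric.mem_nhds_iff.1 (c.continuous.continuousAt.preimage_mem_nhds hU)
  filter_upwards [Metric.ball_mem_nhds t₀ hr] with t ht
  rw [h]
  · simp [arc_apply]
  · intro s
    rw [arc_apply]
    refine hrU ((convex_ball t₀ r) (Metric.mem_ball_self hr) ht (sub_nonneg.2 s.2.2) s.2.1 ?_)
    ring

variable [ChartedSpace (EuclideanSpace ℝ (Fin m)) M]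

lemma IsChartConvex.exists_path {U : Set M} {x : M} {B : Set (EuclideanSpace ℝ (Fin m))}
    (hU : IsChartConvex m U x B) {y z : M} (hy : y ∈ U) (hz : z ∈ U) :
    ∃ p : Path y z, ∀ t, p t ∈ U := by
  set φ := chartAt (EuclideanSpace ℝ (Fin m)) x
  have hy' := hy
  have hz' := hz
  rw [hU.eq] at hy' hz'
  let K : unitInterval → EuclideanSpace ℝ (Fin m) := fun t ↦ (1 - (t : ℝ)) • φ y + (t : ℝ) • φ z
  have hK : Continuous K := by fun_prop
  have hKB : ∀ t, K t ∈ B := fun t ↦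
    hU.convex hy'.2 hz'.2 (sub_nonneg.2 t.2.2) t.2.1 (by ring)
  refine ⟨⟨⟨fun t ↦ φ.symm (K t),
    φ.continuousOn_symm.comp_continuous hK fun z ↦ hU.subset (hKB z)⟩, ?_, ?_⟩, fun t ↦
    hU.symm_mem (hKB t)⟩
  · simp [K, φ.left_inv hy'.1]
  · simp [K, φ.left_inv hz'.1]

/-- In a convex chart the value on a path depends only on its ends, so the value on any path from
`x` inside the chart is a primitive. -/
lemma IsPathCocycle.exists_isPrimitiveAt (m : ℕ) [ChartedSpace (EuclideanSpace ℝ (Fin m)) M]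
    (hΨ : IsPathCocycle Ψ) (x : M) :
    ∃ k : M → V, IsPrimitiveAt Ψ k x := by
  classical
  obtain ⟨U, B, hU, hxU, -⟩ := exists_isChartConvex m x univ_mem
  choose p hp using fun (y : M) (hy : y ∈ U) ↦ (hU.exists_path hxU hy)
  refine ⟨fun y ↦ if hy : y ∈ U then Ψ (p y hy).toContinuousMap else 0, U,
    hU.isOpen_set.mem_nhds hxU, fun q hq ↦ ?_⟩
  simp only [hq, dite_true]
  rw [eq_sub_iff_add_eq, add_comm]
  let q' : Path (q 0) (q 1) := ⟨q, rfl, rfl⟩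
  have h := hΨ.trans (p (q 0) (hq 0)) q'
  refine Eq.trans h.symm (hΨ.eq_of_isChartConvex hU ?_ (hp _ (hq 1)) (by simp) (by simp))
  intro t
  have ht : ((p (q 0) (hq 0)).trans q') t ∈ range ((p (q 0) (hq 0)).trans q') := ⟨t, rfl⟩
  rw [Path.trans_range] at ht
  rcases ht with ⟨s, hs⟩ | ⟨s, hs⟩
  · change ((p (q 0) (hq 0)).trans q') t ∈ U
    rw [← hs]; exact hp _ (hq 0) s
  · change ((p (q 0) (hq 0)).trans q') t ∈ U
    rw [← hs]; exact hq s

/-- Two primitives differ by a constant. -/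
lemma IsPrimitiveAt.sub_eq_sub (m : ℕ) [ChartedSpace (EuclideanSpace ℝ (Fin m)) M]
    (hk : IsPrimitiveAt Ψ k x)
    (hk' : IsPrimitiveAt Ψ k' x) : ∀ᶠ y in 𝓝 x, k y - k x = k' y - k' x := by
  obtain ⟨W, hW, h⟩ := hk
  obtain ⟨W', hW', h'⟩ := hk'
  obtain ⟨U, B, hU, hxU, hUW⟩ := exists_isChartConvex m x (inter_mem hW hW')
  filter_upwards [hU.isOpen_set.mem_nhds hxU] with y hy
  obtain ⟨p, hp⟩ := hU.exists_path hxU hy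
  have e := h p.toContinuousMap fun t ↦ (hUW (hp t)).1
  have e' := h' p.toContinuousMap fun t ↦ (hUW (hp t)).2
  simpa using e.symm.trans e'

end Primitive

/-! ### Position of finitely many disjoint embedded curves -/

section Curves

variable {m : ℕ} {M : Type*} [TopologicalSpace M] [T2Space M]
  [ChartedSpace (EuclideanSpace ℝ (Fin m)) M] {ι : Type*} [Finite ι] {γ : ι → C(ℝ, M)}

lemma eventually_forall_ne_curve (hγ : ∀ i, IsEmbeddedLoop m (γ i)) {x : M}
    (hx : ∀ i t, γ i t ≠ x) : ∀ᶠ y in 𝓝 x, ∀ i t, γ i t ≠ y := by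
  rw [eventually_all]
  intro i
  have hc : IsClosed (γ i '' Icc 0 1) := (isCompact_Icc.image (γ i).continuous).isClosed
  have hx' : x ∉ γ i '' Icc 0 1 := by
    rintro ⟨t, -, ht⟩; exact hx i t ht
  filter_upwards [hc.isOpen_compl.mem_nhds hx'] with y hy t ht
  refine hy ⟨Int.fract t, ⟨Int.fract_nonneg t, (Int.fract_lt_one t).le⟩, ?_⟩
  rw [← ht, ← (hγ i).add_int (Int.fract t) ⌊t⌋, Int.fract_add_floor]

/-- By compactness and embeddedness, only the branch of `γ i` at times close to `t₀` modulo integers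
passes near `γ i t₀`. Conditions known near `t₀` thus hold, up to an integer shift, at every curve
point nearby. -/
lemma eventually_curve_eq (hγ : ∀ i, IsEmbeddedLoop m (γ i))
    (hdisj : ∀ i j, i ≠ j → ∀ s t, γ i s ≠ γ j t) (i : ι) (t₀ : ℝ) {S : Set ℝ} (hS : S ∈ 𝓝 t₀) :
    ∀ᶠ y in 𝓝 (γ i t₀), ∀ j t, γ j t = y → j = i ∧ ∃ n : ℤ, t + n ∈ S := by
  rw [eventually_all]
  intro j
  rcases eq_or_ne j i with rfl | hji
  · obtain ⟨r, hr, hrS⟩ := Metric.mem_nhds_iff.1 hS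
    have hc : IsClosed (γ j '' (Icc (t₀ - 1 / 2) (t₀ + 1 / 2) \ Metric.ball t₀ r)) :=
      ((isCompact_Icc.diff Metric.isOpen_ball).image (γ j).continuous).isClosed
    by_cases hx' : γ j t₀ ∈ γ j '' (Icc (t₀ - 1 / 2) (t₀ + 1 / 2) \ Metric.ball t₀ r)
    · obtain ⟨s, ⟨hs, hsr⟩, he⟩ := hx'
      obtain ⟨k, hk⟩ := (hγ j).injective _ _ he
      exfalso
      have h1 : (-1 : ℝ) < k := by linarith [hs.1]
      have h2 : (k : ℝ) < 1 := by linarith [hs.2]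
      have h3 : k = 0 := by
        have h1' : (-1 : ℤ) < k := by exact_mod_cast h1
        have h2' : k < (1 : ℤ) := by exact_mod_cast h2
        omega
      apply hsr
      rw [hk, h3]; simpa using hr
    · filter_upwards [hc.isOpen_compl.mem_nhds hx'] with y hy t ht
      refine ⟨rfl, -round (t - t₀), ?_⟩
      by_contra hn
      have hb := abs_le.1 (abs_sub_round (t - t₀))
      refine hy ⟨t + ((-round (t - t₀) : ℤ) : ℝ), ⟨⟨?_, ?_⟩, fun h ↦ hn (hrS h)⟩, ?_⟩
      · push_cast; linarith [hb.1]
      · push_cast; linarith [hb.2]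
      · rw [(hγ j).add_int, ht]
  · have hc : IsClosed (γ j '' Icc 0 1) := (isCompact_Icc.image (γ j).continuous).isClosed
    have hx' : γ i t₀ ∉ γ j '' Icc 0 1 := by
      rintro ⟨t, -, ht⟩; exact hdisj j i hji t t₀ ht
    filter_upwards [hc.isOpen_compl.mem_nhds hx'] with y hy t ht
    exfalso
    refine hy ⟨Int.fract t, ⟨Int.fract_nonneg t, (Int.fract_lt_one t).le⟩, ?_⟩
    rw [← ht, ← (hγ j).add_int (Int.fract t) ⌊t⌋, Int.fract_add_floor]

end Curves

end

noncomputable section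

/-! ### Differentials of functions and velocities of curves -/

section Differential

variable {m : ℕ} {M : Type*} [TopologicalSpace M] [ChartedSpace (EuclideanSpace ℝ (Fin m)) M]
  {W : Type*} [NormedAddCommGroup W] [NormedSpace ℝ W] {f f' : M → W} {x y : M}

variable (m) in
/-- The differential of a vector-valued function on a manifold. -/
def mdiff (f : M → W) (y : M) : TangentSpace (𝓡 m) y →L[ℝ] W :=
  mfderiv (𝓡 m) 𝓘(ℝ, W) f y

variable (m) in
/-- The velocity of a curve. -/
def velocity (c : ℝ → M) (t : ℝ) : TangentSpace (𝓡 m) (c t) :=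
  mfderiv 𝓘(ℝ) (𝓡 m) c t (1 : ℝ)

lemma mdiff_congr (h : f =ᶠ[𝓝 y] f') : mdiff m f y = mdiff m f' y := h.mfderiv_eq

variable [IsManifold (𝓡 m) ∞ M]

lemma ContMDiffAt.contDiffAt_comp_symm (hy : y ∈ (chartAt (EuclideanSpace ℝ (Fin m)) x).source)
    (hf : ContMDiffAt (𝓡 m) 𝓘(ℝ, W) ∞ f y) :
    ContDiffAt ℝ ∞ (fun z ↦ f ((chartAt (EuclideanSpace ℝ (Fin m)) x).symm z))
      (chartAt (EuclideanSpace ℝ (Fin m)) x y) := by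
  have h := contMDiffAt_chartAt_symm ((chartAt (EuclideanSpace ℝ (Fin m)) x).map_source hy)
  refine ContMDiffAt.contDiffAt (ContMDiffAt.comp _ ?_ h)
  rwa [(chartAt (EuclideanSpace ℝ (Fin m)) x).left_inv hy]

lemma mdiff_apply_eq (hy : y ∈ (chartAt (EuclideanSpace ℝ (Fin m)) x).source)
    (hf : ContMDiffAt (𝓡 m) 𝓘(ℝ, W) ∞ f y) (v : TangentSpace (𝓡 m) y) :
    mdiff m f y v = fderiv ℝ (fun z ↦ f ((chartAt (EuclideanSpace ℝ (Fin m)) x).symm z))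
      (chartAt (EuclideanSpace ℝ (Fin m)) x y) (chartDeriv m x y v) := by
  have h1 := ((hf.contDiffAt_comp_symm hy).differentiableAt (by simp)).hasFDerivAt.hasMFDerivAt
  have h2 := HasMFDerivAt.comp y h1 (hasMFDerivAt_chartAt hy)
  have h3 : f =ᶠ[𝓝 y] (fun z ↦ f ((chartAt (EuclideanSpace ℝ (Fin m)) x).symm z)) ∘
      (chartAt (EuclideanSpace ℝ (Fin m)) x) := by
    filter_upwards [(chartAt (EuclideanSpace ℝ (Fin m)) x).open_source.mem_nhds hy] with z hz
    simp [(chartAt (EuclideanSpace ℝ (Fin m)) x).left_inv hz]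
  rw [mdiff_congr h3]
  unfold mdiff
  rw [h2.mfderiv]
  rfl

lemma chartDeriv_velocity {c : ℝ → M} {t : ℝ}
    (ht : c t ∈ (chartAt (EuclideanSpace ℝ (Fin m)) x).source)
    (hc : MDifferentiableAt 𝓘(ℝ) (𝓡 m) c t) :
    chartDeriv m x (c t) (velocity m c t) =
      deriv (fun s ↦ chartAt (EuclideanSpace ℝ (Fin m)) x (c s)) t := by
  have h := HasMFDerivAt.comp t (hasMFDerivAt_chartAt ht) hc.hasMFDerivAt
  have h' : HasFDerivAt (fun s ↦ chartAt (EuclideanSpace ℝ (Fin m)) x (c s))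
      (ContinuousLinearMap.comp (M₂ := EuclideanSpace ℝ (Fin m)) (chartDeriv m x (c t))
        (mfderiv 𝓘(ℝ) (𝓡 m) c t) : ℝ →L[ℝ] EuclideanSpace ℝ (Fin m)) t := h.hasFDerivAt
  exact h'.hasDerivAt.deriv.symm

/-- The product rule for a combination whose coefficients add up to one. -/
lemma mdiff_sum_mul {β : Type*} {T : Finset β} {χ θ : β → M → ℝ} {a : ℝ}
    (hχ : ∀ b ∈ T, ContMDiffAt (𝓡 m) 𝓘(ℝ) ∞ (χ b) y)
    (hθ : ∀ b ∈ T, ContMDiffAt (𝓡 m) 𝓘(ℝ) ∞ (θ b) y)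
    (hsum : ∀ᶠ z in 𝓝 y, ∑ b ∈ T, χ b z = 1) (ha : ∀ b ∈ T, θ b y = a)
    (v : TangentSpace (𝓡 m) y) :
    mdiff m (fun z ↦ ∑ b ∈ T, χ b z * θ b z) y v = ∑ b ∈ T, χ b y * mdiff m (θ b) y v := by
  set φ := chartAt (EuclideanSpace ℝ (Fin m)) y
  have hy : y ∈ φ.source := mem_chart_source _ y
  have hsm : ContMDiffAt (𝓡 m) 𝓘(ℝ) ∞ (fun z ↦ ∑ b ∈ T, χ b z * θ b z) y :=
    contMDiffAt_finsetSum fun b hb ↦ (hχ b hb).mul (hθ b hb)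
  rw [mdiff_apply_eq hy hsm]
  have e1 : ∀ b ∈ T, mdiff m (θ b) y v =
      fderiv ℝ (fun z ↦ θ b (φ.symm z)) (φ y) (chartDeriv m y y v) :=
    fun b hb ↦ mdiff_apply_eq hy (hθ b hb) v
  have d (f : M → ℝ) (hf : ContMDiffAt (𝓡 m) 𝓘(ℝ) ∞ f y) :
      HasFDerivAt (fun z ↦ f (φ.symm z)) (fderiv ℝ (fun z ↦ f (φ.symm z)) (φ y)) (φ y) :=
    ((hf.contDiffAt_comp_symm hy).differentiableAt (by simp)).hasFDerivAt
  have D := HasFDerivAt.fun_sum fun b hb ↦ (d _ (hχ b hb)).mul (d _ (hθ b hb))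
  have D1 := HasFDerivAt.fun_sum fun b hb ↦ (d _ (hχ b hb))
  have D2 : HasFDerivAt (fun z ↦ ∑ b ∈ T, χ b (φ.symm z))
      (0 : EuclideanSpace ℝ (Fin m) →L[ℝ] ℝ) (φ y) := by
    refine (hasFDerivAt_const (1 : ℝ) (φ y)).congr_of_eventuallyEq ?_
    have hc := φ.continuousAt_symm (φ.map_source hy)
    rw [ContinuousAt, φ.left_inv hy] at hc
    exact hc.eventually hsum
  have D3 := congrArg (fun L ↦ L (chartDeriv m y y v)) (D1.unique D2)
  rw [show fderiv ℝ (fun z ↦ ∑ b ∈ T, χ b (φ.symm z) * θ b (φ.symm z)) (φ y) = _ from D.fderiv]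
  simp only [sum_apply, add_apply, smul_apply, smul_eq_mul, zero_apply, φ.left_inv hy] at D3 ⊢
  rw [Finset.sum_add_distrib]
  -- All `θ b` have the value `a` at `y`, so the terms where the weights are differentiated add up
  -- to `a` times the differential of the constant `1`.
  have : ∑ b ∈ T, θ b y * fderiv ℝ (fun z ↦ χ b (φ.symm z)) (φ y) (chartDeriv m y y v) = 0 := by
    rw [Finset.sum_congr rfl fun b hb ↦ by rw [ha b hb], ← Finset.mul_sum, D3, mul_zero]
  rw [this, add_zero]
  exact Finset.sum_congr rfl fun b hb ↦ by rw [e1 b hb]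

lemma mdiff_eq_of_eq_add_const {a : W} (hf : ContMDiffAt (𝓡 m) 𝓘(ℝ, W) ∞ f y)
    (h : ∀ᶠ z in 𝓝 y, f' z = f z + a) : mdiff m f' y = mdiff m f y := by
  have hy : y ∈ (chartAt (EuclideanSpace ℝ (Fin m)) y).source := mem_chart_source _ y
  rw [mdiff_congr h]
  ext v
  have hfa : ContMDiffAt (𝓡 m) 𝓘(ℝ, W) ∞ (fun z ↦ f z + a) y := hf.add contMDiffAt_const
  rw [mdiff_apply_eq hy hf, mdiff_apply_eq hy hfa, fderiv_add_const]

end Differential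

/-! ### Forms adapted to curves -/

section Adapted

variable {m : ℕ} {M : Type*} [TopologicalSpace M] [ChartedSpace (EuclideanSpace ℝ (Fin m)) M]
  [IsManifold (𝓡 m) ∞ M]

/-- Along `c`, the differential of `θ` is the form dual to the velocity of `c`. -/
def IsDualForm (g : SmoothMetric m M) (c : ℝ → M) (θ : M → ℝ) (t : ℝ) : Prop :=
  ∀ v : TangentSpace (𝓡 m) (c t),
    mdiff m θ (c t) v * g.inner (c t) (velocity m c t) (velocity m c t) =
      g.inner (c t) (velocity m c t) v

omit [IsManifold (𝓡 m) ∞ M] in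
lemma velocity_comp_add {c : ℝ → M} {t a : ℝ} (hc : MDifferentiableAt 𝓘(ℝ) (𝓡 m) c (t + a)) :
    velocity m (fun s ↦ c (s + a)) t = velocity m c (t + a) := by
  have h1 : HasMFDerivAt 𝓘(ℝ) 𝓘(ℝ) (fun s : ℝ ↦ s + a) t (ContinuousLinearMap.id ℝ ℝ) :=
    ((hasFDerivAt_id t).add_const a).hasMFDerivAt
  have h := HasMFDerivAt.comp (f := fun s : ℝ ↦ s + a) t hc.hasMFDerivAt h1
  exact congrArg (fun L ↦ L (1 : ℝ)) h.mfderiv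

lemma IsDualForm.of_add_int {g : SmoothMetric m M} {c : C(ℝ, M)} (hc : IsSmoothLoop m c)
    {θ : M → ℝ} {t : ℝ} {n : ℤ} (h : IsDualForm g c θ (t + n)) : IsDualForm g c θ t := by
  have h' : IsDualForm g (fun s ↦ c (s + n)) θ t := by
    intro v
    have h2 := velocity_comp_add (m := m) (hc.smooth.mdifferentiableAt (by simp) (x := t + n))
    rw [h2]
    exact h v
  rwa [show (fun s ↦ c (s + n)) = c from funext fun s ↦ hc.add_int s n] at h'

variable {V : Type*} [NormedAddCommGroup V] [NormedSpace ℝ V] {ι : Type*}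

/-- The function `F` is adapted at `x`: subtracted from a primitive of `Ψ` it leaves a smooth
function, and at a point of the curve `γ i` this function is `θ • w`, where `w` is the period along
`γ i` and `θ` is a time function whose differential is dual to the velocity. -/
structure IsAdaptedAt (g : SmoothMetric m M) (Ψ : C(unitInterval, M) → V) (γ : ι → C(ℝ, M))
    (F : M → V) (x : M) : Prop where
  smooth : ∀ k, IsPrimitiveAt Ψ k x →
    ∀ᶠ y in 𝓝 x, ContMDiffAt (𝓡 m) 𝓘(ℝ, V) ∞ (fun z ↦ k z - F z) y
  curve : ∀ i t₀, γ i t₀ = x → ∃ θ : M → ℝ, (∀ᶠ y in 𝓝 x, ContMDiffAt (𝓡 m) 𝓘(ℝ) ∞ θ y) ∧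
    (∀ k, IsPrimitiveAt Ψ k x → k x = Ψ (arc (γ i) 0 t₀) →
      ∀ᶠ y in 𝓝 x, k y - F y = θ y • Ψ (arc (γ i) 0 1)) ∧
    ∀ᶠ t in 𝓝 t₀, θ (γ i t) = t ∧ IsDualForm g (γ i) θ t

variable {g : SmoothMetric m M} {Ψ : C(unitInterval, M) → V} {γ : ι → C(ℝ, M)} {F : M → V}

lemma velocity_ne_zero {c : C(ℝ, M)} (hc : IsEmbeddedLoop m c) (t : ℝ) : velocity m c t ≠ 0 := by
  intro h
  obtain ⟨x, hx, hd⟩ := hc.immersed t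
  apply hd
  rw [← chartDeriv_velocity hx (hc.smooth.mdifferentiableAt (by simp)), h, map_zero]

/-- Near each of its points, an embedded curve has a time function whose differential is dual to
the velocity. -/
lemma exists_time_function_curve (g : SmoothMetric m M) {c : C(ℝ, M)} (hc : IsEmbeddedLoop m c)
    (t₀ : ℝ) : ∃ θ : M → ℝ, (∀ᶠ y in 𝓝 (c t₀), ContMDiffAt (𝓡 m) 𝓘(ℝ) ∞ θ y) ∧
      ∀ᶠ t in 𝓝 t₀, θ (c t) = t ∧ IsDualForm g c θ t := by
  set φ := chartAt (EuclideanSpace ℝ (Fin m)) (c t₀) with hφ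
  have hx : c t₀ ∈ φ.source := mem_chart_source _ _
  obtain ⟨G, hG⟩ := g.exists_chart_form (c t₀)
  have hsrc : ∀ᶠ t in 𝓝 t₀, c t ∈ φ.source :=
    c.continuous.continuousAt.eventually (φ.open_source.mem_nhds hx)
  let q : ℝ → EuclideanSpace ℝ (Fin m) := fun t ↦ φ (c t)
  have hvel (t : ℝ) (ht : c t ∈ φ.source) :
      chartDeriv m (c t₀) (c t) (velocity m c t) = deriv q t :=
    chartDeriv_velocity ht (hc.smooth.mdifferentiableAt (by simp))
  have hGq (t : ℝ) (ht : c t ∈ φ.source) (v : TangentSpace (𝓡 m) (c t)) :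
      g.inner (c t) (velocity m c t) v = G (c t) (deriv q t) (chartDeriv m (c t₀) (c t) v) := by
    rw [(hG _ ht).2, hvel t ht]
  have hpos (t : ℝ) (ht : c t ∈ φ.source) : 0 < G (c t) (deriv q t) (deriv q t) := by
    rw [← hvel t ht, ← (hG _ ht).2]
    exact g.pos _ _ (velocity_ne_zero hc t)
  have hq (t : ℝ) (ht : c t ∈ φ.source) : ContDiffAt ℝ ∞ q t :=
    contDiffAt_chartAt_comp hc.smooth ht
  have hGc (t : ℝ) (ht : c t ∈ φ.source) : ContDiffAt ℝ ∞ (fun t ↦ G (c t)) t :=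
    ((hG _ ht).1.comp t (hc.smooth t)).contDiffAt
  -- The metric dual of the velocity divided by the squared speed, hence equal to one on the
  -- velocity.
  let L : ℝ → EuclideanSpace ℝ (Fin m) →L[ℝ] ℝ := fun t ↦
    (G (c t) (deriv q t) (deriv q t))⁻¹ • G (c t) (deriv q t)
  obtain ⟨h, hs, hh⟩ := exists_time_function (c := q) (L := L) (t₀ := t₀)
    (hsrc.mono hq) (hsrc.mono fun t ht ↦ by
      have h1 := (hGc t ht).clm_apply (hq t ht).deriv_right_real
      have h2 := h1.clm_apply (hq t ht).deriv_right_real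
      exact (h2.inv (hpos t ht).ne').smul h1)
    (hsrc.mono fun t ht ↦ by simp [L, (hpos t ht).ne'])
  have hsm : ∀ᶠ y in 𝓝 (c t₀), ContMDiffAt (𝓡 m) 𝓘(ℝ) ∞ (fun y ↦ h (φ y)) y := by
    filter_upwards [φ.open_source.mem_nhds hx, (φ.continuousAt hx).eventually hs] with y hy hyz
    exact hyz.contMDiffAt.comp y (contMDiffAt_chartAt hy)
  refine ⟨fun y ↦ h (φ y), hsm, ?_⟩
  filter_upwards [hsrc, hh, c.continuous.continuousAt.eventually hsm] with t ht htt hst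
  refine ⟨htt.1, fun v ↦ ?_⟩
  have e : (fun z ↦ h (φ (φ.symm z))) =ᶠ[𝓝 (φ (c t))] h := by
    filter_upwards [φ.open_target.mem_nhds (φ.map_source ht)] with z hz
    rw [φ.right_inv hz]
  rw [mdiff_apply_eq (x := c t₀) ht hst, hGq t ht, hGq t ht, hvel t ht]
  rw [show fderiv ℝ (fun z ↦ h (φ (φ.symm z))) (φ (c t)) = L t from e.fderiv_eq.trans htt.2]
  simp only [L, smul_apply, smul_eq_mul]
  field_simp [(hpos t ht).ne']

end Adapted

end

noncomputable section

/-! ### Periods of a path cocycle along a closed curve -/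

section Periods

variable {M : Type*} [TopologicalSpace M] {A : Type*} [AddCommGroup A]
  {Ψ : C(unitInterval, M) → A}

lemma arc_add_of_periodic {c : C(ℝ, M)} (hc : Function.Periodic c 1) (a b : ℝ) (n : ℤ) :
    arc c (a + n) (b + n) = arc c a b := by
  ext t
  rw [arc_apply, arc_apply, show (1 - (t : ℝ)) * (a + n) + t * (b + n) =
    (1 - (t : ℝ)) * a + t * b + n by ring]
  simpa using hc.int_mul n ((1 - (t : ℝ)) * a + t * b)

lemma IsPathCocycle.arc_add_int (hΨ : IsPathCocycle Ψ) {c : C(ℝ, M)}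
    (hc : Function.Periodic c 1) (t : ℝ) (n : ℤ) :
    Ψ (arc c 0 (t + n)) = Ψ (arc c 0 t) + n • Ψ (arc c 0 1) := by
  have key (k : ℤ) : Ψ (arc c 0 ((k + 1 : ℤ) : ℝ)) = Ψ (arc c 0 k) + Ψ (arc c 0 1) := by
    rw [← hΨ.arc_add c 0 k, ← arc_add_of_periodic hc 0 1 k]
    push_cast
    rw [zero_add, add_comm (1 : ℝ)]
  have h : Ψ (arc c 0 n) = n • Ψ (arc c 0 1) := by
    induction n with
    | zero => simp [hΨ.arc_self]
    | succ k ih =>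
      have := key k
      rw [add_zsmul, one_zsmul, ← ih]; exact this
    | pred k ih =>
      have := key (-k - 1)
      rw [sub_add_cancel, ih] at this
      rw [sub_zsmul, one_zsmul, this, ← sub_eq_add_neg,
        add_sub_cancel_right]
  rw [← hΨ.arc_add c 0 n, h, add_comm]
  congr 1
  have := arc_add_of_periodic hc 0 t n
  rw [zero_add] at this
  rw [this]

end Periods

/-! ### Local construction of adapted functions -/

section Local

variable {m : ℕ} {M : Type*} [TopologicalSpace M] [ChartedSpace (EuclideanSpace ℝ (Fin m)) M]
  [IsManifold (𝓡 m) ∞ M] {V : Type*} [NormedAddCommGroup V] [NormedSpace ℝ V] {ι : Type*}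
  {Ψ : C(unitInterval, M) → V} {γ : ι → C(ℝ, M)} {F : M → V}

omit [IsManifold (𝓡 m) ∞ M] in
-- Primitives differ by constants, so smoothness of the difference with `F = k - s` need only be
-- known for one of them.
lemma IsPrimitiveAt.eventually_contMDiffAt_sub {k k' s : M → V} {y : M}
    (hk : IsPrimitiveAt Ψ k y) (hk' : IsPrimitiveAt Ψ k' y)
    (hs : ∀ᶠ z in 𝓝 y, ContMDiffAt (𝓡 m) 𝓘(ℝ, V) ∞ s z) :
    ∀ᶠ z in 𝓝 y, ContMDiffAt (𝓡 m) 𝓘(ℝ, V) ∞ (fun z ↦ k' z - (k z - s z)) z := by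
  filter_upwards [eventually_eventually_nhds.2 (hk.sub_eq_sub m hk'), hs] with z hz hsz
  have h1 : ContMDiffAt (𝓡 m) 𝓘(ℝ, V) ∞ (fun z ↦ (k' y - k y) + s z) z :=
    contMDiffAt_const.add hsz
  refine h1.congr_of_eventuallyEq ?_
  filter_upwards [hz] with u hu
  rw [sub_eq_sub_iff_add_eq_add] at hu
  rw [← sub_eq_zero]
  have : k' u - (k u - s u) - (k' y - k y + s u) = (k' u + k y) - (k u + k' y) := by abel
  rw [this, hu, sub_self]

variable [T2Space M] [Finite ι]

/-- Away from the curves `F` is itself a primitive, and the form vanishes. Near `γ i` one subtracts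
from a primitive the time function times the period, so that the form becomes `dθ` times the period.
-/
theorem exists_isAdaptedAt_local (g : SmoothMetric m M) (hΨ : IsPathCocycle Ψ)
    (hγ : ∀ i, IsEmbeddedLoop m (γ i)) (hdisj : ∀ i j, i ≠ j → ∀ s t, γ i s ≠ γ j t) (x : M) :
    ∃ F : M → V, ∀ᶠ y in 𝓝 x, IsAdaptedAt g Ψ γ F y := by
  obtain ⟨k₀, hk₀⟩ := hΨ.exists_isPrimitiveAt m x
  by_cases hx : ∀ i t, γ i t ≠ x
  · refine ⟨k₀, ?_⟩
    filter_upwards [hk₀.eventually, eventually_forall_ne_curve hγ hx] with y hky hy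
    refine ⟨fun k hk ↦ ?_, fun i t h ↦ (hy i t h).elim⟩
    simpa using hky.eventually_contMDiffAt_sub hk
      (Eventually.of_forall fun z ↦ contMDiffAt_const (c := (0 : V)))
  push Not at hx
  obtain ⟨i, t₀, rfl⟩ := hx
  obtain ⟨k, hk, hkx⟩ : ∃ k, IsPrimitiveAt Ψ k (γ i t₀) ∧ k (γ i t₀) = Ψ (arc (γ i) 0 t₀) :=
    ⟨_, hk₀.sub_const (k₀ (γ i t₀) - Ψ (arc (γ i) 0 t₀)), by abel⟩
  obtain ⟨θ, hθ, hθγ⟩ := exists_time_function_curve g (hγ i) t₀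
  have hkγ : ∀ᶠ t in 𝓝 t₀, k (γ i t) = Ψ (arc (γ i) 0 t) := by
    filter_upwards [hk.arc_eq] with t ht
    rw [← hΨ.arc_add (γ i) 0 t₀ t, ht, hkx]; abel
  refine ⟨fun y ↦ k y - θ y • Ψ (arc (γ i) 0 1), ?_⟩
  filter_upwards [hk.eventually, eventually_eventually_nhds.2 hθ,
    eventually_curve_eq hγ hdisj i t₀ (hkγ.and (eventually_eventually_nhds.2 hθγ))] with y hky hθy hy
  refine ⟨fun k' hk' ↦ ?_, fun j t₁ hj ↦ ?_⟩
  · exact hky.eventually_contMDiffAt_sub hk'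
      (hθy.mono fun z hz ↦ hz.smul contMDiffAt_const)
  · obtain ⟨rfl, n, hn1, hn2⟩ := hy j t₁ hj
    -- The given parameter of the point differs by `n` from one close to `t₀`; the time function
    -- shifts by `n` and the normalized primitive by `n` periods, and the two shifts cancel.
    refine ⟨fun z ↦ θ z - n, hθy.mono fun z hz ↦ hz.sub contMDiffAt_const, fun k' hk' hk'y ↦ ?_, ?_⟩
    · filter_upwards [hky.sub_eq_sub m hk'] with z hz
      have e1 : k y = k' y + (n : ℝ) • Ψ (arc (γ j) 0 1) := by
        have := hΨ.arc_add_int (hγ j).periodic t₁ n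
        rw [← hn1, (hγ j).add_int, hj] at this
        rw [this, hk'y, Int.cast_smul_eq_zsmul]
      have e2 : k' z = k z - k y + k' y := by rw [hz]; abel
      rw [e2, e1, sub_smul]; abel
    · have hsh : Tendsto (fun t : ℝ ↦ t + n) (𝓝 t₁) (𝓝 (t₁ + n)) :=
        (continuous_add_const (n : ℝ)).tendsto t₁
      have hcont : Tendsto (γ j) (𝓝 t₁) (𝓝 y) := by
        rw [← hj]; exact (γ j).continuous.tendsto t₁
      filter_upwards [hsh.eventually hn2, hcont.eventually hθy] with t ht hst
      refine ⟨?_, ?_⟩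
      · have := ht.1
        rw [(hγ j).add_int] at this
        rw [this]; ring
      · have h1 := ht.2.of_add_int (hγ j).toIsSmoothLoop
        intro v
        rw [mdiff_eq_of_eq_add_const (a := -(n : ℝ)) hst (Eventually.of_forall fun z ↦ by ring)]
        exact h1 v

end Local

/-! ### Gluing adapted functions by a partition of unity -/

section Gluing

variable {m : ℕ} {M : Type*} [TopologicalSpace M] [ChartedSpace (EuclideanSpace ℝ (Fin m)) M]
  [IsManifold (𝓡 m) ∞ M] {V : Type*} [NormedAddCommGroup V] [NormedSpace ℝ V] {ι : Type*}
  {Ψ : C(unitInterval, M) → V} {γ : ι → C(ℝ, M)} {F : M → V}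

/-- Adapted functions can be glued. -/
lemma IsAdaptedAt.sum {g : SmoothMetric m M} {β : Type*} {T : Finset β} {χ : β → M → ℝ}
    {F : β → M → V} {x : M} (hF : ∀ b ∈ T, IsAdaptedAt g Ψ γ (F b) x)
    (hχ : ∀ b ∈ T, ContMDiff (𝓡 m) 𝓘(ℝ) ∞ (χ b)) (hsum : ∀ᶠ z in 𝓝 x, ∑ b ∈ T, χ b z = 1) :
    IsAdaptedAt g Ψ γ (fun z ↦ ∑ b ∈ T, χ b z • F b z) x := by
  have key (k : M → V) (z : M) (hz : ∑ b ∈ T, χ b z = 1) :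
      k z - ∑ b ∈ T, χ b z • F b z = ∑ b ∈ T, χ b z • (k z - F b z) := by
    simp only [smul_sub, Finset.sum_sub_distrib, ← Finset.sum_smul, hz, one_smul]
  refine ⟨fun k hk ↦ ?_, fun i t₀ hi ↦ ?_⟩
  · have h1 : ∀ᶠ y in 𝓝 x, ∀ b ∈ T,
        ContMDiffAt (𝓡 m) 𝓘(ℝ, V) ∞ (fun z ↦ k z - F b z) y :=
      (eventually_all_finset T).2 fun b hb ↦ (hF b hb).smooth k hk
    filter_upwards [h1, eventually_eventually_nhds.2 hsum] with y hy hs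
    have h2 : ContMDiffAt (𝓡 m) 𝓘(ℝ, V) ∞ (fun z ↦ ∑ b ∈ T, χ b z • (k z - F b z)) y :=
      contMDiffAt_finsetSum fun b hb ↦ (hχ b hb y).smul (hy b hb)
    exact h2.congr_of_eventuallyEq (hs.mono fun z hz ↦ key k z hz)
  · choose! θ h1 h2 h3 using fun b hb ↦ (hF b hb).curve i t₀ hi
    have h1' : ∀ᶠ y in 𝓝 x, ∀ b ∈ T, ContMDiffAt (𝓡 m) 𝓘(ℝ) ∞ (θ b) y :=
      (eventually_all_finset T).2 h1
    refine ⟨fun z ↦ ∑ b ∈ T, χ b z * θ b z, ?_, fun k hk hkx ↦ ?_, ?_⟩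
    · filter_upwards [h1'] with y hy
      exact contMDiffAt_finsetSum fun b hb ↦ (hχ b hb y).mul (hy b hb)
    · filter_upwards [hsum, (eventually_all_finset T).2 fun b hb ↦ h2 b hb k hk hkx] with y hy hyb
      rw [key k y hy, Finset.sum_smul]
      exact Finset.sum_congr rfl fun b hb ↦ by rw [hyb b hb, smul_smul]
    · have hcont : Tendsto (γ i) (𝓝 t₀) (𝓝 x) := by
        rw [← hi]; exact (γ i).continuous.tendsto t₀
      filter_upwards [(eventually_all_finset T).2 h3, hcont.eventually h1',
        hcont.eventually (eventually_eventually_nhds.2 hsum)] with t ht hs ho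
      have ho' := ho.self_of_nhds
      refine ⟨?_, fun v ↦ ?_⟩
      · rw [Finset.sum_congr rfl fun b hb ↦ by rw [(ht b hb).1], ← Finset.sum_mul, ho', one_mul]
      · rw [mdiff_sum_mul (fun b hb ↦ hχ b hb _) hs ho fun b hb ↦ (ht b hb).1, Finset.sum_mul,
          Finset.sum_congr rfl fun b hb ↦ by rw [mul_assoc, (ht b hb).2 v], ← Finset.sum_mul, ho',
          one_mul]

lemma IsAdaptedAt.congr {g : SmoothMetric m M} {F' : M → V} {x : M} (h : IsAdaptedAt g Ψ γ F x)
    (he : F' =ᶠ[𝓝 x] F) : IsAdaptedAt g Ψ γ F' x := by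
  refine ⟨fun k hk ↦ ?_, fun i t₀ hi ↦ ?_⟩
  · filter_upwards [h.smooth k hk, eventually_eventually_nhds.2 he] with y hy hey
    exact hy.congr_of_eventuallyEq (hey.mono fun z hz ↦ by simp only [hz])
  · obtain ⟨θ, h1, h2, h3⟩ := h.curve i t₀ hi
    refine ⟨θ, h1, fun k hk hkx ↦ ?_, h3⟩
    filter_upwards [h2 k hk hkx, he] with y hy hey
    rw [hey, hy]

/-- Being adapted survives smooth combinations with weights of sum one. At a given point only the
indices whose weight has this point in its support may be used, since the other local functions need
not be adapted there. -/
theorem exists_isAdaptedAt [T2Space M] [CompactSpace M] [Finite ι] (g : SmoothMetric m M)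
    (hΨ : IsPathCocycle Ψ) (hγ : ∀ i, IsEmbeddedLoop m (γ i))
    (hdisj : ∀ i j, i ≠ j → ∀ s t, γ i s ≠ γ j t) :
    ∃ F : M → V, ∀ x, IsAdaptedAt g Ψ γ F x := by
  classical
  choose F hF using exists_isAdaptedAt_local g hΨ hγ hdisj
  choose U hU hUo hxU using fun x ↦ eventually_nhds_iff.1 (hF x)
  obtain ⟨T, hT⟩ := isCompact_univ.elim_finite_subcover U hUo fun x _ ↦ mem_iUnion.2 ⟨x, hxU x⟩
  obtain ⟨χ, hχ⟩ := SmoothPartitionOfUnity.exists_isSubordinate (ι := T) (𝓡 m) isClosed_univ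
    (fun b ↦ U b) (fun b ↦ hUo b) fun x hx ↦ by
      obtain ⟨b, hb, hxb⟩ := mem_iUnion₂.1 (hT hx)
      exact mem_iUnion.2 ⟨⟨b, hb⟩, hxb⟩
  refine ⟨fun z ↦ ∑ b : T, χ b z • F b z, fun x ↦ ?_⟩
  let S : Finset T := Finset.univ.filter fun b ↦ x ∈ tsupport (χ b)
  have hzero : ∀ᶠ z in 𝓝 x, ∀ b : T, b ∉ S → χ b z = 0 := by
    rw [eventually_all]
    intro b
    by_cases hb : b ∈ S
    · exact Eventually.of_forall fun z h ↦ (h hb).elim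
    · have : x ∉ tsupport (χ b) := by simpa [S] using hb
      filter_upwards [(isClosed_tsupport _).isOpen_compl.mem_nhds this] with z hz _
      exact image_eq_zero_of_notMem_tsupport hz
  refine IsAdaptedAt.congr (F := fun z ↦ ∑ b ∈ S, χ b z • F b z)
    (IsAdaptedAt.sum (fun b hb ↦ ?_) (fun b _ ↦ (χ b).contMDiff) ?_) ?_
  · exact hU b x (hχ b (by simpa [S] using hb))
  · filter_upwards [hzero] with z hz
    rw [← χ.sum_eq_one (mem_univ z), finsum_eq_sum_of_fintype]
    exact Finset.sum_subset (Finset.subset_univ S) fun b _ hb ↦ hz b hb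
  · filter_upwards [hzero] with z hz
    exact (Finset.sum_subset (Finset.subset_univ S) fun b _ hb ↦ by rw [hz b hb, zero_smul]).symm

end Gluing

end

noncomputable section

/-! ### Positive definite forms -/

section Forms

variable {E : Type*} [NormedAddCommGroup E] [NormedSpace ℝ E] {B : E →L[ℝ] E →L[ℝ] ℝ}

lemma sq_le_mul_of_posDef (hsymm : ∀ v w, B v w = B w v) (hpos : ∀ v, v ≠ 0 → 0 < B v v)
    (v w : E) : B v w ^ 2 ≤ B v v * B w w := by
  rcases eq_or_ne w 0 with rfl | hw
  · simp
  have hw' := hpos w hw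
  have h0 : 0 ≤ B (v - (B v w / B w w) • w) (v - (B v w / B w w) • w) := by
    rcases eq_or_ne (v - (B v w / B w w) • w) 0 with h | h
    · rw [h]; simp
    · exact (hpos _ h).le
  have h1 : B (v - (B v w / B w w) • w) (v - (B v w / B w w) • w) =
      B v v - B v w ^ 2 / B w w := by
    simp only [map_sub, map_smul, sub_apply, smul_apply, smul_eq_mul, hsymm w v]
    field_simp
    ring
  rw [h1, sub_nonneg, div_le_iff₀ hw'] at h0
  exact h0

variable [FiniteDimensional ℝ E]

lemma exists_pos_mul_sq_le_of_posDef (hpos : ∀ v, v ≠ 0 → 0 < B v v) :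
    ∃ c > 0, ∀ v, c * ‖v‖ ^ 2 ≤ B v v := by
  rcases (Metric.sphere (0 : E) 1).eq_empty_or_nonempty with h | h
  · refine ⟨1, one_pos, fun v ↦ ?_⟩
    rcases eq_or_ne v 0 with rfl | hv
    · simp
    · have : ‖v‖⁻¹ • v ∈ Metric.sphere (0 : E) 1 := by
        simp [norm_smul, norm_ne_zero_iff.2 hv]
      rw [h] at this
      exact this.elim
  · have hcont : Continuous fun v ↦ B v v := B.continuous.clm_apply continuous_id
    obtain ⟨u, hu, hmin⟩ := (isCompact_sphere (0 : E) 1).exists_isMinOn h hcont.continuousOn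
    have hu0 : u ≠ 0 := by
      rintro rfl
      simp at hu
    refine ⟨B u u, hpos u hu0, fun v ↦ ?_⟩
    rcases eq_or_ne v 0 with rfl | hv
    · simp
    · have hv' : ‖v‖ ≠ 0 := norm_ne_zero_iff.2 hv
      have h1 : ‖v‖⁻¹ • v ∈ Metric.sphere (0 : E) 1 := by simp [norm_smul, hv']
      have h2 : B u u ≤ B (‖v‖⁻¹ • v) (‖v‖⁻¹ • v) := hmin h1
      simp only [map_smul, smul_apply, smul_eq_mul] at h2
      calc B u u * ‖v‖ ^ 2 ≤ (‖v‖⁻¹ * (‖v‖⁻¹ * B v v)) * ‖v‖ ^ 2 := by gcongr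
        _ = B v v := by field_simp

lemma isInvertible_of_posDef (hpos : ∀ v, v ≠ 0 → 0 < B v v) : B.IsInvertible := by
  have hinj : Function.Injective (B : E →ₗ[ℝ] E →L[ℝ] ℝ) := by
    refine (injective_iff_map_eq_zero _).2 fun v hv ↦ ?_
    by_contra h
    have h1 := hpos v h
    have h2 : B v = 0 := hv
    simp [h2] at h1
  have hdim : Module.finrank ℝ E = Module.finrank ℝ (E →L[ℝ] ℝ) := by
    rw [← (LinearMap.toContinuousLinearMap (𝕜 := ℝ) (E := E) (F' := ℝ)).finrank_eq]
    exact (Subspace.dual_finrank_eq (K := ℝ) (V := E)).symm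
  refine ⟨(LinearMap.linearEquivOfInjective _ hinj hdim).toContinuousLinearEquiv, ?_⟩
  ext v w
  rfl

end Forms

/-! ### Bounds for differentials in terms of the metric -/

section Factor

variable {m : ℕ} {M : Type*} [TopologicalSpace M] [ChartedSpace (EuclideanSpace ℝ (Fin m)) M]
  [IsManifold (𝓡 m) ∞ M] {V : Type*} [NormedAddCommGroup V] [NormedSpace ℝ V] {ι : Type*}
  {Ψ : C(unitInterval, M) → V} {γ : ι → C(ℝ, M)} {F : M → V}

/-- A positive definite form representing the metric in a chart. -/
theorem SmoothMetric.exists_posDef_form (g : SmoothMetric m M) (x : M) :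
    ∃ G : M → EuclideanSpace ℝ (Fin m) →L[ℝ] EuclideanSpace ℝ (Fin m) →L[ℝ] ℝ,
      ∀ y ∈ (chartAt (EuclideanSpace ℝ (Fin m)) x).source,
        ContMDiffAt (𝓡 m) 𝓘(ℝ, EuclideanSpace ℝ (Fin m) →L[ℝ] EuclideanSpace ℝ (Fin m) →L[ℝ] ℝ) ∞
          G y ∧
        (∀ v w : TangentSpace (𝓡 m) y,
          g.inner y v w = G y (chartDeriv m x y v) (chartDeriv m x y w)) ∧
        (∀ v w, G y v w = G y w v) ∧ ∀ v, v ≠ 0 → 0 < G y v v := by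
  obtain ⟨G, hG⟩ := g.exists_chart_form x
  refine ⟨G, fun y hy ↦ ⟨(hG y hy).1, (hG y hy).2, fun v w ↦ ?_, fun v hv ↦ ?_⟩⟩
  · obtain ⟨v, rfl⟩ := chartDeriv_surjective hy v
    obtain ⟨w, rfl⟩ := chartDeriv_surjective hy w
    rw [← (hG y hy).2, ← (hG y hy).2, g.symm]
  · obtain ⟨v, rfl⟩ := chartDeriv_surjective hy v
    rw [← (hG y hy).2]
    refine g.pos y v ?_
    rintro rfl
    simp at hv

lemma SmoothMetric.inner_self_nonneg (g : SmoothMetric m M) (y : M) (v : TangentSpace (𝓡 m) y) :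
    0 ≤ g.inner y v v := by
  by_cases hv : v = 0
  · rw [hv]; simp
  · exact (g.pos y v hv).le

omit [NormedSpace ℝ V] [ChartedSpace (EuclideanSpace ℝ (Fin m)) M] [IsManifold (𝓡 m) ∞ M] in
lemma ContinuousAt.eventually_norm_sub_lt {f : M → V} {x : M} (hf : ContinuousAt f x) {c : ℝ}
    (hc : 0 < c) : ∀ᶠ y in 𝓝 x, ‖f y - f x‖ < c := by
  simpa only [dist_eq_norm] using Metric.continuousAt_iff'.1 hf c hc

set_option synthInstance.maxHeartbeats 200000 in
/-- The differential of a smooth function is locally bounded. -/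
lemma exists_mdiff_bound (g : SmoothMetric m M) {s : M → V} {x : M}
    (hs : ∀ᶠ y in 𝓝 x, ContMDiffAt (𝓡 m) 𝓘(ℝ, V) ∞ s y) :
    ∃ A : ℝ, ∀ᶠ y in 𝓝 x, ∀ v, ‖mdiff m s y v‖ ^ 2 ≤ A * g.inner y v v := by
  set φ := chartAt (EuclideanSpace ℝ (Fin m)) x
  have hx : x ∈ φ.source := mem_chart_source _ x
  obtain ⟨G, hG⟩ := g.exists_posDef_form x
  obtain ⟨c, hc, hcG⟩ := exists_pos_mul_sq_le_of_posDef (hG x hx).2.2.2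
  let D : M → EuclideanSpace ℝ (Fin m) →L[ℝ] V :=
    fun y ↦ fderiv ℝ (fun z ↦ s (φ.symm z)) (φ y)
  have hD : ContinuousAt D x := by
    have h1 := (hs.self_of_nhds.contDiffAt_comp_symm hx).fderiv_right (m := ∞) (by simp)
    exact ContinuousAt.comp (g := fun z ↦ fderiv ℝ (fun z ↦ s (φ.symm z)) z)
      h1.continuousAt (φ.continuousAt hx)
  have hD' : ∀ᶠ y in 𝓝 x, ‖D y‖ < ‖D x‖ + 1 :=
    hD.norm.eventually_lt_const (lt_add_one _)
  have hG' : ∀ᶠ y in 𝓝 x, ‖G y - G x‖ < c / 2 := by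
    exact ContinuousAt.eventually_norm_sub_lt
      (V := EuclideanSpace ℝ (Fin m) →L[ℝ] EuclideanSpace ℝ (Fin m) →L[ℝ] ℝ)
      (hG x hx).1.continuousAt (half_pos hc)
  refine ⟨(‖D x‖ + 1) ^ 2 / (c / 2), ?_⟩
  filter_upwards [hD', hG', φ.open_source.mem_nhds hx, hs] with y h1 h2 hy hsy v
  rw [mdiff_apply_eq (x := x) hy hsy, (hG y hy).2.1]
  set u := chartDeriv m x y v
  have h3 : c / 2 * ‖u‖ ^ 2 ≤ G y u u := by
    have h4 : abs ((G y - G x) u u) ≤ c / 2 * ‖u‖ ^ 2 := by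
      calc abs ((G y - G x) u u) ≤ ‖G y - G x‖ * ‖u‖ * ‖u‖ := (G y - G x).le_opNorm₂ u u
        _ ≤ c / 2 * ‖u‖ * ‖u‖ := by gcongr
        _ = c / 2 * ‖u‖ ^ 2 := by ring
    have h5 := (abs_le.1 h4).1
    simp only [sub_apply] at h5
    linarith [hcG u]
  have h6 : ‖D y u‖ ≤ (‖D x‖ + 1) * ‖u‖ :=
    ((D y).le_opNorm u).trans (by gcongr)
  calc ‖D y u‖ ^ 2 ≤ ((‖D x‖ + 1) * ‖u‖) ^ 2 := by gcongr
    _ = (‖D x‖ + 1) ^ 2 / (c / 2) * (c / 2 * ‖u‖ ^ 2) := by field_simp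
    _ ≤ _ := by gcongr

/-- The squared dual norm of the differential of a smooth function. -/
lemma exists_dual_norm_sq (g : SmoothMetric m M) {θ : M → ℝ} {x : M}
    (hθ : ∀ᶠ y in 𝓝 x, ContMDiffAt (𝓡 m) 𝓘(ℝ) ∞ θ y) :
    ∃ q : M → ℝ, ∀ᶠ y in 𝓝 x, ContMDiffAt (𝓡 m) 𝓘(ℝ) ∞ q y ∧
      (∀ v, mdiff m θ y v ^ 2 ≤ q y * g.inner y v v) ∧
      ∀ u, u ≠ 0 → (∀ v, mdiff m θ y v * g.inner y u u = g.inner y u v) →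
        q y * g.inner y u u = 1 := by
  set φ := chartAt (EuclideanSpace ℝ (Fin m)) x
  have hx : x ∈ φ.source := mem_chart_source _ x
  obtain ⟨G, hG⟩ := g.exists_posDef_form x
  let D : M → EuclideanSpace ℝ (Fin m) →L[ℝ] ℝ :=
    fun y ↦ fderiv ℝ (fun z ↦ θ (φ.symm z)) (φ y)
  -- The dual quadratic form evaluated at the differential. Inversion of operators is smooth, the
  -- Cauchy–Schwarz inequality gives the bound, and a vector dual to the differential gives
  -- equality.
  refine ⟨fun y ↦ D y ((G y).inverse (D y)), ?_⟩
  filter_upwards [φ.open_source.mem_nhds hx, hθ] with y hy hθy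
  obtain ⟨hGs, hGi, hGsymm, hGpos⟩ := hG y hy
  have hinv := isInvertible_of_posDef hGpos
  have hGX : G y ((G y).inverse (D y)) = D y := hinv.self_apply_inverse (D y)
  refine ⟨?_, fun v ↦ ?_, fun u hu h ↦ ?_⟩
  · have h1 : ContMDiffAt (𝓡 m) 𝓘(ℝ, EuclideanSpace ℝ (Fin m) →L[ℝ] ℝ) ∞ D y := by
      have h2 := (hθy.contDiffAt_comp_symm hy).fderiv_right (m := ∞) (by simp)
      exact h2.contMDiffAt.comp y (contMDiffAt_chartAt hy)
    have h3 : ContMDiffAt (𝓡 m) 𝓘(ℝ, (EuclideanSpace ℝ (Fin m) →L[ℝ] ℝ) →L[ℝ]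
        EuclideanSpace ℝ (Fin m)) ∞ (fun y ↦ (G y).inverse) y := by
      obtain ⟨e, he⟩ := hinv
      have h4 := contDiffAt_map_inverse (n := ∞) e
      rw [he] at h4
      exact h4.contMDiffAt.comp y hGs
    exact h1.clm_apply (h3.clm_apply h1)
  · have h1 := sq_le_mul_of_posDef hGsymm hGpos ((G y).inverse (D y)) (chartDeriv m x y v)
    rw [hGX] at h1
    rw [mdiff_apply_eq (x := x) hy hθy, hGi]
    exact h1
  · have hpos := g.pos y u hu
    have h1 : g.inner y u u • D y = G y (chartDeriv m x y u) := by
      ext w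
      obtain ⟨v, rfl⟩ := chartDeriv_surjective hy w
      rw [← hGi, ← h v, mdiff_apply_eq (x := x) hy hθy]
      simp only [smul_apply, smul_eq_mul]
      rw [mul_comm]
    have h2 : g.inner y u u • (G y).inverse (D y) = chartDeriv m x y u := by
      rw [← map_smul, h1, hinv.inverse_apply_self]
    have h3 : g.inner y u u * (D y ((G y).inverse (D y)) * g.inner y u u) = g.inner y u u * 1 := by
      calc g.inner y u u * (D y ((G y).inverse (D y)) * g.inner y u u)
          = (g.inner y u u • D y) (g.inner y u u • (G y).inverse (D y)) := by
            simp only [smul_apply, map_smul, smul_eq_mul]; ring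
        _ = g.inner y u u * 1 := by rw [h1, h2, ← hGi, mul_one]
    exact mul_left_cancel₀ hpos.ne' h3

end Factor

end

noncomputable section

/-! ### The conformal factor -/

section Conformal

variable {m : ℕ} {M : Type*} [TopologicalSpace M] [ChartedSpace (EuclideanSpace ℝ (Fin m)) M]
  [IsManifold (𝓡 m) ∞ M] {V : Type*} [NormedAddCommGroup V] [NormedSpace ℝ V] {ι : Type*}
  {Ψ : C(unitInterval, M) → V} {γ : ι → C(ℝ, M)} {F : M → V}

/-- Primitives differ by constants; hence `F` determines a single closed form. -/
lemma IsAdaptedAt.mdiff_eq {g : SmoothMetric m M} {k k' : M → V} {y : M}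
    (hF : IsAdaptedAt g Ψ γ F y) (hk : IsPrimitiveAt Ψ k y) (hk' : IsPrimitiveAt Ψ k' y) :
    mdiff m (fun z ↦ k' z - F z) y = mdiff m (fun z ↦ k z - F z) y := by
  refine mdiff_eq_of_eq_add_const (a := k' y - k y) (hF.smooth k hk).self_of_nhds ?_
  filter_upwards [hk.sub_eq_sub m hk'] with z hz
  have e2 : k' z = k z - k y + k' y := by rw [hz]; abel
  rw [e2]; abel

lemma eventually_forall_mdiff_eq {g : SmoothMetric m M} {k : M → V} {x : M}
    (hF : ∀ x, IsAdaptedAt g Ψ γ F x) (hk : IsPrimitiveAt Ψ k x) :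
    ∀ᶠ y in 𝓝 x, ∀ k', IsPrimitiveAt Ψ k' y →
      mdiff m (fun z ↦ k' z - F z) y = mdiff m (fun z ↦ k z - F z) y := by
  filter_upwards [hk.eventually] with y hy k₁ hk₁ using (hF y).mdiff_eq hy hk₁

/-- A conformal factor for which the form represented by `F` has comass at most one with respect
to `N`, and for which the curves have constant speed, equal to the norm of their periods. -/
theorem exists_conformal_factor [T2Space M] [CompactSpace M] [Finite ι] (g : SmoothMetric m M)
    (N : Seminorm ℝ V) {C : ℝ} (hN : ∀ v, N v ≤ C * ‖v‖) (hγ : ∀ i, IsEmbeddedLoop m (γ i))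
    (hdisj : ∀ i j, i ≠ j → ∀ s t, γ i s ≠ γ j t) (hF : ∀ x, IsAdaptedAt g Ψ γ F x)
    (hΨ : IsPathCocycle Ψ) (hw : ∀ i, 0 < N (Ψ (arc (γ i) 0 1))) :
    ∃ f : M → ℝ, ContMDiff (𝓡 m) 𝓘(ℝ) ∞ f ∧ (∀ x, 0 < f x) ∧
      (∀ x k, IsPrimitiveAt Ψ k x → ∀ v,
        N (mdiff m (fun z ↦ k z - F z) x v) ^ 2 ≤ f x * g.inner x v v) ∧
      ∀ i t, f (γ i t) * g.inner (γ i t) (velocity m (γ i) t) (velocity m (γ i) t) =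
        N (Ψ (arc (γ i) 0 1)) ^ 2 := by
  -- The admissible values of the factor at `x`. They are cut out by affine equations and
  -- inequalities, hence form a convex set, so smooth local choices can be glued.
  let T : M → Set ℝ := fun x ↦ Set.ofPred fun a : ℝ ↦ 0 < a ∧
    (∀ k, IsPrimitiveAt Ψ k x → ∀ v,
      N (mdiff m (fun z ↦ k z - F z) x v) ^ 2 ≤ a * g.inner x v v) ∧
    ∀ i t, γ i t = x → a * g.inner (γ i t) (velocity m (γ i) t) (velocity m (γ i) t) =
      N (Ψ (arc (γ i) 0 1)) ^ 2
  have hT : ∀ x, Convex ℝ (T x) := by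
    intro x a ha b hb r s hr hs hrs
    obtain ⟨ha1, ha2, ha3⟩ := ha
    obtain ⟨hb1, hb2, hb3⟩ := hb
    refine ⟨?_, fun k hk v ↦ ?_, fun i t hit ↦ ?_⟩
    · rcases hr.eq_or_lt with rfl | hr
      · rw [zero_add] at hrs; simpa [hrs] using hb1
      · have : 0 < r • a := mul_pos hr ha1
        have : 0 ≤ s • b := mul_nonneg hs hb1.le
        linarith
    · have h1 := mul_le_mul_of_nonneg_left (ha2 k hk v) hr
      have h2 := mul_le_mul_of_nonneg_left (hb2 k hk v) hs
      calc N (mdiff m (fun z ↦ k z - F z) x v) ^ 2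
          = r * N (mdiff m (fun z ↦ k z - F z) x v) ^ 2 +
            s * N (mdiff m (fun z ↦ k z - F z) x v) ^ 2 := by rw [← add_mul, hrs, one_mul]
        _ ≤ r * (a * g.inner x v v) + s * (b * g.inner x v v) := add_le_add h1 h2
        _ = _ := by simp only [smul_eq_mul]; ring
    · have h1 := ha3 i t hit
      have h2 := hb3 i t hit
      simp only [smul_eq_mul]
      rw [add_mul, mul_assoc, mul_assoc, h1, h2, ← add_mul, hrs, one_mul]
  suffices H : ∀ x : M, ∃ U ∈ 𝓝 x, ∃ f : M → ℝ, ContMDiffOn (𝓡 m) 𝓘(ℝ) ∞ f U ∧ ∀ y ∈ U, f y ∈ T y by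
    obtain ⟨f, hf⟩ := exists_contMDiffMap_forall_mem_convex_of_local (𝓡 m) hT H
    exact ⟨f, f.contMDiff, fun x ↦ (hf x).1, fun x ↦ (hf x).2.1, fun i t ↦ (hf _).2.2 i t rfl⟩
  suffices H : ∀ x : M, ∃ f : M → ℝ,
      ∀ᶠ y in 𝓝 x, ContMDiffAt (𝓡 m) 𝓘(ℝ) ∞ f y ∧ f y ∈ T y by
    intro x
    obtain ⟨f, hf⟩ := H x
    exact ⟨_, hf, f, fun y hy ↦ hy.1.contMDiffWithinAt, fun y hy ↦ hy.2⟩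
  intro x
  obtain ⟨k₀, hk₀⟩ := hΨ.exists_isPrimitiveAt m x
  by_cases hx : ∀ i t, γ i t ≠ x
  · obtain ⟨A, hA⟩ := exists_mdiff_bound g ((hF x).smooth k₀ hk₀)
    -- Off the curves only the inequality matters; the summand `1` ensures positivity.
    refine ⟨fun _ ↦ C ^ 2 * abs A + 1, ?_⟩
    filter_upwards [hA, eventually_forall_mdiff_eq hF hk₀, eventually_forall_ne_curve hγ hx] with
      y hAy hky hy
    refine ⟨contMDiffAt_const, by positivity, fun k hk v ↦ ?_, fun i t h ↦ (hy i t h).elim⟩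
    rw [hky k hk]
    set u := mdiff m (fun z ↦ k₀ z - F z) y v
    have hg := g.inner_self_nonneg y v
    calc N u ^ 2 ≤ (C * ‖u‖) ^ 2 := by gcongr; exact hN u
      _ = C ^ 2 * ‖u‖ ^ 2 := by ring
      _ ≤ C ^ 2 * (abs A * g.inner y v v) := by
        gcongr
        exact (hAy v).trans (mul_le_mul_of_nonneg_right (le_abs_self A) hg)
      _ ≤ (C ^ 2 * abs A + 1) * g.inner y v v := by linarith
  push Not at hx
  obtain ⟨i, t₀, rfl⟩ := hx
  obtain ⟨k, hk, hkx⟩ : ∃ k, IsPrimitiveAt Ψ k (γ i t₀) ∧ k (γ i t₀) = Ψ (arc (γ i) 0 t₀) :=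
    ⟨_, hk₀.sub_const (k₀ (γ i t₀) - Ψ (arc (γ i) 0 t₀)), by abel⟩
  obtain ⟨θ, hθ, hkθ, hθγ⟩ := (hF _).curve i t₀ rfl
  obtain ⟨q, hq⟩ := exists_dual_norm_sq g hθ
  set w := Ψ (arc (γ i) 0 1)
  have hq1 := hq.self_of_nhds.2.2 (velocity m (γ i) t₀) (velocity_ne_zero (hγ i) t₀)
    hθγ.self_of_nhds.2
  have hqpos : 0 < q (γ i t₀) := by
    have := g.pos _ _ (velocity_ne_zero (hγ i) t₀)
    by_contra h
    nlinarith
  -- Near the curve the form is `dθ ⊗ w`, and this function bounds its squared comass; duality of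
  -- `dθ` and the velocity gives the prescribed speed on the curve.
  refine ⟨fun y ↦ N w ^ 2 * q y, ?_⟩
  filter_upwards [hq, eventually_forall_mdiff_eq hF hk, hθ,
    hq.self_of_nhds.1.continuousAt.eventually_const_lt hqpos,
    eventually_eventually_nhds.2 (hkθ k hk hkx),
    eventually_curve_eq hγ hdisj i t₀ hθγ] with y hqy hky hθy hpos hs hy
  refine ⟨contMDiffAt_const.mul hqy.1, mul_pos (pow_pos (hw i) 2) hpos, fun k' hk' v ↦ ?_,
    fun j t hj ↦ ?_⟩
  · have e : mdiff m (fun z ↦ k z - F z) y v = mdiff m θ y v • w := by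
      have hsm : ContMDiffAt (𝓡 m) 𝓘(ℝ, V) ∞ (fun z ↦ θ z • w) y := hθy.smul contMDiffAt_const
      have hys : y ∈ (chartAt (EuclideanSpace ℝ (Fin m)) y).source := mem_chart_source _ y
      rw [mdiff_congr hs, mdiff_apply_eq hys hsm, mdiff_apply_eq hys hθy]
      have hd := ((hθy.contDiffAt_comp_symm hys).differentiableAt (by simp)).hasFDerivAt
      rw [(hd.smul_const w).fderiv]
      simp
    rw [hky k' hk', e, map_smul_eq_mul, mul_pow, Real.norm_eq_abs, sq_abs]
    have := mul_le_mul_of_nonneg_left (hqy.2.1 v) (sq_nonneg (N w))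
    linarith
  · obtain ⟨rfl, n, hn⟩ := hy j t hj
    have h1 := hn.2.of_add_int (hγ j).toIsSmoothLoop
    subst hj
    rw [mul_assoc, hqy.2.2 _ (velocity_ne_zero (hγ j) t) h1, mul_one]

end Conformal

end

noncomputable section

/-! ### Lengths -/

section Length

variable {m : ℕ} {M : Type*} [TopologicalSpace M] [ChartedSpace (EuclideanSpace ℝ (Fin m)) M]
  [IsManifold (𝓡 m) ∞ M]

/-- The length of a curve on `[a, b]`. -/
def segLength (g : SmoothMetric m M) (c : ℝ → M) (a b : ℝ) : ℝ≥0∞ :=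
  letI : RiemannianBundle (fun x : M ↦ TangentSpace (𝓡 m) x) := ⟨g.toRiemannianMetric⟩
  pathELength (𝓡 m) c a b

lemma segLength_eq_lintegral (g : SmoothMetric m M) (c : ℝ → M) (a b : ℝ) :
    segLength g c a b = ∫⁻ t in Ioo a b,
      ENNReal.ofReal (Real.sqrt (g.inner (c t) (velocity m c t) (velocity m c t))) := by
  let _ : RiemannianBundle (fun x : M ↦ TangentSpace (𝓡 m) x) := ⟨g.toRiemannianMetric⟩
  unfold segLength
  rw [pathELength_eq_lintegral_mfderiv_Ioo]
  refine lintegral_congr fun t ↦ ?_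
  rw [← ofReal_norm, norm_eq_sqrt_real_inner]
  rfl

lemma segLength_congr {g : SmoothMetric m M} {c d : ℝ → M} {a b : ℝ} (h : EqOn c d (Ioo a b)) :
    segLength g c a b = segLength g d a b := by
  let _ : RiemannianBundle (fun x : M ↦ TangentSpace (𝓡 m) x) := ⟨g.toRiemannianMetric⟩
  exact pathELength_congr_Ioo h

lemma segLength_add {g : SmoothMetric m M} {c : ℝ → M} {a b d : ℝ} (h : a ≤ b) (h' : b ≤ d) :
    segLength g c a b + segLength g c b d = segLength g c a d := by
  let _ : RiemannianBundle (fun x : M ↦ TangentSpace (𝓡 m) x) := ⟨g.toRiemannianMetric⟩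
  exact pathELength_add h h'

lemma segLength_const {g : SmoothMetric m M} {c : ℝ → M} {a b : ℝ} {x : M}
    (h : ∀ t ∈ Ioo a b, c t = x) : segLength g c a b = 0 := by
  rw [segLength_congr (d := fun _ ↦ x) h, segLength_eq_lintegral]
  have h0 (t : ℝ) : velocity m (fun _ : ℝ ↦ x) t = 0 := by
    unfold velocity
    rw [mfderiv_const]
    rfl
  simp [h0]

lemma segLength_comp {g : SmoothMetric m M} {c : ℝ → M} {a b : ℝ} {f : ℝ → ℝ} (h : a ≤ b)
    (hf : Monotone f) (hf' : Differentiable ℝ f) (hc : MDifferentiable 𝓘(ℝ) (𝓡 m) c) :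
    segLength g (c ∘ f) a b = segLength g c (f a) (f b) := by
  let _ : RiemannianBundle (fun x : M ↦ TangentSpace (𝓡 m) x) := ⟨g.toRiemannianMetric⟩
  exact pathELength_comp_of_monotoneOn h (hf.monotoneOn _) hf'.differentiableOn
    hc.mdifferentiableOn

lemma segLength_lt_top (g : SmoothMetric m M) {c : ℝ → M} (hc : ContMDiff 𝓘(ℝ) (𝓡 m) ∞ c)
    (a b : ℝ) : segLength g c a b < ⊤ := by
  have hcont : Continuous fun t ↦ g.inner (c t) (velocity m c t) (velocity m c t) := by
    rw [continuous_iff_continuousAt]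
    intro t₀
    obtain ⟨G, hG⟩ := g.exists_chart_form (c t₀)
    set φ := chartAt (EuclideanSpace ℝ (Fin m)) (c t₀) with hφ
    have hsrc : ∀ᶠ t in 𝓝 t₀, c t ∈ φ.source :=
      hc.continuous.continuousAt.eventually (φ.open_source.mem_nhds (mem_chart_source _ _))
    have h0 := hsrc.self_of_nhds
    have h1 : ContDiffAt ℝ ∞ (fun t ↦ G (c t)) t₀ := ((hG _ h0).1.comp t₀ (hc t₀)).contDiffAt
    have h2 := (contDiffAt_chartAt_comp hc h0).deriv_right_real
    have h3 := ((h1.clm_apply h2).clm_apply h2).continuousAt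
    refine h3.congr ?_
    filter_upwards [hsrc] with t ht
    rw [(hG _ ht).2, chartDeriv_velocity ht (hc.mdifferentiableAt (by simp))]
  rw [segLength_eq_lintegral]
  obtain ⟨B, hB⟩ := isCompact_Icc.exists_bound_of_continuousOn (s := Icc a b)
    (Real.continuous_sqrt.comp hcont).continuousOn
  calc _ ≤ ∫⁻ t in Ioo a b, ENNReal.ofReal B := by
        refine setLIntegral_mono' measurableSet_Ioo fun t ht ↦ ENNReal.ofReal_le_ofReal ?_
        exact (le_abs_self _).trans (hB t ⟨ht.1.le, ht.2.le⟩)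
    _ < ⊤ := by
        rw [setLIntegral_const]
        exact ENNReal.mul_lt_top ENNReal.ofReal_lt_top (by simp)

/-- Curves of constant speed. -/
lemma segLength_of_speed {g : SmoothMetric m M} {c : ℝ → M} {r : ℝ} (hr : 0 ≤ r)
    (h : ∀ t, g.inner (c t) (velocity m c t) (velocity m c t) = r ^ 2) (a b : ℝ) :
    segLength g c a b = ENNReal.ofReal r * ENNReal.ofReal (b - a) := by
  rw [segLength_eq_lintegral]
  simp only [h, Real.sqrt_sq hr]
  rw [setLIntegral_const, Real.volume_Ioo]

variable {V : Type*} [NormedAddCommGroup V] [NormedSpace ℝ V]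
  {Ψ : C(unitInterval, M) → V} {F : M → V}

/-- A curve on which a form with comass at most one is integrated. -/
lemma enorm_le_segLength {g : SmoothMetric m M} (hΨ : IsPathCocycle Ψ)
    (hsm : ∀ x k, IsPrimitiveAt Ψ k x → ContMDiffAt (𝓡 m) 𝓘(ℝ, V) ∞ (fun z ↦ k z - F z) x)
    (hF : ∀ x k, IsPrimitiveAt Ψ k x → ∀ v,
      ‖mdiff m (fun z ↦ k z - F z) x v‖ ^ 2 ≤ g.inner x v v)
    {c : C(ℝ, M)} {a b : ℝ} (hab : a ≤ b) (hc : ContMDiffOn 𝓘(ℝ) (𝓡 m) 1 c (Icc a b)) :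
    ‖Ψ (arc c a b) - F (c b) + F (c a)‖ₑ ≤ segLength g c a b := by
  -- Up to a constant, the integral of the form along `c` from `a` to `t`. It is `C¹` on the segment
  -- although neither term need be continuous.
  let u : ℝ → V := fun t ↦ Ψ (arc c a t) - F (c t)
  have key (t₀ : ℝ) : ∃ k, IsPrimitiveAt Ψ k (c t₀) ∧
      ∀ᶠ t in 𝓝 t₀, u t = (fun z ↦ k z - F z) (c t) + (Ψ (arc c a t₀) - k (c t₀)) := by
    obtain ⟨k, hk⟩ := hΨ.exists_isPrimitiveAt m (c t₀)
    refine ⟨k, hk, ?_⟩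
    filter_upwards [hk.arc_eq] with t ht
    simp only [u]
    rw [← hΨ.arc_add c a t₀ t, ht]; abel
  have hu : ContDiffOn ℝ 1 u (Icc a b) := by
    intro t ht
    obtain ⟨k, hk, hkt⟩ := key t
    have h1 : ContMDiffWithinAt 𝓘(ℝ) 𝓘(ℝ, V) 1 (fun t ↦ (fun z ↦ k z - F z) (c t)) (Icc a b) t :=
      ((hsm _ k hk).of_le (by exact_mod_cast le_top)).comp_contMDiffWithinAt t (hc t ht)
    exact (h1.contDiffWithinAt.add contDiffWithinAt_const).congr_of_eventuallyEq
      (mem_nhdsWithin_of_mem_nhds hkt) hkt.self_of_nhds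
  have e : Ψ (arc c a b) - F (c b) + F (c a) = u b - u a := by
    simp only [u, hΨ.arc_self]; abel
  rw [e]
  refine (enorm_sub_le_lintegral_deriv_of_contDiffOn_Icc hu hab).trans ?_
  rw [segLength_eq_lintegral, ← restrict_Ioo_eq_restrict_Icc]
  refine setLIntegral_mono' measurableSet_Ioo fun t ht ↦ ?_
  obtain ⟨k, hk, hkt⟩ := key t
  have hct : MDifferentiableAt 𝓘(ℝ) (𝓡 m) c t :=
    ((hc t ⟨ht.1.le, ht.2.le⟩).contMDiffAt (Icc_mem_nhds ht.1 ht.2)).mdifferentiableAt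
      one_ne_zero
  have hd : HasDerivAt u (mdiff m (fun z ↦ k z - F z) (c t) (velocity m c t)) t := by
    have h1 := HasMFDerivAt.comp t
      ((hsm _ k hk).mdifferentiableAt (by simp)).hasMFDerivAt hct.hasMFDerivAt
    have h2 : HasFDerivAt (fun t ↦ (fun z ↦ k z - F z) (c t))
      (ContinuousLinearMap.comp (M₂ := EuclideanSpace ℝ (Fin m)) (mdiff m (fun z ↦ k z - F z) (c t))
        (mfderiv 𝓘(ℝ) (𝓡 m) c t) : ℝ →L[ℝ] V) t := h1.hasFDerivAt
    exact (h2.hasDerivAt.add_const _).congr_of_eventuallyEq hkt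
  rw [hd.deriv, ← ofReal_norm]
  exact ENNReal.ofReal_le_ofReal (Real.le_sqrt_of_sq_le (hF _ k hk _))

end Length

end

noncomputable section

/-! ### The conformal metric -/

section Metric

variable {m : ℕ} {M : Type*} [TopologicalSpace M] [ChartedSpace (EuclideanSpace ℝ (Fin m)) M]
  [IsManifold (𝓡 m) ∞ M]

variable {V : Type*} [NormedAddCommGroup V] [NormedSpace ℝ V]
  {Ψ : C(unitInterval, M) → V} {F : M → V} {ι : Type*} {γ : ι → C(ℝ, M)}

/-- There is a conformal metric for which closed curves are at least as long as the norm of their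
period, with equality for given disjoint embedded curves. -/
theorem exists_conformal_metric [T2Space M] [CompactSpace M] [Finite ι] (g : SmoothMetric m M)
    (hΨ : IsPathCocycle Ψ) (hγ : ∀ i, IsEmbeddedLoop m (γ i))
    (hdisj : ∀ i j, i ≠ j → ∀ s t, γ i s ≠ γ j t) (hw : ∀ i, Ψ (arc (γ i) 0 1) ≠ 0) :
    ∃ g' : SmoothMetric m M, IsConformalTo g g' ∧
      (∀ (x : M) (p : Path x x), IsPiecewiseC1 m p.extend →
        ‖Ψ p.toContinuousMap‖ₑ ≤ curveLength g' p.extend) ∧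
      ∀ i a b, segLength g' (γ i) a b = ‖Ψ (arc (γ i) 0 1)‖ₑ * ENNReal.ofReal (b - a) := by
  obtain ⟨F, hF⟩ := exists_isAdaptedAt g hΨ hγ hdisj
  obtain ⟨f, hf, hpos, hfF, hfγ⟩ := exists_conformal_factor g (normSeminorm ℝ V) (C := 1)
    (fun v ↦ by simp) hγ hdisj hF hΨ (fun i ↦ by simpa using hw i)
  let g' : SmoothMetric m M := ContMDiffRiemannianMetric.conformal g f hf hpos
  have hg' (x : M) (v w : TangentSpace (𝓡 m) x) : g'.inner x v w = f x * g.inner x v w := rfl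
  refine ⟨g', ⟨f, hf, hpos, hg'⟩, fun x p hp ↦ ?_, fun i a b ↦ ?_⟩
  · obtain ⟨-, n, t, ht, ht0, htn, hC⟩ := hp
    let c : C(ℝ, M) := ⟨p.extend, p.continuous_extend⟩
    have hseg (i : ℕ) (hi : i < n) := enorm_le_segLength (g := g') (F := F) hΨ
      (fun x k hk ↦ ((hF x).smooth k hk).self_of_nhds) hfF (c := c)
      (ht (Nat.le_succ i)) (hC i hi)
    -- The values of `F` telescope along the subdivision, and they cancel at the end because the
    -- curve is closed.
    have hsum (j : ℕ) (hj : j ≤ n) :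
        ‖Ψ (arc c 0 (t j)) - F (c (t j)) + F (c 0)‖ₑ ≤ segLength g' c 0 (t j) := by
      induction j with
      | zero => simp [ht0, hΨ.arc_self]
      | succ j ih =>
        have e : Ψ (arc c 0 (t (j + 1))) - F (c (t (j + 1))) + F (c 0) =
            (Ψ (arc c 0 (t j)) - F (c (t j)) + F (c 0)) +
            (Ψ (arc c (t j) (t (j + 1))) - F (c (t (j + 1))) + F (c (t j))) := by
          rw [← hΨ.arc_add c 0 (t j) (t (j + 1))]; abel
        rw [e, ← segLength_add (ht0 ▸ ht (Nat.zero_le j)) (ht (Nat.le_succ j))]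
        exact (enorm_add_le _ _).trans (add_le_add (ih (by omega)) (hseg j (by omega)))
    have h1 := hsum n le_rfl
    have e1 : arc c 0 (t n) = p.toContinuousMap := by
      ext s
      rw [htn, arc_apply]
      simp [c]
    have e2 : c (t n) = c 0 := by
      rw [htn]
      change p.extend 1 = p.extend 0
      simp
    rw [e1, e2, sub_add_cancel, htn] at h1
    exact h1
  · rw [segLength_of_speed (r := ‖Ψ (arc (γ i) 0 1)‖) (norm_nonneg _) (fun t ↦ hfγ i t),
      ofReal_norm]

end Metric

/-! ### Joining points by curves of controlled length -/

section Join

variable {m : ℕ} {M : Type u} [TopologicalSpace M] [ChartedSpace (EuclideanSpace ℝ (Fin m)) M]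
  [IsManifold (𝓡 m) ∞ M] {A : Type*} [AddCommGroup A]
  {Ψ : C(unitInterval, M) → A} {g : SmoothMetric m M} {x y z : M} {a b : A} {r s : ℝ≥0∞}

/-- There is a flat curve of length at most `r` from `x` to `y` on which `Ψ` is `a`. -/
def FlatJoinLE (g : SmoothMetric m M) (Ψ : C(unitInterval, M) → A) (x y : M) (a : A) (r : ℝ≥0∞) :
    Prop :=
  ∃ c : C(ℝ, M), IsFlatCurve m c x y ∧ Ψ (arc c 0 1) = a ∧ segLength g c 0 1 ≤ r

omit [AddCommGroup A] in
lemma FlatJoinLE.mono (h : FlatJoinLE g Ψ x y a r) (hrs : r ≤ s) : FlatJoinLE g Ψ x y a s := by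
  obtain ⟨c, hc, hca, hcr⟩ := h
  exact ⟨c, hc, hca, hcr.trans hrs⟩

lemma FlatJoinLE.trans (hΨ : IsPathCocycle Ψ) (h1 : FlatJoinLE g Ψ x y a r)
    (h2 : FlatJoinLE g Ψ y z b s) : FlatJoinLE g Ψ x z (a + b) (r + s) := by
  obtain ⟨c, hc, rfl, hcr⟩ := h1
  obtain ⟨d, hd, rfl, hds⟩ := h2
  obtain ⟨Q, hQ, q1, q2⟩ := hc.exists_trans hd
  refine ⟨Q, hQ, hΨ.arc_exists_trans hc hd q1 q2, ?_⟩
  have l1 : segLength g Q 0 (1 / 3) = 0 := segLength_const (x := x) fun t ht ↦ by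
    rw [q1 t (by linarith [ht.2]), hc.left _ (by linarith [ht.2])]
  have l2 : segLength g Q (2 / 3) 1 = 0 := segLength_const (x := z) fun t ht ↦ by
    rw [q2 t (by linarith [ht.1]), hd.right _ (by linarith [ht.1])]
  have l3 : segLength g Q (1 / 3) (1 / 2) = segLength g c 0 1 := by
    rw [segLength_congr (d := c ∘ fun t ↦ 6 * t - 2) fun t ht ↦ q1 t (by linarith [ht.2]),
      segLength_comp (by norm_num) (fun u v h ↦ by linarith) (by fun_prop)
        (hc.smooth.mdifferentiable (by simp))]
    norm_num
  have l4 : segLength g Q (1 / 2) (2 / 3) = segLength g d 0 1 := by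
    rw [segLength_congr (d := d ∘ fun t ↦ 6 * t - 3) fun t ht ↦ q2 t (by linarith [ht.1]),
      segLength_comp (by norm_num) (fun u v h ↦ by linarith) (by fun_prop)
        (hd.smooth.mdifferentiable (by simp))]
    norm_num
  rw [← segLength_add (b := 1 / 3) (by norm_num) (by norm_num),
    ← segLength_add (a := 1 / 3) (b := 1 / 2) (by norm_num) (by norm_num),
    ← segLength_add (a := 1 / 2) (b := 2 / 3) (by norm_num) (by norm_num), l1, l2, l3, l4,
    zero_add, add_zero]
  exact add_le_add hcr hds

lemma exists_flatJoinLE (g : SmoothMetric m M) (hΨ : IsPathCocycle Ψ) (p : Path x y) :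
    ∃ r < ⊤, FlatJoinLE g Ψ x y (Ψ p.toContinuousMap) r := by
  obtain ⟨c, hc, hcp⟩ := flatJoin_of_path (m := m) hΨ p.toContinuousMap
  have h0 : p.toContinuousMap 0 = x := p.source
  have h1 : p.toContinuousMap 1 = y := p.target
  rw [h0, h1] at hc
  exact ⟨_, segLength_lt_top g hc.smooth 0 1, c, hc, hcp, le_rfl⟩

/-- Turn `n` times around `c` with a monotone reparametrization which is constant outside the middle
third. Monotonicity preserves the length; a homotopy of parametrizations preserves `Ψ`. -/
lemma IsSmoothLoop.flatJoinLE (g : SmoothMetric m M) (hΨ : IsPathCocycle Ψ) {c : C(ℝ, M)}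
    (hc : IsSmoothLoop m c) (n : ℕ) :
    FlatJoinLE g Ψ (c 0) (c 0) (n • Ψ (arc c 0 1)) (segLength g c 0 n) := by
  let σ : ℝ → ℝ := fun t ↦ n * Real.smoothTransition (3 * t - 1)
  have hσ : ContDiff ℝ ∞ σ :=
    contDiff_const.mul (Real.smoothTransition.contDiff.comp (by fun_prop))
  have σ0 : ∀ t ≤ 1 / 3, σ t = 0 := fun t ht ↦ by
    simp [σ, Real.smoothTransition.zero_of_nonpos (show 3 * t - 1 ≤ 0 by linarith)]
  have σ1 : ∀ t, 2 / 3 ≤ t → σ t = n := fun t ht ↦ by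
    simp [σ, Real.smoothTransition.one_of_one_le (show 1 ≤ 3 * t - 1 by linarith)]
  have hn : c n = c 0 := by simpa using hc.add_int 0 n
  let d : C(ℝ, M) := c.comp ⟨σ, hσ.continuous⟩
  refine ⟨d, ⟨hc.smooth.comp hσ.contMDiff, fun t ht ↦ congrArg c (σ0 t ht), fun t ht ↦ ?_⟩, ?_, ?_⟩
  · exact (congrArg c (σ1 t ht)).trans hn
  · have h1 := hΨ.arc_add_int hc.periodic 0 n
    rw [hΨ.arc_self, zero_add, zero_add] at h1
    rw [← natCast_zsmul, ← h1]
    let Γ : C(ℝ × ℝ, ℝ) := ⟨fun z ↦ (1 - z.1) * (n * z.2) + z.1 * σ z.2, by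
      have := hσ.continuous
      fun_prop⟩
    have hΓ (s t : ℝ) : Γ (s, t) = (1 - s) * (n * t) + s * σ t := rfl
    have h2 := hΨ.eq_of_homotopy (c.comp Γ) (fun s ↦ by simp [hΓ, σ0 0])
      (fun s ↦ by
        have : Γ (s, 1) = Γ (0, 1) := by rw [hΓ, hΓ, σ1 1 (by norm_num)]; ring
        simp [this])
    refine Eq.trans ?_ (h2.symm.trans ?_)
    · congr 1
      ext t
      have : planeSeg (1, 0) (1, 1) t = (1, (t : ℝ)) := by simp [planeSeg]
      rw [ContinuousMap.comp_apply, this, ContinuousMap.comp_apply, hΓ]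
      simp [arc_apply, d]
    · congr 1
      ext t
      have : planeSeg (0, 0) (0, 1) t = (0, (t : ℝ)) := by simp [planeSeg]
      rw [ContinuousMap.comp_apply, this, ContinuousMap.comp_apply, hΓ]
      simp [arc_apply, mul_comm]
  · have hmono : Monotone σ := fun u v h ↦ by
      dsimp only [σ]
      exact mul_le_mul_of_nonneg_left (Real.smoothTransition.monotone (by linarith))
        (Nat.cast_nonneg n)
    have := segLength_comp (g := g) (a := 0) (b := 1) zero_le_one hmono
      (hσ.differentiable (by simp)) (hc.smooth.mdifferentiable (by simp))
    rw [σ0 0 (by norm_num), σ1 1 (by norm_num)] at this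
    exact this.le

/-- Sums of multiples of periods are realized by closed curves through a base point, with a
bounded excess of length. -/
lemma exists_flatJoinLE_sum [PathConnectedSpace M] (g : SmoothMetric m M) (hΨ : IsPathCocycle Ψ)
    {ι : Type*} (T : Finset ι) {γ : ι → C(ℝ, M)} (hγ : ∀ i, IsSmoothLoop m (γ i)) (x : M) :
    ∃ R < ⊤, ∀ k : ι → ℕ, FlatJoinLE g Ψ x x (∑ i ∈ T, k i • Ψ (arc (γ i) 0 1))
      (∑ i ∈ T, segLength g (γ i) 0 (k i) + R) := by
  classical
  induction T using Finset.induction_on with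
  | empty =>
    obtain ⟨r, hr, h⟩ := exists_flatJoinLE g hΨ (Path.refl x)
    refine ⟨r, hr, fun k ↦ ?_⟩
    have e : Ψ (Path.refl x).toContinuousMap = 0 := hΨ.const x
    simpa [e] using h
  | insert i T hi ih =>
    obtain ⟨R, hR, h⟩ := ih
    let p : Path x (γ i 0) := PathConnectedSpace.somePath x (γ i 0)
    obtain ⟨r₁, hr₁, h₁⟩ := exists_flatJoinLE g hΨ p
    obtain ⟨r₂, hr₂, h₂⟩ := exists_flatJoinLE g hΨ p.symm
    -- The path to `γ i` and its reverse cancel in `Ψ` and are travelled once each, whatever the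
    -- number of turns.
    refine ⟨r₁ + r₂ + R, by simp [hr₁, hr₂, hR], fun k ↦ ?_⟩
    have h3 := ((h₁.trans hΨ ((hγ i).flatJoinLE g hΨ (k i))).trans hΨ h₂).trans hΨ (h k)
    rw [hΨ.symm, add_neg_cancel_comm] at h3
    rw [Finset.sum_insert hi, Finset.sum_insert hi]
    refine h3.mono (le_of_eq ?_)
    ring

end Join

/-! ### From flat curves to minimal lengths -/

section MinLength

variable {m : ℕ} {M : Type u} [TopologicalSpace M] [ChartedSpace (EuclideanSpace ℝ (Fin m)) M]
  [IsManifold (𝓡 m) ∞ M] {Ψ : C(unitInterval, M) → realH1 M} {g : SmoothMetric m M} {x : M}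
  {v : realH1 M} {r : ℝ≥0∞}

lemma FlatJoinLE.minLength_le (hΨ : ∀ x (γ : Path x x), Ψ γ.toContinuousMap = loopClass γ)
    (h : FlatJoinLE g Ψ x x v r) : minLength g v ≤ r := by
  obtain ⟨c, hc, hcv, hcr⟩ := h
  let p : Path x x := ⟨arc c 0 1, by simp [arc_apply, hc.left 0], by
    have := hc.right 1 (by norm_num)
    simp [arc_apply, this]⟩
  have hp : EqOn p.extend c (Icc 0 1) := fun t ht ↦ by
    rw [p.extend_apply ht]
    change arc c 0 1 ⟨t, ht⟩ = c t
    simp [arc_apply]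
  have hpw : IsPiecewiseC1 m p.extend := by
    refine ⟨p.continuous_extend.continuousOn, 1, fun k ↦ k, Nat.mono_cast, by simp, by simp, ?_⟩
    intro i hi
    obtain rfl : i = 0 := by omega
    have h1 : ContMDiffOn 𝓘(ℝ) (𝓡 m) 1 c (Icc 0 1) :=
      (hc.smooth.of_le (by exact_mod_cast le_top)).contMDiffOn
    simpa using h1.congr hp
  have hl : loopClass p = v := by rw [← hΨ x p]; exact hcv
  refine le_trans (iInf₂_le_of_le x p (iInf₂_le_of_le hpw hl le_rfl)) ?_
  refine le_trans (le_of_eq ?_) hcr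
  exact segLength_congr (g := g) fun t ht ↦ hp ⟨ht.1.le, ht.2.le⟩

end MinLength

end

noncomputable section

/-! ### Centrally symmetric polytopes -/

section Polytope

variable {E : Type*} [AddCommGroup E] [Module ℝ E]

/-- If a convex combination with positive weights of points of the unit ball has norm one, and the
points are affinely independent, then they are linearly independent. -/
lemma linearIndependent_of_seminorm_eq_one {ι : Type*} [Fintype ι] (N : Seminorm ℝ E) {z : ι → E}
    {w : ι → ℝ} (hz : ∀ i, N (z i) ≤ 1) (hw : ∀ i, 0 < w i) (hw1 : ∑ i, w i = 1)
    (hN : 1 ≤ N (∑ i, w i • z i)) (hai : AffineIndependent ℝ z) : LinearIndependent ℝ z := by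
  -- If a relation had positive coefficient sum, subtracting a small multiple of it from the weights
  -- would express the same vector with positive weights of sum less than one, so its norm would be
  -- less than one.
  have key (c : ι → ℝ) (hc : ∑ i, c i • z i = 0) : ∑ i, c i ≤ 0 := by
    by_contra! h
    obtain ⟨ε, hε, hεw⟩ : ∃ ε > 0, ∀ i, 0 < w i - ε * c i := by
      have h1 : ∀ᶠ ε in 𝓝 (0 : ℝ), ∀ i, 0 < w i - ε * c i := by
        rw [eventually_all]
        intro i
        have h2 : ContinuousAt (fun ε : ℝ ↦ w i - ε * c i) 0 := by fun_prop
        refine h2.eventually_const_lt ?_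
        simpa using hw i
      obtain ⟨ε, hε1, hε2⟩ :=
        ((h1.filter_mono nhdsWithin_le_nhds).and (self_mem_nhdsWithin (s := Ioi (0 : ℝ)))).exists
      exact ⟨ε, hε2, hε1⟩
    have e : ∑ i, w i • z i = ∑ i, (w i - ε * c i) • z i := by
      simp only [sub_smul, Finset.sum_sub_distrib, mul_smul, ← Finset.smul_sum, hc, smul_zero,
        sub_zero]
    have h3 : N (∑ i, w i • z i) ≤ ∑ i, (w i - ε * c i) := by
      rw [e]
      refine (Finset.le_sum_of_subadditive N (map_zero N).le (map_add_le_add N) _ _).trans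
        (Finset.sum_le_sum fun i _ ↦ ?_)
      rw [map_smul_eq_mul, Real.norm_of_nonneg (hεw i).le]
      exact mul_le_of_le_one_right (hεw i).le (hz i)
    rw [Finset.sum_sub_distrib, ← Finset.mul_sum, hw1] at h3
    have := mul_pos hε h
    linarith
  rw [Fintype.linearIndependent_iff]
  intro c hc
  -- Applied to `c` and to `-c`, the claim shows that every linear relation is an affine one.
  have h0 : ∑ i, c i = 0 := by
    refine le_antisymm (key c hc) ?_
    have := key (fun i ↦ -c i) (by simp [hc])
    simpa using this
  intro i
  refine hai.eq_zero_of_sum_eq_zero (s := Finset.univ) h0 hc i (Finset.mem_univ i)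

end Polytope

section PolytopeNorm

variable {E : Type*} [NormedAddCommGroup E] [NormedSpace ℝ E]

/-- The norm whose unit ball is a given centrally symmetric polytope, and decomposition of vectors
along the vertices of a face. -/
theorem exists_seminorm_of_polytope {K : Set E} (hK : ∃ S : Set E, S.Finite ∧ K = convexHull ℝ S)
    (hsymm : -K = K) (hint : (interior K).Nonempty) :
    (K.extremePoints ℝ).Finite ∧ ∃ N : Seminorm ℝ E, (∀ u, N u = 0 → u = 0) ∧
      (∀ u, N u ≤ 1 ↔ u ∈ K) ∧ ∀ v, ∃ (n : ℕ) (z : Fin n → E) (a : Fin n → ℝ),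
        (∀ i, z i ∈ K.extremePoints ℝ) ∧ LinearIndependent ℝ z ∧ (∀ i, 0 ≤ a i) ∧
        v = ∑ i, a i • z i ∧ ∑ i, a i = N v := by
  obtain ⟨S, hS, hKS⟩ := hK
  have hconv : Convex ℝ K := hKS ▸ convex_convexHull ℝ S
  have hcomp : IsCompact K := hKS ▸ hS.isCompact_convexHull ℝ
  have hneg (x : E) (hx : x ∈ K) : -x ∈ K := by rwa [← hsymm, Set.neg_mem_neg]
  have hext : (K.extremePoints ℝ).Finite := hS.subset (hKS ▸ extremePoints_convexHull_subset)
  have hKM : convexHull ℝ (K.extremePoints ℝ) = K := by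
    rw [← (hext.isClosed_convexHull ℝ).closure_eq]
    exact closure_convexHull_extremePoints hcomp hconv
  have h0 : K ∈ 𝓝 (0 : E) := by
    obtain ⟨z, hz⟩ := hint
    have hz' : -z ∈ interior K := by
      have : -interior K = interior (-K) := (Homeomorph.neg E).preimage_interior K
      rw [hsymm] at this
      rw [← this, Set.neg_mem_neg]; exact hz
    have := hconv.interior hz hz' (show (0 : ℝ) ≤ 1 / 2 by norm_num)
      (show (0 : ℝ) ≤ 1 / 2 by norm_num) (by norm_num)
    rw [smul_neg, add_neg_cancel] at this
    exact mem_interior_iff_mem_nhds.1 this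
  have habs : Absorbent ℝ K := absorbent_nhds_zero h0
  have hbal : Balanced ℝ K := (balanced_iff_neg_mem hconv).2 fun x hx ↦ hneg x hx
  let N : Seminorm ℝ E := gaugeSeminorm hbal hconv habs
  have hN1 (u : E) : N u ≤ 1 ↔ u ∈ K := by
    constructor
    · intro hu
      rw [← hcomp.isClosed.closure_eq]
      exact mem_closure_of_gauge_le_one hconv (mem_of_mem_nhds h0) habs hu
    · intro hu
      exact gauge_le_one_of_mem hu
  have hdef (u : E) (hu : N u = 0) : u = 0 := by
    exact (gauge_eq_zero habs (NormedSpace.isVonNBounded_of_isBounded ℝ hcomp.isBounded)).1 hu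
  refine ⟨hext, N, hdef, hN1, fun v ↦ ?_⟩
  rcases eq_or_ne v 0 with rfl | hv
  · exact ⟨0, Fin.elim0, Fin.elim0, by simp, linearIndependent_empty_type, by simp, by simp, by simp⟩
  have hNv : 0 < N v := lt_of_le_of_ne (apply_nonneg N v) fun h ↦ hv (hdef v h.symm)
  have hNx : N ((N v)⁻¹ • v) = 1 := by
    rw [map_smul_eq_mul, Real.norm_of_nonneg (inv_nonneg.2 hNv.le), inv_mul_cancel₀ hNv.ne']
  have hx : (N v)⁻¹ • v ∈ convexHull ℝ (K.extremePoints ℝ) := by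
    rw [hKM, ← hN1, hNx]
  -- Carathéodory's theorem for the normalized vector, which has norm one; this upgrades affine to
  -- linear independence.
  obtain ⟨ι, _, z, w, hz, hai, hw, hw1, hsum⟩ := eq_pos_convex_span_of_mem_convexHull hx
  have hli := linearIndependent_of_seminorm_eq_one N
    (fun i ↦ (hN1 _).2 (extremePoints_subset (hz ⟨i, rfl⟩))) hw hw1 (by rw [hsum, hNx]) hai
  let e := (Fintype.equivFin ι).symm
  refine ⟨Fintype.card ι, z ∘ e, fun i ↦ N v * w (e i), fun i ↦ hz ⟨_, rfl⟩,
    hli.comp e e.injective, fun i ↦ mul_nonneg hNv.le (hw _).le, ?_, ?_⟩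
  · refine Eq.trans ?_ (e.sum_comp fun i ↦ (N v * w i) • z i).symm
    simp only [mul_smul, ← Finset.smul_sum, hsum]
    rw [smul_smul, mul_inv_cancel₀ hNv.ne', one_smul]
  · rw [e.sum_comp fun i ↦ N v * w i, ← Finset.mul_sum, hw1, mul_one]

/-- The same in a finite dimensional space with its module topology. -/
theorem exists_seminorm_of_polytope_of_isModuleTopology {E : Type*} [AddCommGroup E] [Module ℝ E]
    [FiniteDimensional ℝ E] [TopologicalSpace E] [IsModuleTopology ℝ E]
    {K : Set E} (hK : ∃ S : Set E, S.Finite ∧ K = convexHull ℝ S)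
    (hsymm : -K = K) (hint : (interior K).Nonempty) :
    (K.extremePoints ℝ).Finite ∧ ∃ N : Seminorm ℝ E, (∀ u, N u = 0 → u = 0) ∧
      (∀ u, N u ≤ 1 ↔ u ∈ K) ∧ ∀ v, ∃ (n : ℕ) (z : Fin n → E) (a : Fin n → ℝ),
        (∀ i, z i ∈ K.extremePoints ℝ) ∧ LinearIndependent ℝ z ∧ (∀ i, 0 ≤ a i) ∧
        v = ∑ i, a i • z i ∧ ∑ i, a i = N v := by
  have : IsTopologicalAddGroup E := IsModuleTopology.topologicalAddGroup ℝ E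
  let e : E ≃ₗ[ℝ] EuclideanSpace ℝ (Fin (Module.finrank ℝ E)) :=
    LinearEquiv.ofFinrankEq _ _ (by simp)
  have he : Continuous e := IsModuleTopology.continuous_of_linearMap e.toLinearMap
  have he' : Continuous e.symm := LinearMap.continuous_of_finiteDimensional e.symm.toLinearMap
  let h : E ≃ₜ EuclideanSpace ℝ (Fin (Module.finrank ℝ E)) := ⟨e.toEquiv, he, he'⟩
  have hmem (u : E) : e u ∈ e '' K ↔ u ∈ K := e.injective.mem_set_image
  obtain ⟨S, hS, hKS⟩ := hK
  obtain ⟨hfin, N, hdef, hN1, hdec⟩ := exists_seminorm_of_polytope (K := e '' K)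
    ⟨e '' S, hS.image e, by rw [hKS]; exact e.toLinearMap.image_convexHull S⟩
    (by
      conv_rhs => rw [← hsymm]
      exact (Set.image_neg e.toLinearMap.toAddMonoidHom K).symm)
    (by
      have : e '' interior K = interior (e '' K) := h.image_interior K
      rw [← this]
      exact hint.image e)
  have hext : e '' K.extremePoints ℝ = (e '' K).extremePoints ℝ := image_extremePoints e K
  refine ⟨(hext ▸ hfin).of_finite_image e.injective.injOn, N.comp e.toLinearMap,
    fun u hu ↦ ?_, fun u ↦ ?_, fun v ↦ ?_⟩
  · exact e.map_eq_zero_iff.1 (hdef (e u) hu)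
  · exact (hN1 (e u)).trans (hmem u)
  · obtain ⟨n, z, a, hz, hli, ha, hv, hs⟩ := hdec (e v)
    refine ⟨n, fun i ↦ e.symm (z i), a, fun i ↦ ?_, ?_, ha, ?_, hs⟩
    · have := hz i
      rw [← hext] at this
      obtain ⟨u, hu, hue⟩ := this
      change e.symm (z i) ∈ _
      rw [← hue, e.symm_apply_apply]
      exact hu
    · exact hli.map' e.symm.toLinearMap e.symm.ker
    · apply e.injective
      simp [hv]

end PolytopeNorm

end

noncomputable section

/-! ### The stable norm of the conformal metric -/

section Stable

/-- Finitely many nonnegative rational numbers have a common denominator. -/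
lemma exists_common_denominator {ι : Type*} (T : Finset ι) {b : ι → ℝ}
    (hb : ∀ i ∈ T, ∃ q : ℚ, b i = q) (h0 : ∀ i ∈ T, 0 ≤ b i) :
    ∃ D : ℕ, 0 < D ∧ ∀ i ∈ T, ∃ k : ℕ, D * b i = k := by
  classical
  induction T using Finset.induction_on with
  | empty => exact ⟨1, one_pos, by simp⟩
  | insert j T hj ih =>
    obtain ⟨D, hD, h⟩ := ih (fun i hi ↦ hb i (Finset.mem_insert_of_mem hi))
      fun i hi ↦ h0 i (Finset.mem_insert_of_mem hi)
    obtain ⟨q, hq⟩ := hb j (Finset.mem_insert_self j T)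
    have hq0 : 0 ≤ q := by
      have := h0 j (Finset.mem_insert_self j T)
      rw [hq] at this
      exact_mod_cast this
    refine ⟨D * q.den, Nat.mul_pos hD q.den_pos, fun i hi ↦ ?_⟩
    rcases Finset.mem_insert.1 hi with rfl | hi
    · refine ⟨D * q.num.toNat, ?_⟩
      have h1 : (q.den : ℚ) * q = q.num.toNat := by
        rw [mul_comm, Rat.mul_den_eq_num]
        exact_mod_cast (Int.toNat_of_nonneg (Rat.num_nonneg.2 hq0)).symm
      have h2 : (q.den : ℝ) * (q : ℝ) = q.num.toNat := by
        exact_mod_cast congrArg (Rat.cast (K := ℝ)) h1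
      push_cast
      rw [hq, mul_assoc, h2]
    · obtain ⟨k, hk⟩ := h i hi
      refine ⟨q.den * k, ?_⟩
      push_cast
      rw [← hk]; ring

lemma tendsto_div_of_bounded_excess {f : ℕ → ℝ≥0∞} {r : ℝ} {R : ℝ≥0∞} (hR : R < ⊤)
    (hl : ∀ n : ℕ, ENNReal.ofReal (n * r) ≤ f n)
    (hu : ∀ n : ℕ, f n ≤ ENNReal.ofReal (n * r) + R) :
    Tendsto (fun n : ℕ ↦ f n / n) atTop (𝓝 (ENNReal.ofReal r)) := by
  have e (n : ℕ) (hn : n ≠ 0) : ENNReal.ofReal (n * r) / n = ENNReal.ofReal r := by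
    rw [ENNReal.ofReal_mul (Nat.cast_nonneg n), ENNReal.ofReal_natCast, mul_comm]
    exact ENNReal.mul_div_cancel_right (by exact_mod_cast hn) (ENNReal.natCast_ne_top n)
  have h0 : Tendsto (fun n : ℕ ↦ ENNReal.ofReal r + R / n) atTop (𝓝 (ENNReal.ofReal r)) := by
    have h1 : Tendsto (fun n : ℕ ↦ R / (n : ℝ≥0∞)) atTop (𝓝 0) := by
      have := ENNReal.Tendsto.const_div ENNReal.tendsto_nat_nhds_top (Or.inr hR.ne) (a := R)
      simpa using this
    simpa using tendsto_const_nhds.add h1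
  refine tendsto_of_tendsto_of_tendsto_of_le_of_le' tendsto_const_nhds h0 ?_ ?_
  · filter_upwards [eventually_ne_atTop 0] with n hn
    rw [← e n hn]
    exact ENNReal.div_le_div_right (hl n) _
  · filter_upwards [eventually_ne_atTop 0] with n hn
    rw [← e n hn, ← ENNReal.add_div]
    exact ENNReal.div_le_div_right (hu n) _

variable {m : ℕ} {M : Type*} [TopologicalSpace M] [ChartedSpace (EuclideanSpace ℝ (Fin m)) M]
  [IsManifold (𝓡 m) ∞ M]

/-- Version of `exists_conformal_metric` for a definite seminorm. -/
theorem exists_conformal_metric_seminorm [T2Space M] [CompactSpace M] {V : Type*} [AddCommGroup V]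
    [Module ℝ V] (N : Seminorm ℝ V) (hN : ∀ u, N u = 0 → u = 0) {Ψ : C(unitInterval, M) → V}
    {ι : Type*} {γ : ι → C(ℝ, M)} [Finite ι] (g : SmoothMetric m M)
    (hΨ : IsPathCocycle Ψ) (hγ : ∀ i, IsEmbeddedLoop m (γ i))
    (hdisj : ∀ i j, i ≠ j → ∀ s t, γ i s ≠ γ j t) (hw : ∀ i, Ψ (arc (γ i) 0 1) ≠ 0) :
    ∃ g' : SmoothMetric m M, IsConformalTo g g' ∧
      (∀ (x : M) (p : Path x x), IsPiecewiseC1 m p.extend →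
        ENNReal.ofReal (N (Ψ p.toContinuousMap)) ≤ curveLength g' p.extend) ∧
      ∀ i a b, segLength g' (γ i) a b =
        ENNReal.ofReal (N (Ψ (arc (γ i) 0 1))) * ENNReal.ofReal (b - a) := by
  -- `N` itself is installed as the norm of `V`, so that comass and lengths are measured by `N`.
  let nrm : AddGroupNorm V := { N.toAddGroupSeminorm with eq_zero_of_map_eq_zero' := hN }
  let _ : NormedAddCommGroup V := nrm.toNormedAddCommGroup
  let _ : NormedSpace ℝ V := { norm_smul_le := fun a v ↦ (map_smul_eq_mul N a v).le }
  have hnorm (v : V) : ‖v‖ₑ = ENNReal.ofReal (N v) := (ofReal_norm v).symm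
  obtain ⟨g', h1, h2, h3⟩ := exists_conformal_metric g hΨ hγ hdisj hw
  refine ⟨g', h1, fun x p hp ↦ ?_, fun i a b ↦ ?_⟩
  · rw [← hnorm]; exact h2 x p hp
  · rw [← hnorm]; exact h3 i a b

/-- A negative coefficient is absorbed by passing to the opposite integral class. -/
lemma HasRationalDirection.exists_pos_smul {M : Type u} [TopologicalSpace M] {s : realH1 M}
    (h : HasRationalDirection s) (hs : s ≠ 0) :
    ∃ (w : realH1 M) (c : ℝ), IsIntegralClass w ∧ 0 < c ∧ s = c • w := by
  obtain ⟨w, hw, hsw⟩ := h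
  obtain ⟨c, rfl⟩ := Submodule.mem_span_singleton.1 hsw
  rcases lt_trichotomy c 0 with hc | rfl | hc
  · refine ⟨-w, -c, ?_, by linarith, by simp⟩
    obtain ⟨z, hz, rfl⟩ := hw
    exact ⟨-z, by rw [map_neg]; exact neg_mem hz, map_neg ((realSingularComplex M).homologyπ 1).hom z⟩
  · simp at hs
  · exact ⟨w, c, hw, hc, rfl⟩

/-- A multiple of a class represented by a closed curve of finite length. -/
lemma FlatJoinLE.nsmul {A : Type*} [AddCommGroup A] {Ψ : C(unitInterval, M) → A}
    {g : SmoothMetric m M} {x : M} {v : A} {r r₀ : ℝ≥0∞} (hΨ : IsPathCocycle Ψ)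
    (h₀ : FlatJoinLE g Ψ x x 0 r₀) (h : FlatJoinLE g Ψ x x v r) (n : ℕ) :
    FlatJoinLE g Ψ x x (n • v) (r₀ + n * r) := by
  induction n with
  | zero => simpa using h₀
  | succ n ih =>
    rw [succ_nsmul]
    refine (ih.trans hΨ h).mono (le_of_eq ?_)
    push_cast
    ring

/-- If an integral class is a nonnegative combination of linearly independent classes of loops
whose lengths are given by `N`, and `N` is additive on this combination, then `N` bounds the
lengths of its multiples up to a constant. -/
lemma exists_minLength_le {M : Type u} [TopologicalSpace M]
    [ChartedSpace (EuclideanSpace ℝ (Fin m)) M] [IsManifold (𝓡 m) ∞ M] [PathConnectedSpace M]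
    {Ψ : C(unitInterval, M) → realH1 M} (hΨ : IsPathCocycle Ψ)
    (hΨl : ∀ x (γ : Path x x), Ψ γ.toContinuousMap = loopClass γ) (g : SmoothMetric m M)
    (N : Seminorm ℝ (realH1 M)) {ι : Type*} [Fintype ι] {γ : ι → C(ℝ, M)} {b : ι → ℝ}
    (hγ : ∀ i, IsSmoothLoop m (γ i))
    (hlen : ∀ i a b, segLength g (γ i) a b =
      ENNReal.ofReal (N (Ψ (arc (γ i) 0 1))) * ENNReal.ofReal (b - a))
    (hint : ∀ i, IsIntegralClass (Ψ (arc (γ i) 0 1)))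
    (hli : LinearIndependent ℝ fun i ↦ Ψ (arc (γ i) 0 1)) (hb : ∀ i, 0 ≤ b i) {v : realH1 M}
    (hv : IsIntegralClass v) (hvb : v = ∑ i, b i • Ψ (arc (γ i) 0 1))
    (hN : ∑ i, b i * N (Ψ (arc (γ i) 0 1)) ≤ N v) :
    ∃ R < ⊤, ∀ n : ℕ, minLength g (n • v) ≤ ENNReal.ofReal (n * N v) + R := by
  have x₀ : M := Classical.arbitrary M
  have hq := exists_rat_of_integral Finset.univ b (fun i ↦ Ψ (arc (γ i) 0 1)) hint
    (by rw [Finset.coe_univ]; exact linearIndepOn_univ_iff.2 hli) hv hvb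
  obtain ⟨D, hD, hk⟩ := exists_common_denominator Finset.univ hq fun i _ ↦ hb i
  choose k hk using fun i ↦ hk i (Finset.mem_univ i)
  obtain ⟨R, hR, hsum⟩ := exists_flatJoinLE_sum g hΨ Finset.univ hγ x₀
  obtain ⟨p, hp⟩ := hv.exists_loop x₀
  obtain ⟨r, hr, hpr⟩ := exists_flatJoinLE g hΨ p
  obtain ⟨r₀, hr₀, hp₀⟩ := exists_flatJoinLE g hΨ (Path.refl x₀)
  rw [show Ψ (Path.refl x₀).toContinuousMap = 0 from hΨ.const x₀] at hp₀
  rw [hΨl, hp] at hpr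
  refine ⟨R + (r₀ + D * r), ?_, fun n ↦ ?_⟩
  · exact ENNReal.add_lt_top.2 ⟨hR, ENNReal.add_lt_top.2 ⟨hr₀,
      ENNReal.mul_lt_top (ENNReal.natCast_lt_top D) hr⟩⟩
  -- Divide `n` by `D`: the multiple of `D • v` winds around the given loops, and the remainder uses
  -- fewer than `D` copies of one fixed loop, at bounded cost.
  have h1 := (hsum fun i ↦ n / D * k i).trans hΨ (FlatJoinLE.nsmul hΨ hp₀ hpr (n % D))
  have hDv : ∑ i, k i • Ψ (arc (γ i) 0 1) = D • v := by
    rw [hvb, Finset.smul_sum]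
    refine Finset.sum_congr rfl fun i _ ↦ ?_
    rw [← Nat.cast_smul_eq_nsmul ℝ, ← Nat.cast_smul_eq_nsmul ℝ, smul_smul, hk]
  have e1 : ∑ i, (n / D * k i) • Ψ (arc (γ i) 0 1) + (n % D) • v = n • v := by
    simp only [mul_smul, ← Finset.smul_sum]
    rw [hDv, ← mul_smul, ← add_smul, Nat.div_add_mod']
  rw [e1] at h1
  refine (h1.minLength_le hΨl).trans ?_
  have e2 : ∑ i, segLength g (γ i) 0 ((n / D * k i : ℕ) : ℝ) ≤ ENNReal.ofReal (n * N v) := by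
    simp only [hlen, sub_zero]
    have e3 (i : ι) : ENNReal.ofReal (N (Ψ (arc (γ i) 0 1))) *
        ENNReal.ofReal ((n / D * k i : ℕ) : ℝ) =
        ENNReal.ofReal (((n / D * D : ℕ) : ℝ) * (b i * N (Ψ (arc (γ i) 0 1)))) := by
      rw [← ENNReal.ofReal_mul (apply_nonneg N _)]
      congr 1
      push_cast
      rw [← hk]; ring
    simp only [e3]
    rw [← ENNReal.ofReal_sum_of_nonneg fun i _ ↦ mul_nonneg (Nat.cast_nonneg _)
      (mul_nonneg (hb i) (apply_nonneg N _)), ← Finset.mul_sum]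
    refine ENNReal.ofReal_le_ofReal (mul_le_mul ?_ hN
      (Finset.sum_nonneg fun i _ ↦ mul_nonneg (hb i) (apply_nonneg N _)) (Nat.cast_nonneg n))
    exact_mod_cast Nat.div_mul_le_self n D
  have e4 : ((n % D : ℕ) : ℝ≥0∞) ≤ D := by exact_mod_cast (Nat.mod_lt n hD).le
  calc _ ≤ ENNReal.ofReal (n * N v) + R + (r₀ + D * r) := by gcongr
    _ = _ := by rw [add_assoc]

end Stable

end

/-! ### The main theorem -/

theorem mainTheorem3 {m : ℕ} (hm : 3 ≤ m) {M : Type u} [TopologicalSpace M] [T2Space M]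
    [CompactSpace M] [ConnectedSpace M] [ChartedSpace (EuclideanSpace ℝ (Fin m)) M]
    [IsManifold (𝓡 m) ∞ M] (g : SmoothMetric m M)
    (hb : 1 ≤ Module.finrank ℝ (realH1 M))
    (K : Set (realH1 M)) (hK : ∃ S : Set (realH1 M), S.Finite ∧ K = convexHull ℝ S)
    (hsymm : -K = K) (hint : (interior K).Nonempty)
    (hrat : ∀ s ∈ K.extremePoints ℝ, HasRationalDirection s) :
    ∃ g' : SmoothMetric m M, IsConformalTo g g' ∧
      ∃ N : Seminorm ℝ (realH1 M), IsStableNorm g' N ∧ {u | N u ≤ 1} = K := by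
  have : FiniteDimensional ℝ (realH1 M) := Module.finite_of_finrank_pos hb
  have : LocallyPathConnectedSpace M :=
    ChartedSpace.locallyPathConnectedSpace (EuclideanSpace ℝ (Fin m)) M
  have : PathConnectedSpace M := pathConnectedSpace_iff_connectedSpace.2 inferInstance
  obtain ⟨hfin, N, hdef, hN1, hdec⟩ :=
    exists_seminorm_of_polytope_of_isModuleTopology hK hsymm hint
  obtain ⟨Ψ, hΨ, hΨl⟩ := exists_pathCocycle_loopClass (M := M)
  have x₀ : M := Classical.arbitrary M
  -- Nonvanishing is part of the index, so it need not be derived from the geometry of `K`; the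
  -- vertices in a decomposition are nonzero by independence.
  let ι := {s : realH1 M // s ∈ K.extremePoints ℝ ∧ s ≠ 0}
  have : Finite ι := (hfin.subset fun s hs ↦ hs.1 :
    (Set.ofPred fun s ↦ s ∈ K.extremePoints ℝ ∧ s ≠ 0).Finite)
  choose w c hw hc hwc using fun s : ι ↦ (hrat s s.2.1).exists_pos_smul s.2.2
  choose p hp using fun s : ι ↦ (hw s).exists_loop x₀
  obtain ⟨γ, hγ, hγp, hdisj⟩ := exists_disjoint_embedded hm hΨ p
  have hγw (s : ι) : Ψ (arc (γ s) 0 1) = w s := by rw [hγp, hΨl, hp]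
  have hw0 (s : ι) : w s ≠ 0 := fun h ↦ s.2.2 (by rw [hwc s, h, smul_zero])
  obtain ⟨g', hg', hlow, hlen⟩ := exists_conformal_metric_seminorm N hdef g hΨ hγ hdisj
    fun s ↦ by rw [hγw]; exact hw0 s
  refine ⟨g', hg', N, ⟨hdef, fun v hv ↦ ?_⟩, Set.ext hN1⟩
  obtain ⟨n, z, a, hz, hli, ha, hva, haN⟩ := hdec v
  let σ : Fin n → ι := fun i ↦ ⟨z i, hz i, hli.ne_zero i⟩
  have hzw (i : Fin n) : z i = c (σ i) • w (σ i) := hwc (σ i)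
  have hliw : LinearIndependent ℝ fun i ↦ w (σ i) := by
    have h1 := hli.units_smul fun i ↦ (Units.mk0 (c (σ i)) (hc _).ne')⁻¹
    convert h1 using 1
    ext1 i
    change _ = (Units.mk0 (c (σ i)) (hc _).ne')⁻¹ • z i
    rw [hzw i, Units.smul_def, smul_smul]
    simp [(hc (σ i)).ne']
  -- In terms of the integral classes the coefficient of a vertex is multiplied by its scale `c`.
  -- Vertices have norm at most one, so the weighted sum of norms is at most the sum of the `a i`,
  -- which is `N v`.
  obtain ⟨R, hR, hup⟩ := exists_minLength_le (b := fun i ↦ a i * c (σ i)) hΨ hΨl g' N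
    (fun i ↦ (hγ (σ i)).toIsSmoothLoop) (fun i ↦ hlen (σ i)) (fun i ↦ by rw [hγw]; exact hw _)
    (by simpa only [hγw] using hliw) (fun i ↦ mul_nonneg (ha i) (hc _).le) hv
    (by
      rw [hva]
      refine Finset.sum_congr rfl fun i _ ↦ ?_
      rw [hγw, mul_smul, ← hzw])
    (by
      rw [← haN]
      refine Finset.sum_le_sum fun i _ ↦ ?_
      have h1 : N (z i) = c (σ i) * N (w (σ i)) := by
        rw [hzw i, map_smul_eq_mul, Real.norm_of_nonneg (hc _).le]
      rw [hγw, mul_assoc, ← h1]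
      exact mul_le_of_le_one_right (ha i) ((hN1 _).2 (hz i).1))
  refine tendsto_div_of_bounded_excess hR (fun k ↦ ?_) hup
  refine le_iInf fun x ↦ le_iInf fun q ↦ le_iInf fun hq ↦ le_iInf fun hqv ↦ ?_
  have h1 := hlow x q hq
  rw [hΨl, hqv, ← Nat.cast_smul_eq_nsmul ℝ, map_smul_eq_mul, Real.norm_natCast] at h1
  exact h1
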